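/- **Proposition 4.5 (Extension operators).** Let $a<1$, $\lambda(z)=z^a$ and $\nu=\frac{1-a}{2-a}\in(0,1)$. Let $\Omega$ be either the torus $\mathbb{T}^2=(\mathbb{R}/2\pi\mathbb{Z})^2$ or a non-empty bounded convex open set in $\mathbb{R}^2$. The lateral condition (A) for a function on $\Omega$ means: integral $0$ if $\Omega=\mathbb{T}^2$; membership in $H^1_0(\Omega)$ (vanishing on $\partial\Omega$) if $\Omega$ is convex. A function $\Psi$ on $\mathbb{R}_+\times\Omega$ satisfies (A) if $\Psi(z,\cdot)$ does for a.e. $z>0$. Write $\nabla_{\sqrt\lambda}=(\sqrt\lambda\,\partial_z,\partial_{x_1},\partial_{x_2})$ and $\Delta_\lambda=\partial_z\lambda\partial_z+\partial_{x_1}^2+\partial_{x_2}^2$. Let $\mathcal{H}$ be the space of all $\Psi\in L^2(\mathbb{R}_+\times\Omega)$ satisfying (A) with $\nabla_{\sqrt\lambda}\Psi\in L^2(\mathbb{R}_+\times\Omega)$ (weak derivatives), with norm $\|\Psi\|_{\mathcal{H}}=\|\Psi\|_{L^2}+\|\nabla_{\sqrt\lambda}\Psi\|_{L^2}$. Let $(e_i)$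 be an orthonormal basis of $L^2(\Omega)$ (of its subspace of functions with integral $0$ if $\Omega=\mathbb{T}^2$) made of eigenfunctions of $-\Delta$ on $\Omega$ with condition (A), with eigenvalues $k_i$. For $s\in(-1,1)$ let $\dot H^s(\Omega)$ be the space of formal series $\theta=\sum_i\theta_ie_i$ with $\|\theta\|_{\dot H^s(\Omega)}^2=\sum_i k_i^s\theta_i^2<\infty$. Call $\Psi\in\mathcal{H}$ a *Neumann extension* of $\theta\in\dot H^{-\nu}(\Omega)$ if $\Delta_\lambda\Psi=0$ in $\mathbb{R}_+\times\Omega$ in the sense of distributions and $-\lambda\partial_z\Psi(z,\cdot)\to\theta$ in $\dot H^{-\nu}(\Omega)$ as $z\to0^+$. Call $\Psi\in\mathcal{H}$ a *Dirichlet extension* of $h\in\dot H^{\nu}(\Omega)$ if $\Delta_\lambda\Psi=0$ in the sense of distributions and $\Psi(z,\cdot)\to h$ in $L^2(\Omega)$ as $z\to0^+$. (Both limits are essential limits in $z$.) Then there is a constant $\kappa>0$ depending only on $a$, with $\kappa=1$ if $a=0$, such that for every such $\Omega$ and $(e_i)$ there are bounded linear operators $E_1:\dot H^{-\nu}(\Omega)\to\mathcal{H}$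 and $E_2:\dot H^{\nu}(\Omega)\to\mathcal{H}$ for which 1. for every $\theta\in\dot H^{-\nu}(\Omega)$, $E_1(\theta)$ is the unique Neumann extension of $\theta$ in $\mathcal{H}$; 2. for every $h\in\dot H^{\nu}(\Omega)$, $E_2(h)$ is the unique Dirichlet extension of $h$ in $\mathcal{H}$; 3. for all such $\theta$ and $h$, $$\iint_{\mathbb{R}_+\times\Omega}|\nabla_{\sqrt\lambda}E_1(\theta)|^2\,dx\,dz=\kappa^{-1}\|\theta\|_{\dot H^{-\nu}(\Omega)}^2,\qquad \iint_{\mathbb{R}_+\times\Omega}|\nabla_{\sqrt\lambda}E_2(h)|^2\,dx\,dz=\kappa\,\|h\|_{\dot H^{\nu}(\Omega)}^2 .$$ -/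

import Mathlib

open MeasureTheory Set Filter Topology
open scoped ContDiff

noncomputable section

namespace SingularQG

/-- The horizontal plane `ℝ²`, with its Euclidean structure. -/
abbrev Plane : Type := EuclideanSpace ℝ (Fin 2)

/-- The horizontal domain `Ω`: either the flat torus `𝕋² = (ℝ / 2πℤ)²`, or a bounded convex domain
of the plane. -/
inductive HorizontalDomain : Type
  | torus : HorizontalDomain
  | convex (Ω : Set Plane) (isOpen : IsOpen Ω) (nonempty : Ω.Nonempty)
      (isBounded : Bornology.IsBounded Ω) (isConvex : Convex ℝ Ω) : HorizontalDomain

/-- The set over which one integrates: the period cell `(0, 2π)²` for the torus, `Ω` itself for a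
convex domain. Functions on the torus are handled through their values on the cell; their
periodicity is encoded by testing against all smooth periodic functions. -/
def HorizontalDomain.carrier : HorizontalDomain → Set Plane
  | .torus => {x | ∀ j, x j ∈ Ioo (0 : ℝ) (2 * Real.pi)}
  | .convex Ω _ _ _ _ => Ω

/-- Lebesgue measure on `Ω`. -/
def HorizontalDomain.measure (D : HorizontalDomain) : Measure Plane :=
  volume.restrict D.carrier

/-- Lebesgue measure `dz dx` on the cylinder `ℝ₊ × Ω`; points are written `(z, x)`. -/
def HorizontalDomain.cylMeasure (D : HorizontalDomain) : Measure (ℝ × Plane) :=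
  (volume.restrict (Ioi (0 : ℝ))).prod D.measure

/-- `L²(Ω)`. -/
abbrev L2 (D : HorizontalDomain) : Type := Lp ℝ 2 D.measure

/-- `L²(ℝ₊ × Ω)`. -/
abbrev L2Cyl (D : HorizontalDomain) : Type := Lp ℝ 2 D.cylMeasure

/-- The unit vector in the direction `x_j`. -/
def unitVec (j : Fin 2) : Plane := EuclideanSpace.single j (1 : ℝ)

/-- The partial derivative `∂_{x_j} φ` of a smooth function of `x`. -/
def pderiv (j : Fin 2) (φ : Plane → ℝ) (x : Plane) : ℝ := fderiv ℝ φ x (unitVec j)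

/-- The direction, in `ℝ × ℝ²`, of the `i`-th coordinate of `(z, x₁, x₂)`. -/
def cylVec : Fin 3 → ℝ × Plane
  | 0 => (1, 0)
  | 1 => (0, unitVec 0)
  | 2 => (0, unitVec 1)

/-- The partial derivatives `∂_z φ`, `∂_{x₁} φ`, `∂_{x₂} φ` (for `i = 0, 1, 2`) of a smooth function
of `(z, x)`. -/
def cylDeriv (i : Fin 3) (φ : ℝ × Plane → ℝ) (p : ℝ × Plane) : ℝ := fderiv ℝ φ p (cylVec i)

/-- Test functions on `Ω`: the smooth functions on the torus, that is the smooth `2π`-periodic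
functions on the plane; resp. `C_c^∞(Ω)`. -/
def IsTest : HorizontalDomain → (Plane → ℝ) → Prop
  | .torus, φ => ContDiff ℝ ∞ φ ∧ ∀ x j, φ (x + (2 * Real.pi) • unitVec j) = φ x
  | .convex Ω _ _ _ _, φ => ContDiff ℝ ∞ φ ∧ HasCompactSupport φ ∧ tsupport φ ⊆ Ω

/-- Test functions `C_c^∞(ℝ₊ × Ω)` on the open cylinder; for the torus these are smooth, `2π`-periodic
in `x`, and supported in some slab `0 < ε ≤ z ≤ R`. -/
def IsCylTest : HorizontalDomain → (ℝ × Plane → ℝ) → Prop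
  | .torus, φ => ContDiff ℝ ∞ φ ∧
      (∀ z x j, φ (z, x + (2 * Real.pi) • unitVec j) = φ (z, x)) ∧
      ∃ ε R : ℝ, 0 < ε ∧ ∀ z x, z ∉ Icc ε R → φ (z, x) = 0
  | .convex Ω _ _ _ _, φ => ContDiff ℝ ∞ φ ∧ HasCompactSupport φ ∧ tsupport φ ⊆ Ioi (0 : ℝ) ×ˢ Ω

/-- `u ∈ H¹₀(Ω)`, for an open set `Ω`: `u` is a limit in `H¹(Ω)` of functions in `C_c^∞(Ω)`. For a
Lipschitz (in particular a convex) domain this is the kernel of the trace on `∂Ω`. -/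
def MemH10 (Ω : Set Plane) (u : Plane → ℝ) : Prop :=
  MemLp u 2 (volume.restrict Ω) ∧
  ∃ (φ : ℕ → Plane → ℝ) (g : Fin 2 → Plane → ℝ),
    (∀ n, ContDiff ℝ ∞ (φ n) ∧ HasCompactSupport (φ n) ∧ tsupport (φ n) ⊆ Ω) ∧
    (∀ j, MemLp (g j) 2 (volume.restrict Ω)) ∧
    Tendsto (fun n => eLpNorm (φ n - u) 2 (volume.restrict Ω)) atTop (𝓝 0) ∧
    ∀ j, Tendsto (fun n => eLpNorm (pderiv j (φ n) - g j) 2 (volume.restrict Ω)) atTop (𝓝 0)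

/-- The lateral condition (A) for a function `u` of `x` alone: integral `0` on the torus (periodicity
being built into functions on the torus); vanishing on `∂Ω` for a convex domain. -/
def LateralCondition : HorizontalDomain → (Plane → ℝ) → Prop
  | .torus, u => ∫ x, u x ∂(HorizontalDomain.torus.measure) = 0
  | .convex Ω _ _ _ _, u => MemH10 Ω u

/-- `g` is the weak gradient of `u` on `Ω`. -/
def IsWeakGradient (D : HorizontalDomain) (u : L2 D) (g : Fin 2 → L2 D) : Prop :=
  ∀ φ, IsTest D φ → ∀ j, ∫ x, u x * pderiv j φ x ∂D.measure = - ∫ x, g j x * φ x ∂D.measure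

/-- The weights `(λ^{1/2}, 1, 1)` of `∇_{√λ} = (√λ ∂_z, ∂_{x₁}, ∂_{x₂})`, at height `z`, with
`λ(z) = z^a`. -/
def sqrtWeight (a : ℝ) (i : Fin 3) (z : ℝ) : ℝ := if i = 0 then z ^ (a / 2) else 1

/-- `G = ∇_{√λ} Ψ` weakly on `ℝ₊ × Ω`: the weak derivatives of `Ψ` are
`∂_z Ψ = λ^{-1/2} G₀`, `∂_{x₁} Ψ = G₁`, `∂_{x₂} Ψ = G₂`. Such a `G` is unique if it exists. -/
def IsWeightedGradient (D : HorizontalDomain) (a : ℝ) (Ψ : L2Cyl D) (G : Fin 3 → L2Cyl D) : Prop :=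
  ∀ φ, IsCylTest D φ → ∀ i,
    ∫ p, Ψ p * cylDeriv i φ p ∂D.cylMeasure
      = - ∫ p, G i p * ((sqrtWeight a i p.1)⁻¹ * φ p) ∂D.cylMeasure

/-- The lateral condition (A) for a function of `(z, x)`: it holds on almost every horizontal slice. -/
def CylLateralCondition (D : HorizontalDomain) (Ψ : L2Cyl D) : Prop :=
  ∀ᵐ z ∂(volume.restrict (Ioi (0 : ℝ))), LateralCondition D (fun x => Ψ (z, x))

lemma carrier_isBounded (D : HorizontalDomain) : Bornology.IsBounded D.carrier := by
  cases D with
  | convex Ω h1 h2 h3 h4 => exact h3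
  | torus =>
    refine (Metric.isBounded_iff_subset_closedBall (0 : Plane)).2 ⟨2 * (2 * Real.pi), ?_⟩
    intro x hx
    have hpi := Real.pi_pos
    have h0 := hx 0
    have h1 := hx 1
    simp only [mem_Ioo] at h0 h1
    rw [mem_closedBall_zero_iff, EuclideanSpace.norm_eq, Real.sqrt_le_left (by positivity)]
    simp only [Fin.sum_univ_two, Real.norm_eq_abs, sq_abs]
    nlinarith

lemma cylMeasure_eq (D : HorizontalDomain) :
    D.cylMeasure = volume.restrict (Ioi (0 : ℝ) ×ˢ D.carrier) := by
  rw [HorizontalDomain.cylMeasure, HorizontalDomain.measure, Measure.prod_restrict]; rfl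

lemma measurableSet_carrier (D : HorizontalDomain) : MeasurableSet D.carrier := by
  cases D with
  | convex Ω h1 h2 h3 h4 => exact h1.measurableSet
  | torus =>
    have : IsOpen {x : Plane | ∀ j, x j ∈ Ioo (0 : ℝ) (2 * Real.pi)} := by
      simp only [ofPred_forall]
      exact isOpen_iInter_of_finite fun j => isOpen_Ioo.preimage (by fun_prop)
    exact this.measurableSet

instance isFiniteMeasure_measure (D : HorizontalDomain) : IsFiniteMeasure D.measure :=
  ⟨by simpa [HorizontalDomain.measure] using (carrier_isBounded D).measure_lt_top⟩

lemma slab_of_isCylTest {D : HorizontalDomain} {φ : ℝ × Plane → ℝ} (h : IsCylTest D φ) :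
    ∃ ε R : ℝ, 0 < ε ∧ ∀ z x, z ∉ Icc ε R → φ (z, x) = 0 := by
  cases D with
  | torus => exact h.2.2
  | convex Ω h1 h2 h3 h4 =>
    obtain ⟨hc, hK, hs⟩ := h
    by_cases hne : (tsupport φ).Nonempty
    · have hK' : IsCompact (tsupport φ) := hK
      obtain ⟨p, hp, hpmin⟩ := hK'.exists_isMinOn hne (continuous_fst.continuousOn)
      obtain ⟨q, hq, hqmax⟩ := hK'.exists_isMaxOn hne (continuous_fst.continuousOn)
      refine ⟨p.1, q.1, (hs hp).1, fun z x hz => ?_⟩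
      by_contra hne0
      have hmem : (z, x) ∈ tsupport φ := subset_tsupport φ hne0
      exact hz ⟨hpmin hmem, hqmax hmem⟩
    · refine ⟨1, 1, one_pos, fun z x _ => ?_⟩
      by_contra hne0
      exact hne ⟨_, subset_tsupport φ hne0⟩

lemma memLp_of_slab (D : HorizontalDomain) {f : ℝ × Plane → ℝ} {ε R : ℝ}
    (hm : Measurable f) (hc : ContinuousOn f (Icc ε R ×ˢ closure D.carrier))
    (h0 : ∀ z x, z ∉ Icc ε R → f (z, x) = 0) : MemLp f 2 D.cylMeasure := by
  have hcomp : IsCompact (Icc ε R ×ˢ closure D.carrier) :=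
    isCompact_Icc.prod (carrier_isBounded D).isCompact_closure
  obtain ⟨C, hC⟩ := hcomp.exists_bound_of_continuousOn hc
  have hC' : 0 ≤ |C| := abs_nonneg C
  set S : Set (ℝ × Plane) := Icc ε R ×ˢ D.carrier with hS
  have hSm : MeasurableSet S := measurableSet_Icc.prod (measurableSet_carrier D)
  have hSfin : D.cylMeasure S ≠ ⊤ := by
    rw [cylMeasure_eq]
    refine ne_top_of_le_ne_top ?_ (Measure.restrict_apply_le _ S)
    exact ((hcomp.isBounded.subset (prod_mono_right subset_closure)).measure_lt_top).ne
  refine MemLp.mono (memLp_indicator_const 2 hSm |C| (Or.inr hSfin)) hm.aestronglyMeasurable ?_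
  have hae : ∀ᵐ p ∂D.cylMeasure, p ∈ Ioi (0 : ℝ) ×ˢ D.carrier := by
    rw [cylMeasure_eq]
    exact ae_restrict_mem (measurableSet_Ioi.prod (measurableSet_carrier D))
  filter_upwards [hae] with p hp
  by_cases hz : p.1 ∈ Icc ε R
  · have hpS : p ∈ S := ⟨hz, hp.2⟩
    rw [indicator_of_mem hpS]
    simpa using (hC p ⟨hz, subset_closure hp.2⟩).trans (le_abs_self C)
  · rw [show f p = 0 from h0 p.1 p.2 hz]
    simp

lemma memLp_cylDeriv {D : HorizontalDomain} {φ : ℝ × Plane → ℝ} (h : IsCylTest D φ) (i : Fin 3) :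
    MemLp (cylDeriv i φ) 2 D.cylMeasure := by
  obtain ⟨ε, R, hε, hz⟩ := slab_of_isCylTest h
  have hs : ContDiff ℝ ∞ φ := by cases D <;> exact h.1
  have hcont : Continuous (cylDeriv i φ) :=
    (hs.continuous_fderiv (by simp)).clm_apply continuous_const
  refine memLp_of_slab D (ε := ε) (R := R) hcont.measurable hcont.continuousOn fun z x hzx => ?_
  have : φ =ᶠ[𝓝 (z, x)] fun _ => 0 := by
    have hopen : IsOpen {p : ℝ × Plane | p.1 ∉ Icc ε R} :=
      (isClosed_Icc.preimage continuous_fst).isOpen_compl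
    filter_upwards [hopen.mem_nhds hzx] with p hp using hz p.1 p.2 hp
  simp [cylDeriv, this.fderiv_eq]

lemma memLp_weight_mul {D : HorizontalDomain} {φ : ℝ × Plane → ℝ} (h : IsCylTest D φ) (a : ℝ)
    (i : Fin 3) : MemLp (fun p => (sqrtWeight a i p.1)⁻¹ * φ p) 2 D.cylMeasure := by
  obtain ⟨ε, R, hε, hz⟩ := slab_of_isCylTest h
  have hs : ContDiff ℝ ∞ φ := by cases D <;> exact h.1
  refine memLp_of_slab D (ε := ε) (R := R) ?_ ?_ fun z x hzx => by simp [hz z x hzx]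
  · have : Measurable (sqrtWeight a i) := by
      unfold sqrtWeight
      split_ifs <;> fun_prop
    exact ((this.comp measurable_fst).inv).mul hs.continuous.measurable
  · refine ContinuousOn.mul ?_ hs.continuous.continuousOn
    unfold sqrtWeight
    split_ifs
    · refine ContinuousOn.inv₀ (ContinuousOn.rpow_const continuous_fst.continuousOn ?_) ?_
      · exact fun p hp => Or.inl (hε.trans_le hp.1.1).ne'
      · exact fun p hp => (Real.rpow_pos_of_pos (hε.trans_le hp.1.1) _).ne'
    · exact continuousOn_const

lemma isWeightedGradient_add {D : HorizontalDomain} {a : ℝ} {Ψ Φ : L2Cyl D} {G H : Fin 3 → L2Cyl D}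
    (h₁ : IsWeightedGradient D a Ψ G) (h₂ : IsWeightedGradient D a Φ H) :
    IsWeightedGradient D a (Ψ + Φ) (G + H) := by
  intro φ hφ i
  have e (F K : L2Cyl D) (w : ℝ × Plane → ℝ) (hw : MemLp w 2 D.cylMeasure) :
      ∫ p, (F + K) p * w p ∂D.cylMeasure
        = ∫ p, F p * w p ∂D.cylMeasure + ∫ p, K p * w p ∂D.cylMeasure := by
    have hF : Integrable (fun p => F p * w p) D.cylMeasure := (Lp.memLp F).integrable_mul hw
    have hK : Integrable (fun p => K p * w p) D.cylMeasure := (Lp.memLp K).integrable_mul hw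
    rw [← integral_add hF hK]
    refine integral_congr_ae ?_
    filter_upwards [Lp.coeFn_add F K] with p hp
    rw [hp, Pi.add_apply, add_mul]
  rw [e _ _ _ (memLp_cylDeriv hφ i), Pi.add_apply, e _ _ _ (memLp_weight_mul hφ a i),
    h₁ φ hφ i, h₂ φ hφ i, neg_add]

lemma isWeightedGradient_smul {D : HorizontalDomain} {a : ℝ} {Ψ : L2Cyl D} {G : Fin 3 → L2Cyl D}
    (c : ℝ) (h : IsWeightedGradient D a Ψ G) : IsWeightedGradient D a (c • Ψ) (c • G) := by
  intro φ hφ i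
  have e (F : L2Cyl D) (w : ℝ × Plane → ℝ) :
      ∫ p, (c • F) p * w p ∂D.cylMeasure = c * ∫ p, F p * w p ∂D.cylMeasure := by
    rw [← integral_const_mul]
    refine integral_congr_ae ?_
    filter_upwards [Lp.coeFn_smul c F] with p hp
    simp [hp, mul_assoc]
  rw [e, Pi.smul_apply, e, h φ hφ i, mul_neg]

lemma LateralCondition.congr {D : HorizontalDomain} {u v : Plane → ℝ} (huv : u =ᵐ[D.measure] v)
    (hu : LateralCondition D u) : LateralCondition D v := by
  cases D with
  | torus => exact (integral_congr_ae huv).symm.trans hu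
  | convex Ω h1 h2 h3 h4 =>
    obtain ⟨hL, φ, g, hφ, hg, hlim, hlim'⟩ := hu
    refine ⟨(memLp_congr_ae huv).1 hL, φ, g, hφ, hg, ?_, hlim'⟩
    refine hlim.congr fun n => eLpNorm_congr_ae ?_
    filter_upwards [huv] with x hx
    simp [hx]

lemma pderiv_add {φ ψ : Plane → ℝ} (hφ : ContDiff ℝ ∞ φ) (hψ : ContDiff ℝ ∞ ψ) (j : Fin 2) :
    pderiv j (φ + ψ) = pderiv j φ + pderiv j ψ := by
  funext x
  simp only [pderiv, Pi.add_apply]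
  rw [fderiv_add (hφ.differentiable (by simp) x) (hψ.differentiable (by simp) x)]
  rfl

lemma pderiv_smul (c : ℝ) {φ : Plane → ℝ} (hφ : ContDiff ℝ ∞ φ) (j : Fin 2) :
    pderiv j (c • φ) = c • pderiv j φ := by
  funext x
  simp only [pderiv, Pi.smul_apply]
  rw [fderiv_const_smul (hφ.differentiable (by simp) x) c]
  rfl

lemma continuous_pderiv {φ : Plane → ℝ} (hφ : ContDiff ℝ ∞ φ) (j : Fin 2) :
    Continuous (pderiv j φ) :=
  (hφ.continuous_fderiv (by simp)).clm_apply continuous_const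

lemma LateralCondition.add {D : HorizontalDomain} {u v : Plane → ℝ} (hu2 : MemLp u 2 D.measure)
    (hv2 : MemLp v 2 D.measure) (hu : LateralCondition D u) (hv : LateralCondition D v) :
    LateralCondition D (u + v) := by
  cases D with
  | torus =>
    have h1 := hu2.integrable (by norm_num)
    have h2 := hv2.integrable (by norm_num)
    have hu' : ∫ x, u x ∂(HorizontalDomain.torus.measure) = 0 := hu
    have hv' : ∫ x, v x ∂(HorizontalDomain.torus.measure) = 0 := hv
    change ∫ x, (u + v) x ∂(HorizontalDomain.torus.measure) = 0
    simp only [Pi.add_apply]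
    rw [integral_add h1 h2, hu', hv', add_zero]
  | convex Ω h1 h2 h3 h4 =>
    obtain ⟨hL, φ, g, hφ, hg, hlim, hlim'⟩ := hu
    obtain ⟨hM, ψ, k, hψ, hk, lim, lim'⟩ := hv
    have key (f₁ f₂ : ℕ → Plane → ℝ) (w₁ w₂ : Plane → ℝ)
        (c₁ : ∀ n, Continuous (f₁ n)) (c₂ : ∀ n, Continuous (f₂ n))
        (m₁ : MemLp w₁ 2 (volume.restrict Ω)) (m₂ : MemLp w₂ 2 (volume.restrict Ω))
        (l₁ : Tendsto (fun n => eLpNorm (f₁ n - w₁) 2 (volume.restrict Ω)) atTop (𝓝 0))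
        (l₂ : Tendsto (fun n => eLpNorm (f₂ n - w₂) 2 (volume.restrict Ω)) atTop (𝓝 0)) :
        Tendsto (fun n => eLpNorm (f₁ n + f₂ n - (w₁ + w₂)) 2 (volume.restrict Ω)) atTop (𝓝 0) := by
      have hsum := l₁.add l₂
      rw [add_zero] at hsum
      refine tendsto_of_tendsto_of_tendsto_of_le_of_le tendsto_const_nhds hsum
        (fun _ => bot_le) fun n => ?_
      rw [add_sub_add_comm]
      exact eLpNorm_add_le ((c₁ n).aestronglyMeasurable.sub m₁.1)
        ((c₂ n).aestronglyMeasurable.sub m₂.1) (by norm_num)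
    refine ⟨hL.add hM, fun n => φ n + ψ n, fun j => g j + k j, fun n => ⟨?_, ?_, ?_⟩,
      fun j => (hg j).add (hk j), ?_, fun j => ?_⟩
    · exact (hφ n).1.add (hψ n).1
    · exact (hφ n).2.1.add (hψ n).2.1
    · exact (tsupport_add (φ n) (ψ n)).trans (union_subset (hφ n).2.2 (hψ n).2.2)
    · exact key _ _ _ _ (fun n => (hφ n).1.continuous) (fun n => (hψ n).1.continuous) hL hM hlim lim
    · have := key _ _ _ _ (fun n => continuous_pderiv (hφ n).1 j)
        (fun n => continuous_pderiv (hψ n).1 j) (hg j) (hk j) (hlim' j) (lim' j)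
      refine this.congr fun n => ?_
      rw [pderiv_add (hφ n).1 (hψ n).1]

lemma LateralCondition.smul {D : HorizontalDomain} {u : Plane → ℝ} (c : ℝ)
    (hu : LateralCondition D u) : LateralCondition D (c • u) := by
  cases D with
  | torus =>
    have hu' : ∫ x, u x ∂(HorizontalDomain.torus.measure) = 0 := hu
    change ∫ x, (c • u) x ∂(HorizontalDomain.torus.measure) = 0
    simp only [Pi.smul_apply, smul_eq_mul]
    rw [integral_const_mul, hu', mul_zero]
  | convex Ω h1 h2 h3 h4 =>
    obtain ⟨hL, φ, g, hφ, hg, hlim, hlim'⟩ := hu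
    have key (f : ℕ → Plane → ℝ) (w : Plane → ℝ)
        (l : Tendsto (fun n => eLpNorm (f n - w) 2 (volume.restrict Ω)) atTop (𝓝 0)) :
        Tendsto (fun n => eLpNorm (c • f n - c • w) 2 (volume.restrict Ω)) atTop (𝓝 0) := by
      have := ENNReal.Tendsto.const_mul (a := ‖c‖ₑ) l (Or.inr enorm_ne_top)
      rw [mul_zero] at this
      refine this.congr fun n => ?_
      rw [← smul_sub, eLpNorm_const_smul]
    refine ⟨hL.const_smul c, fun n => c • φ n, fun j => c • g j, fun n => ⟨?_, ?_, ?_⟩,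
      fun j => (hg j).const_smul c, key _ _ hlim, fun j => ?_⟩
    · exact (hφ n).1.const_smul c
    · exact (hφ n).2.1.smul_left
    · exact (closure_mono (Function.support_const_smul_subset c (φ n))).trans (hφ n).2.2
    · refine (key _ _ (hlim' j)).congr fun n => ?_
      rw [pderiv_smul c (hφ n).1]

lemma lateralCondition_zero (D : HorizontalDomain) : LateralCondition D 0 := by
  cases D with
  | torus => exact integral_zero _ _
  | convex Ω h1 h2 h3 h4 =>
    refine ⟨MemLp.zero, fun _ => 0, fun _ => 0, fun n => ⟨contDiff_const, HasCompactSupport.zero, ?_⟩,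
      fun j => MemLp.zero, ?_, fun j => ?_⟩
    · simp
    · simp
    · have : pderiv j (0 : Plane → ℝ) = 0 := by
        funext x; simp [pderiv]
      simp [this]

lemma memLp_slice {D : HorizontalDomain} (Ψ : L2Cyl D) :
    ∀ᵐ z ∂(volume.restrict (Ioi (0 : ℝ))), MemLp (fun x => Ψ (z, x)) 2 D.measure := by
  have hsm := Lp.stronglyMeasurable Ψ
  have h : Integrable (fun p => ‖Ψ p‖ ^ 2) D.cylMeasure :=
    (memLp_two_iff_integrable_sq_norm hsm.aestronglyMeasurable).1 (Lp.memLp Ψ)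
  filter_upwards [h.prod_right_ae] with z hz
  exact (memLp_two_iff_integrable_sq_norm
    (hsm.comp_measurable measurable_prodMk_left).aestronglyMeasurable).2 hz

lemma slice_ae {D : HorizontalDomain} {f g : ℝ × Plane → ℝ} (h : f =ᵐ[D.cylMeasure] g) :
    ∀ᵐ z ∂(volume.restrict (Ioi (0 : ℝ))),
      (fun x => f (z, x)) =ᵐ[D.measure] fun x => g (z, x) :=
  Measure.ae_ae_of_ae_prod h

/-- The space `𝓗` of all `Ψ` on `ℝ₊ × Ω` with `∇_{√λ} Ψ ∈ L²(ℝ₊ × Ω)` that satisfy the lateral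
condition (A). -/
def SobolevH (D : HorizontalDomain) (a : ℝ) : Submodule ℝ (L2Cyl D) where
  carrier := {Ψ | (∃ G : Fin 3 → L2Cyl D, IsWeightedGradient D a Ψ G) ∧ CylLateralCondition D Ψ}
  zero_mem' := by
    refine ⟨⟨0, ?_⟩, ?_⟩
    · have h : ∀ w : ℝ × Plane → ℝ, ∫ p, (0 : L2Cyl D) p * w p ∂D.cylMeasure = 0 := fun w => by
        refine integral_eq_zero_of_ae ?_
        filter_upwards [Lp.coeFn_zero ℝ 2 D.cylMeasure] with p hp
        rw [hp]
        simp
      intro φ _ i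
      rw [h, Pi.zero_apply, h, neg_zero]
    · filter_upwards [slice_ae (Lp.coeFn_zero ℝ 2 D.cylMeasure)] with z hz
      exact (lateralCondition_zero D).congr hz.symm
  add_mem' := by
    rintro Ψ Φ ⟨⟨G, hG⟩, hΨ⟩ ⟨⟨H, hH⟩, hΦ⟩
    refine ⟨⟨G + H, isWeightedGradient_add hG hH⟩, ?_⟩
    filter_upwards [slice_ae (Lp.coeFn_add Ψ Φ), memLp_slice Ψ, memLp_slice Φ, hΨ, hΦ]
      with z hz m₁ m₂ h₁ h₂
    exact (h₁.add m₁ m₂ h₂).congr hz.symm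
  smul_mem' := by
    rintro c Ψ ⟨⟨G, hG⟩, hΨ⟩
    refine ⟨⟨c • G, isWeightedGradient_smul c hG⟩, ?_⟩
    filter_upwards [slice_ae (Lp.coeFn_smul c Ψ), hΨ] with z hz h₁
    exact (h₁.smul c).congr hz.symm

/-- `∇_{√λ} Ψ`, for `Ψ ∈ 𝓗`. -/
def weightedGradient {D : HorizontalDomain} {a : ℝ} (Ψ : SobolevH D a) : Fin 3 → L2Cyl D :=
  Ψ.2.1.choose

/-- The weighted Dirichlet energy `∬ |∇_{√λ} Ψ|² dx dz`. -/
def energy {D : HorizontalDomain} {a : ℝ} (Ψ : SobolevH D a) : ℝ :=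
  ∫ p, ∑ i, (weightedGradient Ψ i p) ^ 2 ∂D.cylMeasure

/-- The norm `‖Ψ‖_𝓗 = ‖Ψ‖_{L²} + ‖∇_{√λ} Ψ‖_{L²}`. -/
def normH {D : HorizontalDomain} {a : ℝ} (Ψ : SobolevH D a) : ℝ :=
  ‖(Ψ : L2Cyl D)‖ + √(energy Ψ)

/-- `e` is an orthonormal basis of `L²(Ω)` (of its subspace of functions with integral `0` in the
case of the torus) consisting of eigenfunctions of `-Δ_Ω` with the lateral condition (A), and
`k` is the sequence of their eigenvalues: `e i ∈ H¹(Ω)` satisfies (A) and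
`∫ ∇e_i · ∇φ = k_i ∫ e_i φ` for all test functions. -/
structure IsEigenbasis (D : HorizontalDomain) (e : ℕ → L2 D) (k : ℕ → ℝ) : Prop where
  orthonormal : Orthonormal ℝ e
  lateral : ∀ i, LateralCondition D (e i)
  eigen : ∀ i, ∃ g : Fin 2 → L2 D, IsWeakGradient D (e i) g ∧
    ∀ φ, IsTest D φ →
      ∑ j, ∫ x, g j x * pderiv j φ x ∂D.measure = k i * ∫ x, e i x * φ x ∂D.measure
  complete : ∀ u : L2 D, (D = .torus → ∫ x, u x ∂D.measure = 0) →
    (∀ i, inner ℝ (e i) u = 0) → u = 0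

/-- The homogeneous space `Ḣ^s(Ω)`, where `k` is the sequence of eigenvalues: the formal expansions
`θ = ∑ θ_i e_i` for which `(k_i^{s/2} θ_i)_i` is square summable. An element is given by the
sequence of its coefficients `θ_i`. -/
def HDot (k : ℕ → ℝ) (s : ℝ) : Submodule ℝ (ℕ → ℝ) where
  carrier := {θ | Memℓp (fun i => k i ^ (s / 2) * θ i) 2}
  zero_mem' := by
    refine (congrArg (fun f : ℕ → ℝ => Memℓp f 2) ?_).mp (zero_memℓp : Memℓp (0 : ∀ _ : ℕ, ℝ) 2)
    funext i
    simp
  add_mem' := by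
    intro θ η hθ hη
    have := Memℓp.add hθ hη
    refine (congrArg (fun f : ℕ → ℝ => Memℓp f 2) ?_).mp this
    funext i
    simp [mul_add]
  smul_mem' := by
    intro c θ hθ
    have := Memℓp.const_smul hθ c
    refine (congrArg (fun f : ℕ → ℝ => Memℓp f 2) ?_).mp this
    funext i
    simp [mul_left_comm]

/-- The norm `‖θ‖_{Ḣ^s} = (∑ k_i^s θ_i²)^{1/2}`. -/
def normHDot {k : ℕ → ℝ} {s : ℝ} (θ : HDot k s) : ℝ :=
  √(∑' i, k i ^ s * (θ : ℕ → ℝ) i ^ 2)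

/-- The same square norm for an arbitrary coefficient sequence, with value `∞` allowed. -/
def sqENormHDot (k : ℕ → ℝ) (s : ℝ) (θ : ℕ → ℝ) : ENNReal :=
  ∑' i, ENNReal.ofReal (k i ^ s * θ i ^ 2)

/-- `Δ_λ Ψ = div (λ ∂_z Ψ, ∂_{x₁} Ψ, ∂_{x₂} Ψ) = 0` in `ℝ₊ × Ω`, in the sense of distributions. -/
def IsHarmonic {D : HorizontalDomain} {a : ℝ} (Ψ : SobolevH D a) : Prop :=
  ∀ φ, IsCylTest D φ →
    ∫ p, ∑ i, (sqrtWeight a i p.1 * weightedGradient Ψ i p) * cylDeriv i φ p ∂D.cylMeasure = 0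

/-- The filter `z → 0⁺`, up to null sets of heights `z`; limits along it are essential limits, hence
do not depend on the representative of a function defined almost everywhere. -/
def heightToZero : Filter ℝ := 𝓝[>] 0 ⊓ ae volume

/-- The Dirichlet trace is `γ₀ Ψ = lim_{z → 0} Ψ(z, ·) = h = ∑ h_i e_i`, as a limit in `L²(Ω)`. -/
def HasDirichletTrace {D : HorizontalDomain} {a : ℝ} (e : ℕ → L2 D) (Ψ : SobolevH D a)
    (h : ℕ → ℝ) : Prop :=
  Tendsto (fun z => eLpNorm (fun x => (Ψ : L2Cyl D) (z, x) - (∑' i, h i • e i : L2 D) x) 2 D.measure)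
    heightToZero (𝓝 0)

/-- The Neumann datum `-λ ∂_z Ψ` at height `z`, as a function of `x`
(recall that `weightedGradient Ψ 0 = √λ ∂_z Ψ`). -/
def conormal {D : HorizontalDomain} {a : ℝ} (Ψ : SobolevH D a) (z : ℝ) (x : Plane) : ℝ :=
  -(z ^ (a / 2) * weightedGradient Ψ 0 (z, x))

/-- The Neumann trace is `γ_λ Ψ = - lim_{z → 0} λ ∂_z Ψ(z, ·) = θ`, as a limit in `Ḣ^s(Ω)`. -/
def HasNeumannTrace {D : HorizontalDomain} {a : ℝ} (e : ℕ → L2 D) (k : ℕ → ℝ) (s : ℝ)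
    (Ψ : SobolevH D a) (θ : ℕ → ℝ) : Prop :=
  Tendsto (fun z => sqENormHDot k s (fun i => (∫ x, conormal Ψ z x * e i x ∂D.measure) - θ i))
    heightToZero (𝓝 0)

/-- `Ψ ∈ 𝓗` (so that (A) holds) is a Neumann extension of `θ ∈ Ḣ^s`. -/
def IsNeumannExtension {D : HorizontalDomain} {a s : ℝ} (e : ℕ → L2 D) {k : ℕ → ℝ}
    (θ : HDot k s) (Ψ : SobolevH D a) : Prop :=
  IsHarmonic Ψ ∧ HasNeumannTrace e k s Ψ θ

/-- `Ψ ∈ 𝓗` (so that (A) holds) is a Dirichlet extension of `h ∈ Ḣ^s`. -/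
def IsDirichletExtension {D : HorizontalDomain} {a s : ℝ} (e : ℕ → L2 D) {k : ℕ → ℝ}
    (h : HDot k s) (Ψ : SobolevH D a) : Prop :=
  IsHarmonic Ψ ∧ HasDirichletTrace e Ψ h

end SingularQG

end

/-! Separation of variables. On a mode `e i` with eigenvalue k > 0 the equation becomes (z^a f')' =
k f on (0, ∞). Up to scale this has one decaying solution f; normalise it by f(0⁺) = 1 and let q =
-z^a f' be its flux. By homogeneity in k, q(0⁺) = κ k^ν with κ depending only on a. The Dirichlet
extension of h = ∑ h_i e_i is therefore ∑ h_i f_i(z) e_i(x), its Neumann datum has coefficients κ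
k_i^ν h_i, and the Neumann extension of θ is the Dirichlet extension of κ⁻¹ k_i^(-ν) θ_i.

The profile is explicit (`exists_isProfile`): f is a Bessel-type integral of order ν in the variable
z^(2-a) k / (2-a)², and q is the same kind of integral of order 1 - ν, so κ is a ratio of Gamma
values. From (f q)' = -(z^(-a) q² + k f²), each mode has energy exactly κ k^ν (`IsProfile.energy`).
Distinct modes are orthogonal, both in L² and for their gradients
(`EigenData.inner_separatedGradient`). The energies therefore add up to κ ‖h‖² in Ḣ^ν. A positive
lower bound on the eigenvalues turns this into a bound for the L² norm too.

The same identity gives uniqueness. The coefficient on `e i` of a harmonic function in the energy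
class solves the vertical equation weakly (`EigenData.weak_ode`). If u is such a solution with flux
variable v = z^a u', then (u v)' ≥ 0; a zero datum at 0⁺ makes u v start at 0, and finite energy
prevents it from ever becoming positive, so u = 0 (`ae_eq_zero_of_weak_ode`).

The horizontal analysis is gathered in `EigenData`: each eigenfunction is an H¹ limit of test
functions, and its equation may be tested with almost every slice of an element of the energy space.
On a convex domain this comes from the definition of H¹₀, and the spectral gap from the Poincaré
inequality. On the torus, Fourier coefficients show that eigenfunctions are trigonometric
polynomials with frequencies |n|² = k and n ≠ 0, whence k ≥ 1. -/

open MeasureTheory Set Filter Topology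
open scoped ContDiff

noncomputable section

namespace SingularQG

/-! ### The vertical profile: Bessel-type integrals and the energy identity. -/

section Profile

/-- The Bessel-type integral `∫₀^∞ exp (-r - x / r) r^(s - 1) dr`. -/
def besselInt (s x : ℝ) : ℝ := ∫ r in Ioi (0 : ℝ), Real.exp (-r - x / r) * r ^ (s - 1)

lemma aestronglyMeasurable_bessel (s x : ℝ) :
    AEStronglyMeasurable (fun r : ℝ => Real.exp (-r - x / r) * r ^ (s - 1))
      (volume.restrict (Ioi 0)) := by
  have : Measurable (fun r : ℝ => Real.exp (-r - x / r) * r ^ (s - 1)) := by fun_prop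
  exact this.aestronglyMeasurable

lemma norm_bessel_le {s x r : ℝ} (hx : 0 ≤ x) (hr : 0 < r) :
    ‖Real.exp (-r - x / r) * r ^ (s - 1)‖ ≤ Real.exp (-r) * r ^ (s - 1) := by
  rw [Real.norm_of_nonneg (by positivity)]
  have : 0 ≤ x / r := by positivity
  gcongr
  linarith

lemma integrableOn_bessel {s x : ℝ} (hs : 0 < s) (hx : 0 ≤ x) :
    IntegrableOn (fun r : ℝ => Real.exp (-r - x / r) * r ^ (s - 1)) (Ioi 0) := by
  refine Integrable.mono' (Real.GammaIntegral_convergent hs) (aestronglyMeasurable_bessel s x) ?_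
  filter_upwards [ae_restrict_mem measurableSet_Ioi] with r hr using norm_bessel_le hx hr

lemma besselInt_nonneg (s x : ℝ) : 0 ≤ besselInt s x :=
  setIntegral_nonneg measurableSet_Ioi fun r hr => by
    have : (0 : ℝ) < r := hr
    positivity

lemma besselInt_le_Gamma {s x : ℝ} (hs : 0 < s) (hx : 0 ≤ x) : besselInt s x ≤ Real.Gamma s := by
  rw [Real.Gamma_eq_integral hs]
  exact setIntegral_mono_on (integrableOn_bessel hs hx) (Real.GammaIntegral_convergent hs)
    measurableSet_Ioi fun r hr => (le_abs_self _).trans (norm_bessel_le hx hr)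

lemma tendsto_besselInt_zero {s : ℝ} (hs : 0 < s) :
    Tendsto (besselInt s) (𝓝[>] 0) (𝓝 (Real.Gamma s)) := by
  rw [Real.Gamma_eq_integral hs]
  refine tendsto_integral_filter_of_dominated_convergence
    (fun r => Real.exp (-r) * r ^ (s - 1))
    (Eventually.of_forall fun x => aestronglyMeasurable_bessel s x) ?_
    (Real.GammaIntegral_convergent hs) ?_
  · filter_upwards [self_mem_nhdsWithin] with x hx
    filter_upwards [ae_restrict_mem measurableSet_Ioi] with r hr
    exact norm_bessel_le (le_of_lt hx) hr
  · refine Eventually.of_forall fun r => ?_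
    have : Continuous fun x : ℝ => Real.exp (-r - x / r) * r ^ (s - 1) := by fun_prop
    have h := (this.tendsto 0).mono_left (nhdsWithin_le_nhds (s := Ioi 0))
    simpa using h

lemma tendsto_besselInt_atTop {s : ℝ} (hs : 0 < s) :
    Tendsto (besselInt s) atTop (𝓝 0) := by
  have h0 : (0 : ℝ) = ∫ r in Ioi (0 : ℝ), (0 : ℝ) := by simp
  rw [h0]
  refine tendsto_integral_filter_of_dominated_convergence
    (fun r => Real.exp (-r) * r ^ (s - 1))
    (Eventually.of_forall fun x => aestronglyMeasurable_bessel s x) ?_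
    (Real.GammaIntegral_convergent hs) ?_
  · filter_upwards [eventually_ge_atTop 0] with x hx
    filter_upwards [ae_restrict_mem measurableSet_Ioi] with r hr
    exact norm_bessel_le hx hr
  · filter_upwards [ae_restrict_mem measurableSet_Ioi] with r hr
    have hr' : (0 : ℝ) < r := hr
    have h1 : Tendsto (fun x : ℝ => -r - x / r) atTop atBot := by
      have := (tendsto_id.atTop_div_const hr' : Tendsto (fun x : ℝ => id x / r) atTop atTop)
      have := tendsto_neg_atTop_atBot.comp this
      simpa [sub_eq_add_neg] using tendsto_atBot_add_const_left atTop (-r) this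
    simpa using (Real.tendsto_exp_atBot.comp h1).mul_const (r ^ (s - 1))

/-- The substitution r ↦ x / r exchanges the two terms of the exponent. It is carried out as the
scaling r = x u followed by u ↦ u⁻¹. It matters because differentiating in x lowers the order from s
to s - 1, where the integral diverges at x = 0; inversion returns to the order 1 - s, positive for s
in (0, 1). -/
lemma bessel_inversion {s x : ℝ} (hx : 0 < x) :
    besselInt (s - 1) x = x ^ (s - 1) * besselInt (1 - s) x := by
  have h1 := integral_comp_mul_left_Ioi
    (fun r : ℝ => Real.exp (-r - x / r) * r ^ (s - 2)) 0 hx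
  have h2 := integral_comp_rpow_Ioi
    (fun u : ℝ => Real.exp (-(x * u) - x / (x * u)) * (x * u) ^ (s - 2)) (p := -1) (by norm_num)
  rw [mul_zero] at h1
  have e1 : besselInt (s - 1) x = x * ∫ u in Ioi (0 : ℝ),
      Real.exp (-(x * u) - x / (x * u)) * (x * u) ^ (s - 2) := by
    rw [h1, smul_eq_mul, ← mul_assoc, mul_inv_cancel₀ hx.ne', one_mul, besselInt,
      show s - 1 - 1 = s - 2 by ring]
  rw [e1, ← h2, besselInt, ← integral_const_mul, ← integral_const_mul]
  refine setIntegral_congr_fun measurableSet_Ioi fun r hr => ?_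
  have hr' : (0 : ℝ) < r := hr
  have e2 : x * (|(-1 : ℝ)| * r ^ ((-1 : ℝ) - 1)) * (x * r ^ (-1 : ℝ)) ^ (s - 2)
      = x ^ (s - 1) * r ^ (1 - s - 1) := by
    rw [Real.mul_rpow hx.le (by positivity), ← Real.rpow_mul hr'.le]
    have : x ^ (s - 1) = x * x ^ (s - 2) := by
      rw [show s - 1 = 1 + (s - 2) by ring, Real.rpow_add hx, Real.rpow_one]
    have h3 : r ^ (1 - s - 1) = r ^ ((-1 : ℝ) - 1) * r ^ (-1 * (s - 2)) := by
      rw [← Real.rpow_add hr']; ring_nf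
    rw [this, h3, abs_neg, abs_one]; ring
  have e3 : Real.exp (-(x * r ^ (-1 : ℝ)) - x / (x * r ^ (-1 : ℝ))) = Real.exp (-r - x / r) := by
    rw [Real.rpow_neg_one, div_mul_eq_div_div, div_self hx.ne', one_div, inv_inv]; ring_nf
  simp only [smul_eq_mul]
  rw [e3]
  linear_combination (Real.exp (-r - x / r)) * e2

/-- Differentiation under the integral produces an extra factor 1 / r. For y > x / 2 it is absorbed
by the exponential, since x / (2 r) ≤ exp (y / r); this yields the dominating function with constant
2 / x. The form of the derivative pairs the orders s and 1 - s, so the profile and its flux form a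
closed system. -/
lemma hasDerivAt_besselInt {s x : ℝ} (hs : 0 < s) (hx : 0 < x) :
    HasDerivAt (besselInt s) (-(x ^ (s - 1) * besselInt (1 - s) x)) x := by
  rw [← bessel_inversion hx]
  have hball : Ioi (x / 2) ∈ 𝓝 x := Ioi_mem_nhds (by linarith)
  have key := hasDerivAt_integral_of_dominated_loc_of_deriv_le (μ := volume.restrict (Ioi (0 : ℝ)))
    (F := fun y r => Real.exp (-r - y / r) * r ^ (s - 1))
    (F' := fun y r => -(Real.exp (-r - y / r) * r ^ (s - 1 - 1)))
    (bound := fun r => 2 / x * (Real.exp (-r) * r ^ (s - 1))) (x₀ := x)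
    hball
    (Eventually.of_forall fun y => aestronglyMeasurable_bessel s y)
    (integrableOn_bessel hs hx.le) (aestronglyMeasurable_bessel (s - 1) x).neg ?_
    ((Real.GammaIntegral_convergent hs).const_mul _) ?_
  · have h := key.2
    rw [integral_neg] at h
    exact h
  · filter_upwards [ae_restrict_mem measurableSet_Ioi] with r hr y hy
    have hr' : (0 : ℝ) < r := hr
    have hy' : x / 2 < y := hy
    rw [norm_neg, Real.norm_of_nonneg (by positivity), Real.exp_sub, Real.rpow_sub_one hr'.ne']
    have h1 : x / 2 / r ≤ Real.exp (y / r) := by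
      have h2 : x / 2 / r ≤ y / r := by gcongr
      linarith [Real.add_one_le_exp (y / r)]
    have h3 : Real.exp (-r) / Real.exp (y / r) ≤ Real.exp (-r) / (x / 2 / r) := by gcongr
    calc Real.exp (-r) / Real.exp (y / r) * (r ^ (s - 1) / r)
        ≤ Real.exp (-r) / (x / 2 / r) * (r ^ (s - 1) / r) := by gcongr
      _ = _ := by field_simp
  · filter_upwards [ae_restrict_mem measurableSet_Ioi] with r hr y hy
    have hr' : (0 : ℝ) < r := hr
    have h1 : HasDerivAt (fun y : ℝ => -r - y / r) (-(1 / r)) y := by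
      simpa using ((hasDerivAt_id y).div_const r).const_sub (-r)
    have h2 := (h1.exp).mul_const (r ^ (s - 1))
    refine h2.congr_deriv ?_
    rw [Real.rpow_sub_one hr'.ne' (s - 1)]
    ring

/-- `f` is the decaying solution of `(z^a f')' = k f` on `(0, ∞)` with `f (0⁺) = 1`, and `q` is the
flux `-z^a f'`, with value `m` at `0⁺`. -/
structure IsProfile (a k m : ℝ) (f q : ℝ → ℝ) : Prop where
  deriv : ∀ z, 0 < z → HasDerivAt f (-(z ^ (-a) * q z)) z
  deriv_flux : ∀ z, 0 < z → HasDerivAt q (-(k * f z)) z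
  nonneg : ∀ z, 0 < z → 0 ≤ f z
  le_one : ∀ z, 0 < z → f z ≤ 1
  flux_nonneg : ∀ z, 0 < z → 0 ≤ q z
  flux_le : ∀ z, 0 < z → q z ≤ m
  tendsto_zero : Tendsto f (𝓝[>] 0) (𝓝 1)
  flux_tendsto_zero : Tendsto q (𝓝[>] 0) (𝓝 m)
  tendsto_atTop : Tendsto f atTop (𝓝 0)

theorem exists_isProfile (a : ℝ) (ha : a < 1) :
    ∃ κ : ℝ, 0 < κ ∧ (a = 0 → κ = 1) ∧ ∀ k : ℝ, 0 < k →
      ∃ f q, IsProfile a k (κ * k ^ ((1 - a) / (2 - a))) f q := by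
  have h2 : 0 < 2 - a := by linarith
  set ν := (1 - a) / (2 - a) with hν
  have hν0 : 0 < ν := div_pos (by linarith) h2
  have hν1 : 0 < 1 - ν := by
    have : 1 - ν = 1 / (2 - a) := by rw [hν]; field_simp; ring
    rw [this]; positivity
  -- Chosen so that (2 - a)² c = 1, which makes the derivative of the flux exactly -k f.
  set c := 1 / (2 - a) ^ 2 with hc
  have hc0 : 0 < c := by positivity
  have hG := Real.Gamma_pos_of_pos hν0
  have hG' := Real.Gamma_pos_of_pos hν1
  -- The flux at 0⁺ is (2 - a) (c k)^ν Γ(1 - ν) / Γ(ν); κ is this value with k^ν removed. For a = 0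
  -- one has ν = 1/2 and c = 1/4, so the Gamma factors cancel and κ = 2 · (1/4)^(1/2) = 1.
  refine ⟨(2 - a) * c ^ ν * Real.Gamma (1 - ν) / Real.Gamma ν, by positivity, ?_, ?_⟩
  · intro h0
    have e1 : ν = 1 / 2 := by rw [hν, h0]; norm_num
    have e2 : c = (1 / 2) ^ (2 : ℝ) := by rw [hc, h0]; norm_num
    rw [e1, e2, ← Real.rpow_mul (by norm_num), h0]
    norm_num
    exact (Real.Gamma_pos_of_pos (by norm_num)).ne'
  intro k hk
  -- With ν = (1 - a)/(2 - a), the powers of z coming from X^(ν-1) X' combine to z^(-a), and those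
  -- from X^(-ν) X' cancel.
  set X : ℝ → ℝ := fun z => c * k * z ^ (2 - a) with hX
  have hX0 : ∀ z, 0 < z → 0 < X z := fun z hz => by simp only [hX]; positivity
  have hXd : ∀ z, 0 < z → HasDerivAt X (c * k * ((2 - a) * z ^ (2 - a - 1))) z := fun z hz =>
    (Real.hasDerivAt_rpow_const (Or.inl hz.ne')).const_mul _
  have hXpow : ∀ z b, 0 < z → X z ^ b = (c * k) ^ b * z ^ ((2 - a) * b) := fun z b hz => by
    simp only [hX]
    rw [Real.mul_rpow (by positivity) (by positivity), ← Real.rpow_mul hz.le]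
  have hXz : Tendsto X (𝓝[>] 0) (𝓝[>] 0) := by
    refine tendsto_nhdsWithin_iff.2 ⟨?_, ?_⟩
    · have : ContinuousAt X 0 :=
        continuousAt_const.mul (Real.continuousAt_rpow_const _ _ (Or.inr h2.le))
      have h := this.tendsto.mono_left (nhdsWithin_le_nhds (s := Ioi 0))
      have e : X 0 = 0 := by simp [hX, Real.zero_rpow h2.ne']
      rwa [e] at h
    · filter_upwards [self_mem_nhdsWithin] with z hz using hX0 z hz
  have hXt : Tendsto X atTop atTop :=
    (tendsto_rpow_atTop h2).const_mul_atTop (by positivity)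
  have hm : (2 - a) * c ^ ν * Real.Gamma (1 - ν) / Real.Gamma ν * k ^ ν
      = (2 - a) * (c * k) ^ ν / Real.Gamma ν * Real.Gamma (1 - ν) := by
    rw [Real.mul_rpow hc0.le hk.le]; ring
  rw [hm]
  refine ⟨fun z => besselInt ν (X z) / Real.Gamma ν,
    fun z => (2 - a) * (c * k) ^ ν / Real.Gamma ν * besselInt (1 - ν) (X z), ?_⟩
  constructor
  · intro z hz
    have h := ((hasDerivAt_besselInt hν0 (hX0 z hz)).comp z (hXd z hz)).div_const (Real.Gamma ν)
    refine h.congr_deriv ?_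
    have e1 : (c * k) ^ (ν - 1) * (c * k) = (c * k) ^ ν := by
      rw [Real.rpow_sub_one (by positivity)]; field_simp
    have e2 : z ^ ((2 - a) * (ν - 1)) * z ^ (2 - a - 1) = z ^ (-a) := by
      rw [← Real.rpow_add hz]
      congr 1
      rw [hν]; field_simp; ring
    rw [hXpow z _ hz, ← e1, ← e2]
    ring
  · intro z hz
    have h := ((hasDerivAt_besselInt hν1 (hX0 z hz)).comp z (hXd z hz)).const_mul
      ((2 - a) * (c * k) ^ ν / Real.Gamma ν)
    refine h.congr_deriv ?_
    have e0 : (1 : ℝ) - ν - 1 = -ν := by ring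
    have e1 : (c * k) ^ ν * (c * k) ^ (-ν) = 1 := by
      rw [← Real.rpow_add (by positivity)]; simp
    have e2 : z ^ ((2 - a) * (-ν)) * z ^ (2 - a - 1) = 1 := by
      rw [← Real.rpow_add hz]
      have : (2 - a) * (-ν) + (2 - a - 1) = 0 := by rw [hν]; field_simp; ring
      rw [this, Real.rpow_zero]
    have e3 : (2 - a) * ((2 - a) * c) = 1 := by rw [hc]; field_simp
    rw [e0, hXpow z _ hz, sub_sub_cancel]
    calc _ = -(((c * k) ^ ν * (c * k) ^ (-ν)) * (z ^ ((2 - a) * (-ν)) * z ^ (2 - a - 1))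
            * ((2 - a) * ((2 - a) * c)) * k * (besselInt ν (X z) / Real.Gamma ν)) := by ring
      _ = _ := by rw [e1, e2, e3]; ring
  · intro z hz
    have := besselInt_nonneg ν (X z)
    positivity
  · intro z hz
    exact (div_le_one hG).2 (besselInt_le_Gamma hν0 (hX0 z hz).le)
  · intro z hz
    have := besselInt_nonneg (1 - ν) (X z)
    positivity
  · intro z hz
    have := besselInt_le_Gamma hν1 (hX0 z hz).le
    gcongr
  · have h := ((tendsto_besselInt_zero hν0).comp hXz).div_const (Real.Gamma ν)
    rwa [div_self hG.ne'] at h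
  · exact ((tendsto_besselInt_zero hν1).comp hXz).const_mul _
  · simpa using ((tendsto_besselInt_atTop hν0).comp hXt).div_const (Real.Gamma ν)

namespace IsProfile

variable {a k m : ℝ} {f q : ℝ → ℝ}

lemma continuousOn (h : IsProfile a k m f q) : ContinuousOn f (Ioi 0) := fun z hz =>
  (h.deriv z hz).continuousAt.continuousWithinAt

lemma continuousOn_flux (h : IsProfile a k m f q) : ContinuousOn q (Ioi 0) := fun z hz =>
  (h.deriv_flux z hz).continuousAt.continuousWithinAt

lemma antitoneOn (h : IsProfile a k m f q) : AntitoneOn f (Ioi 0) := by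
  refine antitoneOn_of_deriv_nonpos (convex_Ioi 0) h.continuousOn ?_ ?_
  · rw [interior_Ioi]
    exact fun z hz => (h.deriv z hz).differentiableAt.differentiableWithinAt
  · rw [interior_Ioi]
    intro z hz
    have hz' : (0 : ℝ) < z := hz
    rw [(h.deriv z hz).deriv]
    have := h.flux_nonneg z hz
    have := Real.rpow_nonneg hz'.le (-a)
    nlinarith [mul_nonneg this (h.flux_nonneg z hz)]

/-- The energy identity `∫ z^{-a} q² + k f² = m`. -/
lemma energy (h : IsProfile a k m f q) (hk : 0 < k) :
    IntegrableOn (fun z => z ^ (-a) * q z ^ 2 + k * f z ^ 2) (Ioi 0) ∧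
      ∫ z in Ioi 0, (z ^ (-a) * q z ^ 2 + k * f z ^ 2) = m := by
  -- A primitive of the integrand, given its limit value by hand at 0, where f and q are not
  -- controlled. At infinity it tends to 0 because f does and q stays bounded by m.
  set F : ℝ → ℝ := fun z => if z = 0 then -m else -(f z * q z) with hF
  have hFe : ∀ z, 0 < z → F =ᶠ[𝓝 z] fun z => -(f z * q z) := fun z hz => by
    filter_upwards [Ioi_mem_nhds hz] with w hw
    simp [hF, (show w ≠ 0 from (ne_of_gt hw))]
  have hd : ∀ z ∈ Ioi (0 : ℝ), HasDerivAt F (z ^ (-a) * q z ^ 2 + k * f z ^ 2) z := fun z hz => by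
    have h1 := ((h.deriv z hz).mul (h.deriv_flux z hz)).neg
    refine HasDerivAt.congr_of_eventuallyEq (h1.congr_deriv ?_) (hFe z hz)
    ring
  have hc : ContinuousWithinAt F (Ici 0) 0 := by
    rw [← continuousWithinAt_Ioi_iff_Ici]
    have h1 : Tendsto (fun z => -(f z * q z)) (𝓝[>] 0) (𝓝 (-m)) := by
      simpa using (h.tendsto_zero.mul h.flux_tendsto_zero).neg
    have e : F 0 = -m := by simp [hF]
    rw [ContinuousWithinAt, e]
    refine h1.congr' ?_
    filter_upwards [self_mem_nhdsWithin] with z hz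
    simp [hF, (show z ≠ 0 from (ne_of_gt hz))]
  have hn : ∀ z ∈ Ioi (0 : ℝ), 0 ≤ z ^ (-a) * q z ^ 2 + k * f z ^ 2 := fun z hz => by
    have hz' : (0 : ℝ) < z := hz
    positivity
  have hl : Tendsto F atTop (𝓝 0) := by
    have h1 : Tendsto (fun z => f z * m) atTop (𝓝 0) := by simpa using h.tendsto_atTop.mul_const m
    have h2 : Tendsto (fun z => f z * q z) atTop (𝓝 0) := by
      refine tendsto_of_tendsto_of_tendsto_of_le_of_le' tendsto_const_nhds h1 ?_ ?_
      · filter_upwards [eventually_gt_atTop 0] with z hz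
        exact mul_nonneg (h.nonneg z hz) (h.flux_nonneg z hz)
      · filter_upwards [eventually_gt_atTop 0] with z hz
        exact mul_le_mul_of_nonneg_left (h.flux_le z hz) (h.nonneg z hz)
    have h3 := h2.neg
    rw [neg_zero] at h3
    refine h3.congr' ?_
    filter_upwards [eventually_gt_atTop 0] with z hz
    simp [hF, hz.ne']
  refine ⟨integrableOn_Ioi_deriv_of_nonneg hc hd hn hl, ?_⟩
  rw [integral_Ioi_of_hasDerivAt_of_nonneg hc hd hn hl]
  simp [hF]

end IsProfile

end Profile

/-! ### Weak derivatives in the height variable and the vertical uniqueness theorem. -/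

section Height

/-- Test functions `C_c^∞(ℝ₊)` of the height `z`. -/
def IsHeightTest (η : ℝ → ℝ) : Prop :=
  ContDiff ℝ ∞ η ∧ HasCompactSupport η ∧ tsupport η ⊆ Ioi (0 : ℝ)

lemma IsHeightTest.exists_Ioo {η : ℝ → ℝ} (h : IsHeightTest η) :
    ∃ ε R : ℝ, 0 < ε ∧ ε < R ∧ ∀ z, z ∉ Ioo ε R → η z = 0 := by
  obtain ⟨-, hc, hs⟩ := h
  have hK : IsCompact (tsupport η) := hc
  by_cases hne : (tsupport η).Nonempty
  · obtain ⟨p, hp, hpmin⟩ := hK.exists_isMinOn hne continuousOn_id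
    obtain ⟨q, hq, hqmax⟩ := hK.exists_isMaxOn hne continuousOn_id
    have hp0 : 0 < p := hs hp
    refine ⟨p / 2, q + 1, by linarith, ?_, fun z hz => ?_⟩
    · have : p ≤ q := hpmin hq
      linarith
    by_contra h0
    have hm : z ∈ tsupport η := subset_tsupport η h0
    have h1 : p ≤ z := hpmin hm
    have h2 : z ≤ q := hqmax hm
    exact hz ⟨by linarith, by linarith⟩
  · refine ⟨1, 2, one_pos, one_lt_two, fun z _ => ?_⟩
    by_contra h0
    exact hne ⟨_, subset_tsupport η h0⟩

lemma deriv_eq_zero_of_notMem_Ioo {η : ℝ → ℝ} {ε R : ℝ} (h : ∀ z, z ∉ Ioo ε R → η z = 0) {z : ℝ}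
    (hz : z ∉ Icc ε R) : deriv η z = 0 := by
  have : η =ᶠ[𝓝 z] fun _ => 0 := by
    filter_upwards [isClosed_Icc.isOpen_compl.mem_nhds hz] with w hw
    exact h w fun hw' => hw (Ioo_subset_Icc_self hw')
  rw [this.deriv_eq, deriv_const]

lemma setIntegral_Ioi_eq_intervalIntegral {F : ℝ → ℝ} {R : ℝ} (hR : 0 ≤ R)
    (h : ∀ z, z ∉ Icc 0 R → F z = 0) : ∫ z in Ioi 0, F z = ∫ z in (0 : ℝ)..R, F z := by
  rw [intervalIntegral.integral_of_le hR]
  refine (setIntegral_eq_of_subset_of_forall_sdiff_eq_zero measurableSet_Ioi Ioc_subset_Ioi_self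
    fun z hz => h z fun hz' => hz.2 ⟨hz.1, hz'.2⟩)

/-- Integration by parts for absolutely continuous functions; `g` is only integrable, so its
primitive is differentiable only almost everywhere. The boundary terms vanish because the test
function does. -/
lemma integral_primitive_mul_deriv {g η : ℝ → ℝ} (hg : ∀ R, IntegrableOn g (Ioc 0 R))
    (hη : IsHeightTest η) :
    ∫ z in Ioi 0, (∫ s in (0 : ℝ)..z, g s) * deriv η z = -∫ z in Ioi 0, g z * η z := by
  obtain ⟨ε, R, hε, hεR, h0⟩ := hη.exists_Ioo
  have hR : 0 < R := hε.trans hεR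
  have hgi : IntervalIntegrable g volume 0 R :=
    (intervalIntegrable_iff_integrableOn_Ioc_of_le hR.le).2 (hg R)
  rw [setIntegral_Ioi_eq_intervalIntegral (R := R) hR.le,
    setIntegral_Ioi_eq_intervalIntegral (R := R) hR.le]
  rotate_left
  · exact fun z hz => by rw [h0 z fun h => hz ⟨(hε.trans h.1).le, h.2.le⟩, mul_zero]
  · intro z hz
    rw [deriv_eq_zero_of_notMem_Ioo h0 fun h => hz ⟨hε.le.trans h.1, h.2⟩, mul_zero]
  have hac := hgi.absolutelyContinuousOnInterval_intervalIntegral (c := 0) left_mem_uIcc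
  have hacη : AbsolutelyContinuousOnInterval η 0 R :=
    (hη.1.of_le (by simp)).contDiffOn.absolutelyContinuousOnInterval
  rw [hac.integral_mul_deriv_eq_deriv_mul hacη, h0 R (by simp),
    h0 0 (fun h => absurd h.1 (by simp [hε.le]))]
  simp only [mul_zero, sub_zero, zero_sub, neg_inj]
  refine intervalIntegral.integral_congr_ae ?_
  filter_upwards [hgi.ae_hasDerivAt_integral] with z hz hz'
  rw [(hz (uIoc_subset_uIcc hz') 0 left_mem_uIcc).deriv]

lemma integrable_mul_of_slab {h χ : ℝ → ℝ} (hh : LocallyIntegrableOn h (Ioi 0))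
    (hχ : Continuous χ) {ε R : ℝ} (hε : 0 < ε) (hR : ∀ z, z ∉ Icc ε R → χ z = 0) :
    IntegrableOn (fun z => h z * χ z) (Ioi 0) := by
  have h1 : IntegrableOn (fun z => h z * χ z) (Icc ε R) := by
    obtain ⟨C, hC⟩ :=
      (isCompact_Icc (a := ε) (b := R)).exists_bound_of_continuousOn hχ.continuousOn
    refine Integrable.mul_bdd (c := C) (hh.integrableOn_compact_subset
      (fun z hz => hε.trans_le hz.1) isCompact_Icc) hχ.aestronglyMeasurable ?_
    filter_upwards [ae_restrict_mem measurableSet_Icc] with z hz using hC z hz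
  refine h1.of_forall_sdiff_eq_zero measurableSet_Ioi fun z hz => ?_
  rw [hR z hz.2, mul_zero]

lemma locallyIntegrableOn_Ioi {h : ℝ → ℝ} (hh : ∀ R, IntegrableOn h (Ioc 0 R)) :
    LocallyIntegrableOn h (Ioi 0) := by
  intro z hz
  refine ⟨Ioc 0 (z + 1), ?_, hh _⟩
  have : Ioo (0 : ℝ) (z + 1) ∈ 𝓝 z := Ioo_mem_nhds hz (by linarith)
  exact mem_nhdsWithin_of_mem_nhds (mem_of_superset this Ioo_subset_Ioc_self)

lemma exists_heightTest_integral_one : ∃ ρ, IsHeightTest ρ ∧ ∫ z in Ioi 0, ρ z = 1 := by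
  let b : ContDiffBump (2 : ℝ) := ⟨1 / 2, 1, by norm_num, by norm_num⟩
  have hs : tsupport (b.normed volume) ⊆ Ioi (0 : ℝ) := by
    rw [b.tsupport_normed_eq, Real.closedBall_eq_Icc]
    intro z hz
    have : (2 : ℝ) - 1 ≤ z := hz.1
    exact lt_of_lt_of_le (by norm_num) this
  refine ⟨b.normed volume, ⟨b.contDiff_normed, b.hasCompactSupport_normed, hs⟩, ?_⟩
  rw [setIntegral_eq_integral_of_forall_compl_eq_zero, b.integral_normed]
  intro z hz
  by_contra h
  exact hz (hs (subset_tsupport _ h))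

/-- The primitive starting at 0 vanishes below the support of `χ`, and above it because the total
integral is zero. -/
lemma exists_primitive_heightTest {χ : ℝ → ℝ} (hχ : IsHeightTest χ)
    (h0 : ∫ z in Ioi 0, χ z = 0) : ∃ η, IsHeightTest η ∧ deriv η = χ := by
  obtain ⟨ε, R, hε, hεR, hz⟩ := hχ.exists_Ioo
  have hc : Continuous χ := hχ.1.continuous
  have hd : ∀ z, HasDerivAt (fun z => ∫ s in (0 : ℝ)..z, χ s) (χ z) z := fun z =>
    intervalIntegral.integral_hasDerivAt_right (hc.intervalIntegrable _ _)
      (hc.stronglyMeasurableAtFilter _ _) hc.continuousAt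
  have hde : deriv (fun z => ∫ s in (0 : ℝ)..z, χ s) = χ := funext fun z => (hd z).deriv
  have hsupp : ∀ z, z ∉ Icc ε R → ∫ s in (0 : ℝ)..z, χ s = 0 := by
    intro z hzz
    rcases lt_or_ge z ε with h | h
    · have : ∀ s ∈ uIcc 0 z, χ s = 0 := fun s hs => hz s fun hs' => by
        rcases mem_uIcc.1 hs with h1 | h1 <;> linarith [h1.1, h1.2, hs'.1]
      rw [intervalIntegral.integral_congr this]
      simp
    · have hRz : R < z := not_le.1 fun h' => hzz ⟨h, h'⟩
      rw [← setIntegral_Ioi_eq_intervalIntegral (by linarith), h0]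
      exact fun s hs => hz s fun hs' => hs ⟨by linarith [hs'.1], by linarith [hs'.2]⟩
  have hts : tsupport (fun z => ∫ s in (0 : ℝ)..z, χ s) ⊆ Icc ε R :=
    closure_minimal (fun z hz' => by_contra fun h => hz' (hsupp z h)) isClosed_Icc
  refine ⟨_, ⟨?_, ?_, hts.trans fun z hz' => hε.trans_le hz'.1⟩, hde⟩
  · rw [contDiff_infty_iff_deriv, hde]
    exact ⟨fun z => (hd z).differentiableAt, hχ.1⟩
  · exact isCompact_Icc.of_isClosed_subset (isClosed_tsupport _) hts

/-- A function with zero weak derivative on `(0, ∞)` is constant. -/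
lemma ae_eq_const_of_weak_deriv_zero {h : ℝ → ℝ} (hh : LocallyIntegrableOn h (Ioi 0))
    (hw : ∀ η, IsHeightTest η → ∫ z in Ioi 0, h z * deriv η z = 0) :
    ∃ C, ∀ᵐ z ∂volume.restrict (Ioi 0), h z = C := by
  obtain ⟨ρ, hρ, hρ1⟩ := exists_heightTest_integral_one
  refine ⟨∫ z in Ioi 0, h z * ρ z, ?_⟩
  set C := ∫ z in Ioi 0, h z * ρ z with hC
  have hconst : ∀ C : ℝ, LocallyIntegrableOn (fun _ => C) (Ioi (0 : ℝ)) := fun C =>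
    continuousOn_const.locallyIntegrableOn measurableSet_Ioi
  rw [ae_restrict_iff' measurableSet_Ioi]
  have hloc : LocallyIntegrableOn (fun z => h z - C) (Ioi 0) := hh.sub (hconst C)
  have := isOpen_Ioi.ae_eq_zero_of_integral_contDiff_smul_eq_zero hloc fun χ h1 h2 h3 => ?_
  · filter_upwards [this] with z hz hz' using sub_eq_zero.1 (hz hz')
  have hχ : IsHeightTest χ := ⟨h1, h2, h3⟩
  have hi : ∀ χ : ℝ → ℝ, IsHeightTest χ → ∀ h : ℝ → ℝ, LocallyIntegrableOn h (Ioi 0) →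
      IntegrableOn (fun z => h z * χ z) (Ioi 0) := fun χ hχ h hh => by
    obtain ⟨ε, R, hε, hεR, hz⟩ := hχ.exists_Ioo
    exact integrable_mul_of_slab hh hχ.1.continuous hε
      fun z hz' => hz z fun h => hz' ⟨h.1.le, h.2.le⟩
  have hi1 : ∀ χ : ℝ → ℝ, IsHeightTest χ → IntegrableOn χ (Ioi 0) := fun χ hχ => by
    simpa using hi χ hχ (fun _ => 1) (hconst 1)
  set m := ∫ z in Ioi 0, χ z with hm
  -- Subtracting the multiple of `ρ` with the same integral leaves a test function of integral zero.
  -- It is the derivative of a test function, and the hypothesis applies to that.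
  have hdiff : IsHeightTest (fun z => χ z - m * ρ z) := by
    refine ⟨h1.sub (contDiff_const.mul hρ.1), h2.sub hρ.2.1.mul_left, ?_⟩
    refine (closure_mono ?_).trans ((closure_union (s := Function.support χ)
      (t := Function.support ρ)).subset.trans (union_subset h3 hρ.2.2))
    intro z hz
    by_contra hn
    simp only [mem_union, Function.mem_support, not_or, not_not] at hn
    exact hz (by simp [hn.1, hn.2])
  obtain ⟨η, hη, hηd⟩ := exists_primitive_heightTest hdiff (by
    rw [integral_sub (hi1 χ hχ) ((hi1 ρ hρ).const_mul m), integral_const_mul, hρ1, mul_one,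
      sub_self])
  have h4 := hw η hη
  rw [hηd] at h4
  have e : ∫ z, χ z • (h z - C) = ∫ z in Ioi 0, χ z • (h z - C) := by
    rw [setIntegral_eq_integral_of_forall_compl_eq_zero]
    intro z hz
    have : χ z = 0 := by
      by_contra hn
      exact hz (h3 (subset_tsupport _ hn))
    simp [this]
  have e1 : ∫ z in Ioi 0, h z * (χ z - m * ρ z)
      = (∫ z in Ioi 0, h z * χ z) - m * C := by
    rw [hC, ← integral_const_mul, ← integral_sub (hi χ hχ h hh) ((hi ρ hρ h hh).const_mul m)]
    congr 1; ext z; ring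
  have e2 : ∫ z in Ioi 0, χ z • (h z - C) = (∫ z in Ioi 0, h z * χ z) - C * m := by
    rw [hm, ← integral_const_mul, ← integral_sub (hi χ hχ h hh) ((hi1 χ hχ).const_mul C)]
    congr 1; ext z; simp only [smul_eq_mul]; ring
  rw [e, e2]
  linarith

/-- The lemma of du Bois-Reymond on `(0, ∞)`, up to the boundary point. -/
lemma ae_eq_primitive_of_weak_deriv {f g : ℝ → ℝ} (hf : LocallyIntegrableOn f (Ioi 0))
    (hg : ∀ R, IntegrableOn g (Ioc 0 R))
    (hw : ∀ η, IsHeightTest η → ∫ z in Ioi 0, f z * deriv η z = -∫ z in Ioi 0, g z * η z) :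
    ∃ C, ∀ᵐ z ∂volume.restrict (Ioi 0), f z = C + ∫ s in (0 : ℝ)..z, g s := by
  have hG : LocallyIntegrableOn (fun z => ∫ s in (0 : ℝ)..z, g s) (Ioi 0) := by
    refine locallyIntegrableOn_Ioi fun R => ?_
    rcases le_total R 0 with h | h
    · simp [Ioc_eq_empty (not_lt.2 h)]
    · have h1 : IntervalIntegrable g volume 0 R :=
        (intervalIntegrable_iff_integrableOn_Ioc_of_le h).2 (hg R)
      have h2 := intervalIntegral.continuousOn_primitive_interval' h1 left_mem_uIcc
      rw [uIcc_of_le h] at h2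
      exact (h2.integrableOn_Icc).mono_set Ioc_subset_Icc_self
  obtain ⟨C, hC⟩ := ae_eq_const_of_weak_deriv_zero (h := fun z => f z - ∫ s in (0 : ℝ)..z, g s)
    (hf.sub hG) fun η hη => by
      obtain ⟨ε, R, hε, hεR, hz⟩ := hη.exists_Ioo
      have hz' : ∀ z, z ∉ Icc ε R → deriv η z = 0 := fun z hz' =>
        deriv_eq_zero_of_notMem_Ioo hz hz'
      have hηc : Continuous (deriv η) := (hη.1.continuous_deriv (by simp))
      simp only [sub_mul]
      rw [integral_sub (integrable_mul_of_slab hf hηc hε hz')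
        (integrable_mul_of_slab hG hηc hε hz'), hw η hη, integral_primitive_mul_deriv hg hη,
        sub_self]
  exact ⟨C, hC.mono fun z hz => by linarith⟩


/-- No null set covers an interval (0, u). Without this, limits along the filter would not be unique
and a trace would determine nothing. -/
instance heightToZero_neBot : heightToZero.NeBot := by
  have h : (ae (volume.restrict (Ioo (0 : ℝ) 1))).NeBot := by
    rw [ae_neBot]
    intro h
    have := congrArg (fun μ => μ univ) h
    simp at this
  rw [heightToZero, inf_neBot_iff]
  intro s hs t ht
  obtain ⟨u, hu, hus⟩ := mem_nhdsGT_iff_exists_Ioo_subset.1 hs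
  have hu0 : (0 : ℝ) < u := hu
  by_contra hne
  rw [not_nonempty_iff_eq_empty] at hne
  have h1 : Ioo 0 u ⊆ tᶜ := fun z hz hzt => by
    have : z ∈ s ∩ t := ⟨hus hz, hzt⟩
    rw [hne] at this
    exact this
  have h2 := measure_mono_null h1 (mem_ae_iff.1 ht)
  simp [hu0.not_ge] at h2

lemma eventually_heightToZero {P : ℝ → Prop} (h : ∀ᵐ z ∂volume.restrict (Ioi 0), P z) :
    ∀ᶠ z in heightToZero, P z := by
  rw [ae_restrict_iff' measurableSet_Ioi] at h
  filter_upwards [inf_le_left (a := 𝓝[>] (0 : ℝ)) self_mem_nhdsWithin,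
    inf_le_right (a := 𝓝[>] (0 : ℝ)) h]
    with z hz hz' using hz' hz

lemma heightToZero_le : heightToZero ≤ 𝓝[>] 0 := inf_le_left

/-- Integrability of `g` down to 0 makes its primitive continuous there. The representatives of ψ
and of its flux thus have genuine boundary values, with which the prescribed essential limit can be
compared. -/
lemma tendsto_primitive_zero {g : ℝ → ℝ} (hg : ∀ R, IntegrableOn g (Ioc 0 R)) (C : ℝ) :
    Tendsto (fun z => C + ∫ s in (0 : ℝ)..z, g s) (𝓝[>] 0) (𝓝 C) := by
  have h1 : IntervalIntegrable g volume 0 1 :=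
    (intervalIntegrable_iff_integrableOn_Ioc_of_le zero_le_one).2 (hg 1)
  have h2 := intervalIntegral.continuousOn_primitive_interval' h1 left_mem_uIcc
  rw [uIcc_of_le zero_le_one] at h2
  have h4 : 𝓝[>] (0 : ℝ) ≤ 𝓝[Icc 0 1] 0 :=
    nhdsWithin_le_of_mem (mem_of_superset (Ioo_mem_nhdsGT one_pos) Ioo_subset_Icc_self)
  simpa using ((h2 0 (by simp)).mono_left h4).const_add C

/-- A solution in the energy class of `(z^a ψ')' = k ψ` on `(0, ∞)`, with `p = z^{a/2} ψ'`, that has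
zero Dirichlet or Neumann datum at `0⁺` vanishes. -/
theorem ae_eq_zero_of_weak_ode {a k : ℝ} (ha : a < 1) (hk : 0 < k) {ψ p : ℝ → ℝ}
    (hψ : MemLp ψ 2 (volume.restrict (Ioi 0))) (hp : MemLp p 2 (volume.restrict (Ioi 0)))
    (h1 : ∀ η, IsHeightTest η →
      ∫ z in Ioi 0, ψ z * deriv η z = -∫ z in Ioi 0, p z * ((z ^ (a / 2))⁻¹ * η z))
    (h2 : ∀ η, IsHeightTest η →
      ∫ z in Ioi 0, z ^ (a / 2) * p z * deriv η z = -∫ z in Ioi 0, k * ψ z * η z)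
    (h0 : Tendsto ψ heightToZero (𝓝 0) ∨ Tendsto (fun z => z ^ (a / 2) * p z) heightToZero (𝓝 0)) :
    ψ =ᵐ[volume.restrict (Ioi 0)] 0 := by
  have hle : ∀ R : ℝ, volume.restrict (Ioc 0 R) ≤ volume.restrict (Ioi 0) := fun R =>
    Measure.restrict_mono Ioc_subset_Ioi_self le_rfl
  have hψ1 : ∀ R, IntegrableOn ψ (Ioc 0 R) := fun R =>
    (hψ.mono_measure (hle R)).integrable (by norm_num)
  have hp1 : ∀ R, IntegrableOn p (Ioc 0 R) := fun R =>
    (hp.mono_measure (hle R)).integrable (by norm_num)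
  -- The condition a < 1 enters here: z^(-a) is integrable at 0, so z^(-a/2) is square integrable
  -- there and ψ' = z^(-a/2) p is integrable up to 0.
  have hw : ∀ R, MemLp (fun z : ℝ => (z ^ (a / 2))⁻¹) 2 (volume.restrict (Ioc 0 R)) := fun R => by
    have hm : Measurable (fun z : ℝ => (z ^ (a / 2))⁻¹) := by fun_prop
    rw [memLp_two_iff_integrable_sq hm.aestronglyMeasurable]
    rcases le_total R 0 with hR | hR
    · simp [Ioc_eq_empty (not_lt.2 hR)]
    have h := intervalIntegral.intervalIntegrable_rpow' (a := 0) (b := R) (r := -a) (by linarith)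
    rw [intervalIntegrable_iff_integrableOn_Ioc_of_le hR] at h
    refine h.congr_fun (fun z hz => ?_) measurableSet_Ioc
    have hz' : (0 : ℝ) < z := hz.1
    simp only
    rw [← Real.rpow_neg hz'.le, ← Real.rpow_natCast, ← Real.rpow_mul hz'.le]
    congr 1
    push_cast; ring
  have hg : ∀ R, IntegrableOn (fun z => (z ^ (a / 2))⁻¹ * p z) (Ioc 0 R) := fun R =>
    (hw R).integrable_mul (hp.mono_measure (hle R))
  have hq1 : LocallyIntegrableOn (fun z => z ^ (a / 2) * p z) (Ioi 0) := by
    refine (locallyIntegrableOn_Ioi hp1).continuousOn_mul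
      (fun z hz => (Real.continuousAt_rpow_const _ _ (Or.inl (ne_of_gt hz))).continuousWithinAt) ?_
    exact isOpen_Ioi.isLocallyClosed
  obtain ⟨A, hA⟩ := ae_eq_primitive_of_weak_deriv (locallyIntegrableOn_Ioi hψ1) hg fun η hη => by
    rw [h1 η hη]
    congr 2; ext z; ring
  obtain ⟨B, hB⟩ := ae_eq_primitive_of_weak_deriv hq1 (fun R => (hψ1 R).const_mul k) h2
  set u : ℝ → ℝ := fun z => A + ∫ s in (0 : ℝ)..z, (s ^ (a / 2))⁻¹ * p s with hu
  set v : ℝ → ℝ := fun z => B + ∫ s in (0 : ℝ)..z, k * ψ s with hv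
  have hu0 : Tendsto u (𝓝[>] 0) (𝓝 A) := tendsto_primitive_zero hg A
  have hv0 : Tendsto v (𝓝[>] 0) (𝓝 B) := tendsto_primitive_zero (fun R => (hψ1 R).const_mul k) B
  -- Either datum is treated alike, since only the boundary value of the product u v is used.
  have hAB : A * B = 0 := by
    rcases h0 with h | h
    · have := tendsto_nhds_unique (h.congr' (eventually_heightToZero hA))
        (hu0.mono_left heightToZero_le)
      rw [← this, zero_mul]
    · have := tendsto_nhds_unique (h.congr' (eventually_heightToZero hB))
        (hv0.mono_left heightToZero_le)
      rw [← this, mul_zero]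
  have hcont : ∀ {g : ℝ → ℝ} (C : ℝ), (∀ R, IntegrableOn g (Ioc 0 R)) →
      ContinuousOn (fun z => C + ∫ s in (0 : ℝ)..z, g s) (Ioi 0) := fun {g} C hg z hz => by
    have hz' : (0 : ℝ) < z := hz
    have h1 : IntervalIntegrable g volume 0 (z + 1) :=
      (intervalIntegrable_iff_integrableOn_Ioc_of_le (by linarith)).2 (hg _)
    have h2 := intervalIntegral.continuousOn_primitive_interval' h1 left_mem_uIcc
    rw [uIcc_of_le (by linarith)] at h2
    exact ((h2.continuousAt (Icc_mem_nhds hz' (by linarith))).const_add C).continuousWithinAt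
  have huc : ContinuousOn u (Ioi 0) := hcont A hg
  have hvc : ContinuousOn v (Ioi 0) := hcont B fun R => (hψ1 R).const_mul k
  -- both primitives have classical derivatives
  have hder : ∀ {g w : ℝ → ℝ} (C : ℝ), (∀ R, IntegrableOn g (Ioc 0 R)) → ContinuousOn w (Ioi 0) →
      (∀ᵐ z ∂volume.restrict (Ioi 0), g z = w z) → ∀ z, 0 < z →
      HasDerivAt (fun z => C + ∫ s in (0 : ℝ)..z, g s) (w z) z := fun {g w} C hg hw hgw z hz => by
    rw [ae_restrict_iff' measurableSet_Ioi] at hgw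
    have hII : ∀ y, 0 ≤ y → IntervalIntegrable g volume 0 y := fun y hy =>
      (intervalIntegrable_iff_integrableOn_Ioc_of_le hy).2 (hg y)
    have hwI : ∀ y, 0 < y → IntervalIntegrable w volume z y := fun y hy =>
      (hw.mono fun x hx => (lt_min hz hy).trans_le hx.1).intervalIntegrable
    have hd : HasDerivAt (fun y => (C + ∫ s in (0 : ℝ)..z, g s) + ∫ s in z..y, w s) (w z) z := by
      have h := intervalIntegral.integral_hasDerivAt_right (hwI z hz)
        (hw.stronglyMeasurableAtFilter isOpen_Ioi z hz) (hw.continuousAt (Ioi_mem_nhds hz))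
      simpa using h.const_add (C + ∫ s in (0 : ℝ)..z, g s)
    refine hd.congr_of_eventuallyEq ?_
    filter_upwards [Ioi_mem_nhds hz] with y hy
    have hy' : (0 : ℝ) < y := hy
    have e : ∫ s in z..y, w s = ∫ s in z..y, g s := by
      refine intervalIntegral.integral_congr_ae ?_
      filter_upwards [hgw] with s hs hs'
      exact (hs ((le_min hz.le hy'.le).trans_lt hs'.1)).symm
    rw [e, add_assoc, intervalIntegral.integral_add_adjacent_intervals (hII z hz.le)
      ((hII z hz.le).symm.trans (hII y hy'.le))]
  have hud : ∀ z, 0 < z → HasDerivAt u (z ^ (-a) * v z) z := by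
    refine hder A hg (w := fun z => z ^ (-a) * v z) ?_ ?_
    · exact ContinuousOn.mul (fun z hz =>
        (Real.continuousAt_rpow_const _ _ (Or.inl (ne_of_gt hz))).continuousWithinAt) hvc
    · filter_upwards [hB, ae_restrict_mem measurableSet_Ioi] with z hz hz0
      have hz' : (0 : ℝ) < z := hz0
      have hvz : v z = z ^ (a / 2) * p z := hz.symm
      rw [hvz, ← mul_assoc, ← Real.rpow_add hz', ← Real.rpow_neg hz'.le]
      congr 2; ring
  have hvd : ∀ z, 0 < z → HasDerivAt v (k * u z) z := by
    refine hder B (fun R => (hψ1 R).const_mul k) (w := fun z => k * u z)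
      (continuousOn_const.mul huc) ?_
    filter_upwards [hA] with z hz
    rw [hz]
  have hwd : ∀ z, 0 < z → HasDerivAt (fun z => u z * v z) (z ^ (-a) * v z ^ 2 + k * u z ^ 2) z :=
    fun z hz => ((hud z hz).mul (hvd z hz)).congr_deriv (by ring)
  -- The derivative of u v is the energy density z^(-a) v² + k u² ≥ 0.
  have hmono : MonotoneOn (fun z => u z * v z) (Ioi 0) := by
    refine monotoneOn_of_deriv_nonneg (convex_Ioi 0) (huc.mul hvc) ?_ ?_
    · rw [interior_Ioi]
      exact fun z hz => (hwd z hz).differentiableAt.differentiableWithinAt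
    · rw [interior_Ioi]
      intro z hz
      have hz' : (0 : ℝ) < z := hz
      rw [(hwd z hz).deriv]
      positivity
  have hlim : Tendsto (fun z => u z * v z) (𝓝[>] 0) (𝓝 0) := by
    simpa [hAB] using hu0.mul hv0
  have hnn : ∀ z, 0 < z → 0 ≤ u z * v z := fun z hz => by
    refine le_of_tendsto hlim ?_
    filter_upwards [Ioo_mem_nhdsGT hz] with y hy using hmono hy.1 hz hy.2.le
  -- If u v were positive at z₀, it would stay above that value, so ψ p = z^(-a/2) u v would
  -- dominate a multiple of z^(-a/2) at infinity. But ψ p is integrable as a product of L²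
  -- functions, and z^(-a/2) is integrable at infinity only if a > 2.
  have hzero : ∀ z, 0 < z → u z * v z = 0 := fun z₀ hz₀ => by
    refine le_antisymm (not_lt.1 fun hpos => ?_) (hnn z₀ hz₀)
    have hint : IntegrableOn (fun z => ψ z * p z) (Ioi (max z₀ 1)) :=
      (hψ.integrable_mul hp).mono_measure (Measure.restrict_mono
        (Ioi_subset_Ioi (by positivity)) le_rfl)
    have hint2 : IntegrableOn (fun z : ℝ => z ^ (-(a / 2))) (Ioi (max z₀ 1)) := by
      have hb : IntegrableOn (fun z : ℝ => (u z₀ * v z₀) * z ^ (-(a / 2))) (Ioi (max z₀ 1)) := by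
        refine Integrable.mono' hint (by fun_prop) ?_
        have hsub : volume.restrict (Ioi (max z₀ 1)) ≤ volume.restrict (Ioi 0) :=
          Measure.restrict_mono (Ioi_subset_Ioi (by positivity)) le_rfl
        filter_upwards [ae_mono hsub hA, ae_mono hsub hB, ae_restrict_mem measurableSet_Ioi]
          with z hz1 hz2 hz3
        have hz4 : z₀ < z := (le_max_left _ _).trans_lt hz3
        have hz5 : 0 < z := hz₀.trans hz4
        have e : ψ z * p z = (u z * v z) * z ^ (-(a / 2)) := by
          have : p z = z ^ (-(a / 2)) * v z := by
            have hvz : v z = z ^ (a / 2) * p z := hz2.symm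
            rw [hvz, ← mul_assoc, ← Real.rpow_add hz5]
            simp
          rw [hz1, this]; ring
        rw [e, Real.norm_of_nonneg (by positivity)]
        have := hmono hz₀ hz5 hz4.le
        have := Real.rpow_nonneg hz5.le (-(a / 2))
        gcongr
      have := hb.const_mul (u z₀ * v z₀)⁻¹
      refine this.congr (Eventually.of_forall fun z => ?_)
      simp only
      rw [← mul_assoc, inv_mul_cancel₀ hpos.ne', one_mul]
    rw [integrableOn_Ioi_rpow_iff (by positivity)] at hint2
    linarith
  have huz : ∀ z, 0 < z → u z = 0 := fun z hz => by
    have hev : (fun z => u z * v z) =ᶠ[𝓝 z] fun _ => 0 := by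
      filter_upwards [Ioi_mem_nhds hz] with y hy using hzero y hy
    have h3 := (hwd z hz).congr_of_eventuallyEq hev.symm
    have h4 := h3.unique (hasDerivAt_const z (0 : ℝ))
    have h5 : 0 ≤ z ^ (-a) * v z ^ 2 := by positivity
    have h6 : k * u z ^ 2 = 0 := le_antisymm (by linarith) (by positivity)
    rcases mul_eq_zero.1 h6 with h7 | h7
    · exact absurd h7 hk.ne'
    · exact pow_eq_zero_iff (two_ne_zero) |>.1 h7
  filter_upwards [hA, ae_restrict_mem measurableSet_Ioi] with z hz hz0
  rw [hz]
  exact huz z hz0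

end Height

/-! ### Orthogonal series, tensor products and horizontal slice coefficients. -/

section Slices

section Hilbert

variable {W : Type*} [NormedAddCommGroup W] [InnerProductSpace ℝ W]

/-- The lines spanned by the vectors form an orthogonal family, to which the Hilbert-space criterion
applies. No normalisation is required, so coefficients of a series may vanish. -/
lemma summable_of_pairwise_orthogonal [CompleteSpace W] {w : ℕ → W}
    (hw : Pairwise fun i j => inner ℝ (w i) (w j) = 0)
    (hs : Summable fun i => ‖w i‖ ^ 2) : Summable w := by
  have hV : OrthogonalFamily ℝ (fun i => (ℝ ∙ w i : Submodule ℝ W))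
      fun i => (ℝ ∙ w i : Submodule ℝ W).subtypeₗᵢ := by
    intro i j hij x y
    obtain ⟨a, ha⟩ := Submodule.mem_span_singleton.1 x.2
    obtain ⟨b, hb⟩ := Submodule.mem_span_singleton.1 y.2
    simp [← ha, ← hb, inner_smul_left, inner_smul_right, hw hij]
  have := (hV.summable_iff_norm_sq_summable
    fun i => ⟨w i, Submodule.mem_span_singleton_self (w i)⟩).2 (by simpa using hs)
  simpa using this

lemma norm_tsum_sq_of_pairwise_orthogonal {w : ℕ → W}
    (hw : Pairwise fun i j => inner ℝ (w i) (w j) = 0) (hs : Summable w) :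
    ‖∑' i, w i‖ ^ 2 = ∑' i, ‖w i‖ ^ 2 := by
  rw [← real_inner_self_eq_norm_sq]
  have h1 := (hs.hasSum.mapL (innerSL ℝ (∑' i, w i))).tsum_eq
  simp only [innerSL_apply_apply] at h1
  rw [← h1]
  refine tsum_congr fun i => ?_
  have h2 := (hs.hasSum.mapL (innerSL ℝ (w i))).tsum_eq
  simp only [innerSL_apply_apply] at h2
  rw [real_inner_comm, ← h2, tsum_eq_single i fun j hj => hw hj.symm, real_inner_self_eq_norm_sq]

end Hilbert

section General

variable {α : Type*} [MeasurableSpace α] {μ : Measure α}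

lemma integral_mul_eq_inner (F : Lp ℝ 2 μ) {w : α → ℝ} (hw : MemLp w 2 μ) :
    ∫ p, F p * w p ∂μ = inner ℝ (hw.toLp w) F := by
  rw [L2.inner_def]
  refine integral_congr_ae ?_
  filter_upwards [hw.coeFn_toLp] with p hp
  simp [hp]

lemma integral_mul_coe (F G : Lp ℝ 2 μ) : ∫ p, F p * G p ∂μ = inner ℝ F G := by
  rw [integral_mul_eq_inner F (Lp.memLp G), Lp.toLp_coeFn, real_inner_comm]

lemma norm_toLp_sq {w : α → ℝ} (hw : MemLp w 2 μ) : ‖hw.toLp w‖ ^ 2 = ∫ x, w x ^ 2 ∂μ := by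
  rw [← real_inner_self_eq_norm_sq, L2.inner_def]
  refine integral_congr_ae ?_
  filter_upwards [hw.coeFn_toLp] with p hp
  simp [hp, sq]

lemma ae_eq_of_forall_integral_mul {f g : α → ℝ} (hf : MemLp f 2 μ) (hg : MemLp g 2 μ)
    (h : ∀ w : α → ℝ, MemLp w 2 μ → ∫ x, w x * f x ∂μ = ∫ x, w x * g x ∂μ) : f =ᵐ[μ] g := by
  have hfg := hf.sub hg
  have h1 := h _ hfg
  have h2 : ∫ x, (f x - g x) ^ 2 ∂μ = 0 := by
    have e : ∀ x, (f x - g x) ^ 2 = (f - g) x * f x - (f - g) x * g x := fun x => by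
      simp only [Pi.sub_apply]; ring
    simp only [e]
    have i1 : Integrable (fun x => (f - g) x * f x) μ := hfg.integrable_mul hf
    have i2 : Integrable (fun x => (f - g) x * g x) μ := hfg.integrable_mul hg
    rw [integral_sub i1 i2, h1, sub_self]
  have i3 : Integrable (fun x => (f x - g x) ^ 2) μ := hfg.integrable_sq
  rw [integral_eq_zero_iff_of_nonneg (fun x => sq_nonneg _) i3] at h2
  filter_upwards [h2] with x hx
  have := pow_eq_zero_iff (two_ne_zero) |>.1 hx
  linarith

end General

/-- Lebesgue measure on the heights `z > 0`. -/
abbrev heightMeasure : Measure ℝ := volume.restrict (Ioi (0 : ℝ))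

variable {D : HorizontalDomain}

lemma memLp_tensor {f : ℝ → ℝ} {v : Plane → ℝ} (hf : MemLp f 2 heightMeasure)
    (hv : MemLp v 2 D.measure) : MemLp (fun p : ℝ × Plane => f p.1 * v p.2) 2 D.cylMeasure := by
  have hm : AEStronglyMeasurable (fun p : ℝ × Plane => f p.1 * v p.2) D.cylMeasure :=
    (hf.1.comp_fst).mul (hv.1.comp_snd)
  rw [memLp_two_iff_integrable_sq hm]
  simp only [mul_pow]
  exact hf.integrable_sq.mul_prod hv.integrable_sq

/-- The function `f(z) v(x)` in `L²(ℝ₊ × Ω)`. -/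
def tensor (f : Lp ℝ 2 heightMeasure) (v : L2 D) : L2Cyl D :=
  (memLp_tensor (Lp.memLp f) (Lp.memLp v)).toLp _

lemma coeFn_tensor (f : Lp ℝ 2 heightMeasure) (v : L2 D) :
    tensor f v =ᵐ[D.cylMeasure] fun p => f p.1 * v p.2 :=
  MemLp.coeFn_toLp _

lemma inner_tensor (f g : Lp ℝ 2 heightMeasure) (v w : L2 D) :
    inner ℝ (tensor f v) (tensor g w) = inner ℝ f g * inner ℝ v w := by
  rw [← integral_mul_coe, ← integral_mul_coe f, ← integral_mul_coe v, ← integral_prod_mul]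
  refine integral_congr_ae ?_
  filter_upwards [coeFn_tensor f v, coeFn_tensor g w] with p h1 h2
  rw [h1, h2]; ring

variable (D) in
/-- The pairing of the horizontal slices of `F` with `v`. -/
def sliceCoef (v : Plane → ℝ) (F : ℝ × Plane → ℝ) (z : ℝ) : ℝ := ∫ x, F (z, x) * v x ∂D.measure

lemma sliceCoef_congr_right {v w : Plane → ℝ} (h : v =ᵐ[D.measure] w) (F : ℝ × Plane → ℝ) :
    sliceCoef D v F = sliceCoef D w F := by
  funext z
  refine integral_congr_ae ?_
  filter_upwards [h] with x hx
  rw [hx]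

lemma sliceCoef_congr {F G : ℝ × Plane → ℝ} (h : F =ᵐ[D.cylMeasure] G) (v : Plane → ℝ) :
    sliceCoef D v F =ᵐ[heightMeasure] sliceCoef D v G := by
  filter_upwards [slice_ae h] with z hz
  refine integral_congr_ae ?_
  filter_upwards [hz] with x hx
  rw [hx]

lemma sliceCoef_sq_le (F : ℝ × Plane → ℝ) {v : Plane → ℝ} (hv : MemLp v 2 D.measure)
    {z : ℝ} (hz : MemLp (fun x => F (z, x)) 2 D.measure) :
    sliceCoef D v F z ^ 2 ≤ (∫ x, F (z, x) ^ 2 ∂D.measure) * ∫ x, v x ^ 2 ∂D.measure := by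
  have e : sliceCoef D v F z = inner ℝ (hv.toLp v) (hz.toLp _) := by
    rw [← integral_mul_eq_inner]
    refine integral_congr_ae ?_
    filter_upwards [hz.coeFn_toLp] with x hx
    rw [hx]
  rw [e, ← norm_toLp_sq hv, ← norm_toLp_sq hz, ← mul_pow, mul_comm, ← sq_abs]
  gcongr
  exact abs_real_inner_le_norm _ _

lemma memLp_sliceCoef (F : L2Cyl D) {v : Plane → ℝ} (hv : MemLp v 2 D.measure) :
    MemLp (sliceCoef D v F) 2 heightMeasure := by
  have hm : AEStronglyMeasurable (sliceCoef D v F) heightMeasure :=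
    (((Lp.aestronglyMeasurable F).mul hv.1.comp_snd) :
      AEStronglyMeasurable (fun p : ℝ × Plane => F p * v p.2)
        (heightMeasure.prod D.measure)).integral_prod_right'
  rw [memLp_two_iff_integrable_sq hm]
  have hi : Integrable (fun p => F p ^ 2) (heightMeasure.prod D.measure) :=
    (Lp.memLp F).integrable_sq
  refine Integrable.mono' (hi.integral_prod_left.mul_const (∫ x, v x ^ 2 ∂D.measure)) (hm.pow 2) ?_
  filter_upwards [memLp_slice F] with z hz
  rw [Real.norm_of_nonneg (sq_nonneg _)]
  exact sliceCoef_sq_le F hv hz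

lemma integral_mul_sliceCoef (F : L2Cyl D) {f : ℝ → ℝ} {v : Plane → ℝ}
    (hf : MemLp f 2 heightMeasure) (hv : MemLp v 2 D.measure) :
    ∫ z, f z * sliceCoef D v F z ∂heightMeasure = ∫ p, F p * (f p.1 * v p.2) ∂D.cylMeasure := by
  have hi : Integrable (fun p : ℝ × Plane => F p * (f p.1 * v p.2))
    (heightMeasure.prod D.measure) :=
    (Lp.memLp F).integrable_mul (memLp_tensor hf hv)
  refine Eq.trans ?_ (integral_prod _ hi).symm
  refine integral_congr_ae (Eventually.of_forall fun z => ?_)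
  simp only [sliceCoef]
  rw [← integral_const_mul]
  congr 1; ext x; ring

/-- Identification of a slice coefficient by duality. -/
lemma sliceCoef_ae_eq (F : L2Cyl D) {v : Plane → ℝ} (hv : MemLp v 2 D.measure) {g : ℝ → ℝ}
    (hg : MemLp g 2 heightMeasure)
    (h : ∀ f : ℝ → ℝ, MemLp f 2 heightMeasure →
      ∫ p, F p * (f p.1 * v p.2) ∂D.cylMeasure = ∫ z, f z * g z ∂heightMeasure) :
    sliceCoef D v F =ᵐ[heightMeasure] g :=
  ae_eq_of_forall_integral_mul (memLp_sliceCoef F hv) hg fun f hf => by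
    rw [integral_mul_sliceCoef F hf hv, h f hf]

lemma sliceCoef_tensor (f : Lp ℝ 2 heightMeasure) (w : L2 D) (v : L2 D) :
    sliceCoef D v (tensor f w) =ᵐ[heightMeasure] fun z => f z * inner ℝ w v := by
  filter_upwards [sliceCoef_congr (coeFn_tensor f w) v] with z hz
  rw [hz, sliceCoef, ← integral_mul_coe, ← integral_const_mul]
  congr 1; ext x; ring

/-- Slice coefficients of an orthogonal-type series. -/
lemma sliceCoef_hasSum {u : ℕ → L2Cyl D} {F : L2Cyl D} (hF : HasSum u F) (v : L2 D) {i : ℕ}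
    {g : ℝ → ℝ} (hi : sliceCoef D v (u i) =ᵐ[heightMeasure] g)
    (h0 : ∀ j, j ≠ i → sliceCoef D v (u j) =ᵐ[heightMeasure] 0) :
    sliceCoef D v F =ᵐ[heightMeasure] g := by
  refine sliceCoef_ae_eq F (Lp.memLp v) ((memLp_congr_ae hi).1 (memLp_sliceCoef _ (Lp.memLp v)))
    fun f hf => ?_
  -- The slice at a fixed height is not continuous in L² of the cylinder. Pairing with f(z) v(x) is,
  -- so the series is summed after testing against an arbitrary f.
  have hw := memLp_tensor hf (Lp.memLp v)
  have h1 := (hF.mapL (innerSL ℝ (hw.toLp _))).tsum_eq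
  simp only [innerSL_apply_apply, ← integral_mul_eq_inner] at h1
  rw [← h1, tsum_eq_single i, ← integral_mul_sliceCoef _ hf (Lp.memLp v)]
  · refine integral_congr_ae ?_
    filter_upwards [hi] with z hz
    rw [hz]
  · intro j hj
    rw [← integral_mul_sliceCoef _ hf (Lp.memLp v)]
    refine integral_eq_zero_of_ae ?_
    filter_upwards [h0 j hj] with z hz
    simp [hz]

lemma eq_zero_of_slice_ae_eq_zero (F : L2Cyl D)
    (h : ∀ᵐ z ∂heightMeasure, (fun x => F (z, x)) =ᵐ[D.measure] 0) : F = 0 := by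
  rw [Lp.eq_zero_iff_ae_eq_zero]
  have hm : MeasurableSet {p : ℝ × Plane | F p = 0} :=
    (Lp.stronglyMeasurable F).measurable (measurableSet_singleton 0)
  exact (Measure.ae_prod_iff_ae_ae hm).2 h

variable {e : ℕ → L2 D} {k : ℕ → ℝ}

/-- On the torus the eigenbasis spans only functions of integral zero; comparing integrals recovers
the missing constant mode. -/
lemma toLp_eq_of_coef (he : IsEigenbasis D e k) {u : Plane → ℝ} (hu : MemLp u 2 D.measure)
    (w : L2 D) (h : ∀ i, ∫ x, u x * e i x ∂D.measure = inner ℝ (e i) w)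
    (h1 : D = .torus → ∫ x, u x ∂D.measure = ∫ x, w x ∂D.measure) : hu.toLp u = w := by
  rw [← sub_eq_zero]
  refine he.complete _ (fun hD => ?_) fun i => ?_
  · have hi := hu.integrable (q := 2) (by norm_num)
    have hj := (Lp.memLp w).integrable (q := 2) (by norm_num)
    rw [integral_congr_ae (Lp.coeFn_sub _ _)]
    simp only [Pi.sub_apply]
    rw [integral_sub ((integrable_congr hu.coeFn_toLp).2 hi) hj, integral_congr_ae hu.coeFn_toLp,
      h1 hD, sub_self]
  · rw [inner_sub_right, ← h i, sub_eq_zero, real_inner_comm, ← integral_mul_coe]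
    refine integral_congr_ae ?_
    filter_upwards [hu.coeFn_toLp] with x hx
    rw [hx]

/-- There are countably many coefficients, so off a single null set of heights they all vanish at
once and completeness applies to the slice. -/
lemma eq_zero_of_sliceCoef (he : IsEigenbasis D e k) (F : L2Cyl D)
    (h : ∀ i, sliceCoef D (e i) F =ᵐ[heightMeasure] 0)
    (h1 : D = .torus → sliceCoef D (fun _ => 1) F =ᵐ[heightMeasure] 0) : F = 0 := by
  refine eq_zero_of_slice_ae_eq_zero F ?_
  have h1' : ∀ᵐ z ∂heightMeasure, D = .torus → sliceCoef D (fun _ => 1) F z = 0 := by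
    by_cases hD : D = .torus
    · filter_upwards [h1 hD] with z hz _ using hz
    · exact Eventually.of_forall fun z h => absurd h hD
  filter_upwards [memLp_slice F, ae_all_iff.2 h, h1'] with z hz hz' hz1
  have h0 : ∫ x, (0 : L2 D) x ∂D.measure = 0 := by
    rw [integral_congr_ae (Lp.coeFn_zero ℝ 2 D.measure)]
    simp
  have := toLp_eq_of_coef he hz 0 (fun i => by rw [inner_zero_right]; exact hz' i)
    fun hD => by rw [h0]; simpa [sliceCoef] using hz1 hD
  have h2 := hz.coeFn_toLp
  rw [this] at h2
  exact h2.symm.trans (Lp.coeFn_zero ℝ 2 D.measure)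

end Slices

/-! ### Approximation of eigenfunctions by test functions; the Poincaré inequality on convex
domains. -/

section ConvexDomain

variable {D : HorizontalDomain}

lemma memLp_of_continuous (D : HorizontalDomain) {f : Plane → ℝ} (hf : Continuous f) :
    MemLp f 2 D.measure := by
  obtain ⟨C, hC⟩ := (carrier_isBounded D).isCompact_closure.exists_bound_of_continuousOn
    hf.continuousOn
  refine MemLp.of_bound hf.aestronglyMeasurable C ?_
  filter_upwards [ae_restrict_mem (measurableSet_carrier D)] with x hx using hC x
    (subset_closure hx)

lemma IsTest.contDiff {φ : Plane → ℝ} (h : IsTest D φ) : ContDiff ℝ ∞ φ := by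
  cases D <;> exact h.1

lemma IsTest.memLp {φ : Plane → ℝ} (h : IsTest D φ) : MemLp φ 2 D.measure :=
  memLp_of_continuous D h.contDiff.continuous

lemma contDiff_pderiv {φ : Plane → ℝ} (h : ContDiff ℝ ∞ φ) (j : Fin 2) :
    ContDiff ℝ ∞ (pderiv j φ) :=
  (h.fderiv_right (m := ∞) (by simp)).clm_apply contDiff_const

lemma tsupport_pderiv_subset (φ : Plane → ℝ) (j : Fin 2) : tsupport (pderiv j φ) ⊆ tsupport φ := by
  refine closure_minimal (fun x hx => ?_) (isClosed_tsupport φ)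
  refine support_fderiv_subset ℝ (f := φ) fun h => hx ?_
  simp [pderiv, h]

lemma IsTest.pderiv {φ : Plane → ℝ} (h : IsTest D φ) (j : Fin 2) : IsTest D (pderiv j φ) := by
  cases D with
  | torus =>
    refine ⟨contDiff_pderiv h.1 j, fun x l => ?_⟩
    have e : (fun y => φ (y + (2 * Real.pi) • unitVec l)) = φ := funext fun y => h.2 y l
    have := fderiv_comp_add_right (𝕜 := ℝ) (f := φ) (x := x) ((2 * Real.pi) • unitVec l)
    rw [e] at this
    simp only [SingularQG.pderiv]
    rw [this]
  | convex Ω h1 h2 h3 h4 =>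
    exact ⟨contDiff_pderiv h.1 j, h.2.1.of_isClosed_subset (isClosed_tsupport _)
      (tsupport_pderiv_subset φ j), (tsupport_pderiv_subset φ j).trans h.2.2⟩

lemma tendsto_toLp {φ : ℕ → Plane → ℝ} {u : Plane → ℝ} (hφ : ∀ n, MemLp (φ n) 2 D.measure)
    (hu : MemLp u 2 D.measure)
    (h : Tendsto (fun n => eLpNorm (φ n - u) 2 D.measure) atTop (𝓝 0)) :
    Tendsto (fun n => (hφ n).toLp (φ n)) atTop (𝓝 (hu.toLp u)) :=
  (Lp.tendsto_Lp_iff_tendsto_eLpNorm'' _ hφ _ hu).2 h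

lemma tendsto_integral_mul {φ : ℕ → Plane → ℝ} {u : Plane → ℝ} (hφ : ∀ n, MemLp (φ n) 2 D.measure)
    (hu : MemLp u 2 D.measure)
    (h : Tendsto (fun n => eLpNorm (φ n - u) 2 D.measure) atTop (𝓝 0)) {w : Plane → ℝ}
    (hw : MemLp w 2 D.measure) :
    Tendsto (fun n => ∫ x, w x * φ n x ∂D.measure) atTop (𝓝 (∫ x, w x * u x ∂D.measure)) := by
  have e : ∀ {v : Plane → ℝ} (hv : MemLp v 2 D.measure),
      ∫ x, w x * v x ∂D.measure = inner ℝ (hw.toLp w) (hv.toLp v) := fun {v} hv => by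
    rw [real_inner_comm, ← integral_mul_eq_inner]
    refine integral_congr_ae ?_
    filter_upwards [hw.coeFn_toLp] with x hx
    rw [hx]
  simp only [e hu, fun n => e (hφ n)]
  exact tendsto_const_nhds.inner (tendsto_toLp hφ hu h)

/-- Weak formulation of the eigenvalue problem for `e`, eigenvalue `k`, gradient `g`, together with
an approximating sequence `φ` of test functions in `H¹`, and the extension of the weak formulation
to all functions `u` with the lateral condition and with weak gradient `γ`. -/
structure EigenData (D : HorizontalDomain) (e : L2 D) (k : ℝ) (g : Fin 2 → L2 D)
    (φ : ℕ → Plane → ℝ) : Prop where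
  grad : IsWeakGradient D e g
  eigen : ∀ χ, IsTest D χ →
    ∑ j, ∫ x, g j x * pderiv j χ x ∂D.measure = k * ∫ x, e x * χ x ∂D.measure
  test : ∀ n, IsTest D (φ n)
  tendsto : Tendsto (fun n => eLpNorm (φ n - ⇑e) 2 D.measure) atTop (𝓝 0)
  tendsto_grad : ∀ j, Tendsto (fun n => eLpNorm (pderiv j (φ n) - ⇑(g j)) 2 D.measure) atTop (𝓝 0)
  slice : ∀ u, MemLp u 2 D.measure → LateralCondition D u → ∀ γ : Fin 2 → Plane → ℝ,
    (∀ j, MemLp (γ j) 2 D.measure) →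
    (∀ n j, ∫ x, u x * pderiv j (pderiv j (φ n)) x ∂D.measure
      = -∫ x, γ j x * pderiv j (φ n) x ∂D.measure) →
    ∑ j, ∫ x, γ j x * g j x ∂D.measure = k * ∫ x, u x * e x ∂D.measure

/-- Test the equation of `e` with the approximants of `e'` and pass to the limit. Gradients of
orthogonal eigenfunctions are then orthogonal, and the squared norm of the gradient of a unit
eigenfunction is its eigenvalue. -/
lemma EigenData.inner_grad {e e' : L2 D} {k k' : ℝ} {g g' : Fin 2 → L2 D} {φ φ' : ℕ → Plane → ℝ}
    (h : EigenData D e k g φ) (h' : EigenData D e' k' g' φ') :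
    ∑ j, inner ℝ (g j) (g' j) = k * inner ℝ e e' := by
  simp only [← integral_mul_coe]
  have h1 : Tendsto (fun n => ∑ j, ∫ x, g j x * pderiv j (φ' n) x ∂D.measure) atTop
      (𝓝 (∑ j, ∫ x, g j x * g' j x ∂D.measure)) :=
    tendsto_finsetSum _ fun j _ => tendsto_integral_mul (fun n => ((h'.test n).pderiv j).memLp)
      (Lp.memLp _) (h'.tendsto_grad j) (Lp.memLp _)
  have h2 := (tendsto_integral_mul (fun n => (h'.test n).memLp) (Lp.memLp _) h'.tendsto
    (Lp.memLp e)).const_mul k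
  exact tendsto_nhds_unique (h1.congr fun n => h.eigen _ (h'.test n)) h2

section Convex

variable {Ω : Set Plane} {ho : IsOpen Ω} {hne : Ω.Nonempty} {hb : Bornology.IsBounded Ω}
  {hc : Convex ℝ Ω}

lemma integral_mul_pderiv_of_compact {φ ψ : Plane → ℝ} (hφ : ContDiff ℝ ∞ φ)
    (hφc : HasCompactSupport φ) (hφs : tsupport φ ⊆ Ω) (hψ : ContDiff ℝ ∞ ψ) (j : Fin 2) :
    ∫ x in Ω, ψ x * pderiv j φ x = -∫ x in Ω, pderiv j ψ x * φ x := by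
  have hφ0 : ∀ x, x ∉ Ω → φ x = 0 := fun x hx => by
    by_contra h
    exact hx (hφs (subset_tsupport _ h))
  have hφ0' : ∀ x, x ∉ Ω → pderiv j φ x = 0 := fun x hx => by
    by_contra h
    exact hx (hφs (tsupport_pderiv_subset φ j (subset_tsupport _ h)))
  have hc' : HasCompactSupport (pderiv j φ) :=
    hφc.of_isClosed_subset (isClosed_tsupport _) (tsupport_pderiv_subset φ j)
  rw [setIntegral_eq_integral_of_forall_compl_eq_zero fun x hx => by rw [hφ0' x hx, mul_zero],
    setIntegral_eq_integral_of_forall_compl_eq_zero fun x hx => by rw [hφ0 x hx, mul_zero]]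
  refine integral_mul_fderiv_eq_neg_fderiv_mul_of_integrable ?_ ?_ ?_
    (fun x _ => hψ.differentiable (by simp) x) (fun x _ => hφ.differentiable (by simp) x)
  · exact ((continuous_pderiv hψ j).mul hφ.continuous).integrable_of_hasCompactSupport hφc.mul_left
  · exact (hψ.continuous.mul (continuous_pderiv hφ j)).integrable_of_hasCompactSupport hc'.mul_left
  · exact (hψ.continuous.mul hφ.continuous).integrable_of_hasCompactSupport hφc.mul_left

/-- The Poincaré inequality for `C_c^∞(Ω)`. -/
lemma integral_sq_le_of_compact {φ : Plane → ℝ} (hφ : ContDiff ℝ ∞ φ)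
    (hφc : HasCompactSupport φ) (hφs : tsupport φ ⊆ Ω) (hΩ : MeasurableSet Ω) {R : ℝ}
    (hR : ∀ x ∈ Ω, |x 0| ≤ R) :
    ∫ x in Ω, φ x ^ 2 ≤ 4 * R ^ 2 * ∫ x in Ω, pderiv 0 φ x ^ 2 := by
  set ψ : Plane → ℝ := fun x => x 0 with hψ
  have hψc : ContDiff ℝ ∞ ψ := (EuclideanSpace.proj (𝕜 := ℝ) (0 : Fin 2)).contDiff
  have hψd : ∀ x, pderiv 0 ψ x = 1 := fun x => by
    have : ψ = (EuclideanSpace.proj (0 : Fin 2) : Plane →L[ℝ] ℝ) := rfl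
    rw [pderiv, this, ContinuousLinearMap.fderiv]
    simp [unitVec]
  have hsq : pderiv 0 (fun x => φ x * φ x) = fun x => 2 * φ x * pderiv 0 φ x := by
    funext x
    have hd := hφ.differentiable (by simp) x
    simp only [pderiv]
    rw [fderiv_fun_mul hd hd]
    simp; ring
  -- Since ∂₀ x₀ = 1, integrating φ² by parts against x₀ gives ∫ φ² = -∫ 2 x₀ φ ∂₀φ.
  have h := integral_mul_pderiv_of_compact (Ω := Ω) (φ := fun x => φ x * φ x) (hφ.mul hφ)
    hφc.mul_left ((closure_mono (Function.support_mul_subset_left φ φ)).trans hφs) hψc 0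
  simp only [hψd, hsq, one_mul] at h
  have hint : ∀ {f : Plane → ℝ}, Continuous f → HasCompactSupport f → IntegrableOn f Ω :=
    fun hf hfc => (hf.integrable_of_hasCompactSupport hfc).integrableOn
  have hdc : HasCompactSupport (pderiv 0 φ) :=
    hφc.of_isClosed_subset (isClosed_tsupport _) (tsupport_pderiv_subset φ 0)
  have i1 : IntegrableOn (fun x => φ x ^ 2) Ω := by
    simp only [sq]; exact hint (hφ.continuous.mul hφ.continuous) hφc.mul_left
  have i2 : IntegrableOn (fun x => pderiv 0 φ x ^ 2) Ω := by
    simp only [sq]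
    exact hint ((continuous_pderiv hφ 0).mul (continuous_pderiv hφ 0)) hdc.mul_left
  have i3 : IntegrableOn (fun x => -(ψ x * (2 * φ x * pderiv 0 φ x))) Ω :=
    hint (hψc.continuous.mul ((continuous_const.mul hφ.continuous).mul
      (continuous_pderiv hφ 0))).neg (hdc.mul_left.mul_left).neg
  have h2 : ∫ x in Ω, -(ψ x * (2 * φ x * pderiv 0 φ x))
      ≤ ∫ x in Ω, (1 / 2 * φ x ^ 2 + 2 * R ^ 2 * pderiv 0 φ x ^ 2) := by
    -- Young's inequality with weights 1/2 and 2; the term (1/2) ∫ φ² is absorbed on the left,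
    -- whence the constant 4 R².
    refine setIntegral_mono_on i3 ((i1.const_mul _).add (i2.const_mul _)) hΩ fun x hx => ?_
    have h3 : ψ x ^ 2 ≤ R ^ 2 := sq_le_sq' (abs_le.1 (hR x hx)).1 (abs_le.1 (hR x hx)).2
    have h4 := mul_le_mul_of_nonneg_right h3 (sq_nonneg (pderiv 0 φ x))
    nlinarith [sq_nonneg (φ x + 2 * ψ x * pderiv 0 φ x)]
  rw [integral_add (i1.const_mul _) (i2.const_mul _), integral_const_mul, integral_const_mul,
    integral_neg] at h2
  simp only [sq] at h2 ⊢
  linarith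

/-- A function in H¹₀ comes with approximants whose gradients converge to some g', while the
eigenvalue problem comes with a weak gradient g. Weak gradients on an open set are unique, so g' = g
and the approximants converge to the eigenfunction in H¹. -/
lemma convex_eigenData (hD : D = .convex Ω ho hne hb hc) {e : L2 D} {k : ℝ} {g : Fin 2 → L2 D}
    (hl : LateralCondition D e) (hg : IsWeakGradient _ e g)
    (he : ∀ χ, IsTest D χ →
      ∑ j, ∫ x, g j x * pderiv j χ x ∂D.measure = k * ∫ x, e x * χ x ∂D.measure) :
    ∃ φ, EigenData D e k g φ := by
  have hμ : D.measure = volume.restrict Ω := by subst hD; rfl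
  have hT : ∀ {φ}, IsTest D φ ↔ (ContDiff ℝ ∞ φ ∧ HasCompactSupport φ ∧ tsupport φ ⊆ Ω) := by
    subst hD; exact Iff.rfl
  have hA : ∀ {u}, LateralCondition D u ↔ MemH10 Ω u := by subst hD; exact Iff.rfl
  -- the gradient of an element of `H¹₀`
  have key : ∀ {u : Plane → ℝ} (hu : MemLp u 2 D.measure) {χ : ℕ → Plane → ℝ}
    {γ : Fin 2 → Plane → ℝ}
      (_ : ∀ n, IsTest D (χ n)) (_ : ∀ j, MemLp (γ j) 2 D.measure)
      (_ : Tendsto (fun n => eLpNorm (χ n - u) 2 D.measure) atTop (𝓝 0))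
      (_ : ∀ j, Tendsto (fun n => eLpNorm (pderiv j (χ n) - γ j) 2 D.measure) atTop (𝓝 0))
      {ψ : Plane → ℝ} (_ : IsTest D ψ) (j : Fin 2),
      ∫ x, u x * pderiv j ψ x ∂D.measure = -∫ x, γ j x * ψ x ∂D.measure := by
    intro u hu χ γ hχ hγ h1 h2 ψ hψ j
    have l1 := tendsto_integral_mul (fun n => (hχ n).memLp) hu h1 (hψ.pderiv j).memLp
    have l2 := (tendsto_integral_mul (fun n => ((hχ n).pderiv j).memLp) (hγ j) (h2 j) hψ.memLp).neg
    have := tendsto_nhds_unique (l1.congr fun n => ?_) l2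
    · simpa only [mul_comm] using this
    · have := integral_mul_pderiv_of_compact (hT.1 hψ).1 (hT.1 hψ).2.1 (hT.1 hψ).2.2
        (hχ n).contDiff j
      simp only [hμ, mul_comm (pderiv j ψ _), this, mul_comm (ψ _)]
  obtain ⟨hL, φ, g', hφ, hg', l1, l2⟩ := hA.1 hl
  rw [← hμ] at hL l1
  simp only [← hμ] at l2 hg'
  simp only [← hT] at hφ
  have hgg : ∀ j, g j =ᵐ[D.measure] g' j := fun j => by
    have hsub : MemLp (fun x => g j x - g' j x) 2 D.measure := (Lp.memLp (g j)).sub (hg' j)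
    have hint : IntegrableOn (fun x => g j x - g' j x) Ω volume := by
      rw [IntegrableOn, ← hμ]
      exact hsub.integrable (by norm_num)
    have := ho.ae_eq_zero_of_integral_contDiff_smul_eq_zero hint.locallyIntegrableOn
      fun χ h1 h2 h3 => ?_
    · have hae : ∀ {P : Plane → Prop}, (∀ᵐ x, x ∈ Ω → P x) → ∀ᵐ x ∂D.measure, P x := fun h => by
        rw [hμ]
        exact (ae_restrict_iff' ho.measurableSet).2 h
      have h4 : ∀ᵐ x ∂D.measure, g j x - g' j x = 0 := hae this
      exact h4.mono fun x hx => sub_eq_zero.1 hx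
    · have hχ : IsTest D χ := hT.2 ⟨h1, h2, h3⟩
      rw [← setIntegral_eq_integral_of_forall_compl_eq_zero (s := Ω) fun x hx => ?_]
      · have e1 := hg χ hχ j
        have e2 := key hL hφ hg' l1 l2 hχ j
        have i1 : Integrable (fun x => g j x * χ x) D.measure :=
          (Lp.memLp (g j)).integrable_mul hχ.memLp
        have i2 : Integrable (fun x => g' j x * χ x) D.measure := (hg' j).integrable_mul hχ.memLp
        have e3 : ∫ x, (g j x * χ x - g' j x * χ x) ∂D.measure = 0 := by
          rw [integral_sub i1 i2]
          linarith
        rw [← e3, ← hμ]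
        refine integral_congr_ae (Eventually.of_forall fun x => ?_)
        simp only [smul_eq_mul]
        ring
      · have : χ x = 0 := by
          by_contra h
          exact hx (h3 (subset_tsupport _ h))
        simp [this]
  have l2' : ∀ j, Tendsto (fun n => eLpNorm (pderiv j (φ n) - ⇑(g j)) 2 D.measure) atTop (𝓝 0) :=
    fun j => (l2 j).congr fun n => eLpNorm_congr_ae ((hgg j).symm.mono fun x hx => by
      simp only [Pi.sub_apply, hx])
  refine ⟨φ, hg, he, hφ, l1, l2', ?_⟩
  intro u hu hu' γ hγ hγu
  obtain ⟨-, χ, γ', hχ, hγ', m1, m2⟩ := hA.1 hu'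
  rw [← hμ] at m1
  simp only [← hμ] at m2 hγ'
  simp only [← hT] at hχ
  -- The family `γ` agrees with the H¹₀ gradient `γ'` of u only against the functions ∂_j φ_n. These
  -- converge to g_j, which is all that the pairing with g needs. For `γ'` the equation of `e` can
  -- be tested with the approximants of u.
  have h1 : ∀ n, ∑ j, ∫ x, γ j x * pderiv j (φ n) x ∂D.measure
      = ∑ j, ∫ x, γ' j x * pderiv j (φ n) x ∂D.measure := fun n =>
    Finset.sum_congr rfl fun j _ => by
      have e1 := hγu n j
      have e2 := key hu hχ hγ' m1 m2 (IsTest.pderiv (hφ n) j) j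
      linarith
  have h2 : ∀ {γ : Fin 2 → Plane → ℝ} (_ : ∀ j, MemLp (γ j) 2 D.measure),
      Tendsto (fun n => ∑ j, ∫ x, γ j x * pderiv j (φ n) x ∂D.measure) atTop
        (𝓝 (∑ j, ∫ x, γ j x * g j x ∂D.measure)) := fun hγ =>
    tendsto_finsetSum _ fun j _ => tendsto_integral_mul
      (fun n => (IsTest.pderiv (hφ n) j).memLp) (Lp.memLp _) (l2' j) (hγ j)
  rw [tendsto_nhds_unique ((h2 hγ).congr h1) (h2 hγ')]
  have h3 : Tendsto (fun n => ∑ j, ∫ x, g j x * pderiv j (χ n) x ∂D.measure) atTop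
      (𝓝 (∑ j, ∫ x, g j x * γ' j x ∂D.measure)) :=
    tendsto_finsetSum _ fun j _ => tendsto_integral_mul
      (fun n => (IsTest.pderiv (hχ n) j).memLp) (hγ' j) (m2 j) (Lp.memLp _)
  have h4 := (tendsto_integral_mul (fun n => IsTest.memLp (hχ n)) hu m1 (Lp.memLp e)).const_mul k
  have := tendsto_nhds_unique (h3.congr fun n => he _ (hχ n)) h4
  simpa only [mul_comm] using this

/-- The Poincaré inequality passes to the H¹ limit, and the squared norm of the gradient of a unit
eigenfunction is k. The bound depends only on the size of Ω in the direction x₀. -/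
lemma convex_eigenvalue_lower_bound (hD : D = .convex Ω ho hne hb hc) :
    ∃ c : ℝ, 0 < c ∧ ∀ (e : L2 D) (k : ℝ) g φ, EigenData D e k g φ → ‖e‖ = 1 → c ≤ k := by
  have hμ : D.measure = volume.restrict Ω := by subst hD; rfl
  have hT : ∀ {φ}, IsTest D φ → (ContDiff ℝ ∞ φ ∧ HasCompactSupport φ ∧ tsupport φ ⊆ Ω) := by
    subst hD; exact id
  obtain ⟨R, hR⟩ := (Metric.isBounded_iff_subset_closedBall (0 : Plane)).1 hb
  have hR' : ∀ x ∈ Ω, |x 0| ≤ |R| + 1 := fun x hx => by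
    have h1 : ‖x‖ ≤ R := mem_closedBall_zero_iff.1 (hR hx)
    have h2 : ‖x 0‖ ≤ ‖x‖ := PiLp.norm_apply_le x 0
    rw [Real.norm_eq_abs] at h2
    linarith [le_abs_self R]
  have hR0 : 0 < |R| + 1 := by positivity
  refine ⟨1 / (4 * (|R| + 1) ^ 2), by positivity, fun e k g φ h he1 => ?_⟩
  rw [div_le_iff₀ (by positivity)]
  have l1 := ((tendsto_toLp (fun n => (h.test n).memLp) (Lp.memLp _) h.tendsto).norm).pow 2
  have l2 := (((tendsto_toLp (fun n => ((h.test n).pderiv 0).memLp) (Lp.memLp _)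
    (h.tendsto_grad 0)).norm).pow 2).const_mul (4 * (|R| + 1) ^ 2)
  have h1 := le_of_tendsto_of_tendsto' l1 l2 fun n => by
    rw [norm_toLp_sq, norm_toLp_sq, hμ]
    obtain ⟨t1, t2, t3⟩ := hT (h.test n)
    exact integral_sq_le_of_compact t1 t2 t3 ho.measurableSet hR'
  rw [Lp.toLp_coeFn, Lp.toLp_coeFn, he1] at h1
  have h2 := h.inner_grad h
  rw [Fin.sum_univ_two, real_inner_self_eq_norm_sq, real_inner_self_eq_norm_sq,
    real_inner_self_eq_norm_sq, he1] at h2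
  have h3 : ‖g 0‖ ^ 2 ≤ k := by nlinarith [sq_nonneg ‖g 1‖]
  have : 4 * (|R| + 1) ^ 2 * ‖g 0‖ ^ 2 ≤ 4 * (|R| + 1) ^ 2 * k := by gcongr
  linarith

end Convex

end ConvexDomain

/-! ### Calculus and Fourier series on the torus. -/

section Torus

section TorusCalculus

lemma torus_measure : HorizontalDomain.torus.measure
    = volume.restrict {x : Plane | ∀ j, x j ∈ Ioo (0 : ℝ) (2 * Real.pi)} := rfl

/-- The open cell is replaced by a closed box in coordinates, from which it differs by a null set;
this is the setting of the divergence theorem. -/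
lemma integral_torus (g : Plane → ℝ) : ∫ x, g x ∂HorizontalDomain.torus.measure
    = ∫ y in Icc (0 : Fin 2 → ℝ) (fun _ => 2 * Real.pi), g (WithLp.toLp 2 y) := by
  have hemb : MeasurableEmbedding (WithLp.toLp 2 : (Fin 2 → ℝ) → Plane) :=
    (MeasurableEquiv.toLp 2 (Fin 2 → ℝ)).measurableEmbedding
  rw [torus_measure, ← (PiLp.volume_preserving_toLp (Fin 2)).setIntegral_preimage_emb hemb]
  have e : (WithLp.toLp 2 : (Fin 2 → ℝ) → Plane) ⁻¹' {x : Plane | ∀ j,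
    x j ∈ Ioo (0 : ℝ) (2 * Real.pi)}
      = pi univ fun i => Ioo ((0 : Fin 2 → ℝ) i) ((fun _ => 2 * Real.pi : Fin 2 → ℝ) i) := by
    ext y; simp
  rw [e]
  exact setIntegral_congr_set Measure.univ_pi_Ioo_ae_eq_Icc

/-- The integral of a partial derivative of a smooth periodic function vanishes. -/
lemma integral_pderiv_torus {φ : Plane → ℝ} (hφ : IsTest .torus φ) (j : Fin 2) :
    ∫ x, pderiv j φ x ∂HorizontalDomain.torus.measure = 0 := by
  rw [integral_torus]
  set T : (Fin 2 → ℝ) ≃L[ℝ] Plane := (EuclideanSpace.equiv (Fin 2) ℝ).symm with hT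
  have hTy : ∀ y, T y = WithLp.toLp 2 y := fun y => rfl
  have hd : ∀ y, HasFDerivAt (fun y => φ (T y)) ((fderiv ℝ φ (T y)).comp
    (T : (Fin 2 → ℝ) →L[ℝ] Plane)) y :=
    fun y => ((hφ.1.differentiable (by simp) (T y)).hasFDerivAt).comp y T.hasFDerivAt
  have hcont : Continuous fun y => φ (T y) := hφ.1.continuous.comp T.continuous
  have hsum : ∀ y : Fin 2 → ℝ, ∑ i, (if i = j then (fderiv ℝ φ (T y)).comp
      (T : (Fin 2 → ℝ) →L[ℝ] Plane) else 0) (Pi.single i (1 : ℝ))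
        = pderiv j φ (WithLp.toLp 2 y) := by
    intro y
    rw [Finset.sum_eq_single j]
    · simp [pderiv, unitVec, hTy]
    · intro i _ hi
      simp [hi]
    · simp
  -- The divergence theorem for the field whose only nonzero component is φ, in direction j. The
  -- integrals over the two opposite faces cancel by periodicity.
  have key := integral_divergence_of_hasFDerivAt_off_countable' (n := 1) (0 : Fin 2 → ℝ)
    (fun _ => 2 * Real.pi) (fun i => by simp [Real.pi_pos.le])
    (fun i y => if i = j then φ (T y) else 0)
    (fun i y => if i = j then (fderiv ℝ φ (T y)).comp (T : (Fin 2 → ℝ) →L[ℝ] Plane) else 0)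
    ∅ (by simp) ?_ ?_ ?_
  · simp only [hsum] at key
    rw [key]
    refine Finset.sum_eq_zero fun i _ => ?_
    rw [sub_eq_zero]
    by_cases hi : i = j
    · subst hi
      simp only [if_true]
      congr 1
      ext y
      refine Eq.trans ?_ (hφ.2 (T (i.insertNth (0 : ℝ) y)) i)
      congr 1
      ext l
      rcases eq_or_ne l i with rfl | hl
      · simp [hTy, unitVec]
      · obtain ⟨l', rfl⟩ := Fin.exists_succAbove_eq hl
        simp [hTy, unitVec, hl]
    · simp [hi]
  · intro i
    by_cases hi : i = j
    · simpa [hi] using hcont.continuousOn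
    · simpa [hi] using continuousOn_const
  · intro y _ i
    by_cases hi : i = j
    · simpa [hi] using hd y
    · simpa [hi] using hasFDerivAt_const (0 : ℝ) y
  · simp only [hsum]
    exact ((continuous_pderiv hφ.1 j).comp (PiLp.continuous_toLp 2 _)).continuousOn.integrableOn_Icc

lemma IsTest.mul_torus {φ ψ : Plane → ℝ} (hφ : IsTest .torus φ) (hψ : IsTest .torus ψ) :
    IsTest .torus (fun x => φ x * ψ x) :=
  ⟨hφ.1.mul hψ.1, fun x j => by simp only [hφ.2, hψ.2]⟩

lemma integral_mul_pderiv_torus {φ ψ : Plane → ℝ} (hφ : IsTest .torus φ) (hψ : IsTest .torus ψ)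
    (j : Fin 2) : ∫ x, φ x * pderiv j ψ x ∂HorizontalDomain.torus.measure
      = -∫ x, pderiv j φ x * ψ x ∂HorizontalDomain.torus.measure := by
  have h := integral_pderiv_torus (hφ.mul_torus hψ) j
  have e : pderiv j (fun x => φ x * ψ x) = fun x => φ x * pderiv j ψ x + pderiv j φ x * ψ x := by
    funext x
    simp only [pderiv]
    rw [fderiv_fun_mul (hφ.1.differentiable (by simp) x) (hψ.1.differentiable (by simp) x)]
    simp [mul_comm]
  have i1 : Integrable (fun x => φ x * pderiv j ψ x) HorizontalDomain.torus.measure :=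
    hφ.memLp.integrable_mul (hψ.pderiv j).memLp
  have i2 : Integrable (fun x => pderiv j φ x * ψ x) HorizontalDomain.torus.measure :=
    (hφ.pderiv j).memLp.integrable_mul hψ.memLp
  rw [e, integral_add i1 i2] at h
  linarith

/-- The linear form `x ↦ n · x`. -/
def torusPhase (n : Fin 2 → ℤ) : Plane →L[ℝ] ℝ := ∑ j, (n j : ℝ) • EuclideanSpace.proj j

lemma torusPhase_apply (n : Fin 2 → ℤ) (x : Plane) : torusPhase n x = ∑ j, (n j : ℝ) * x j := by
  simp [torusPhase]

lemma torusPhase_unitVec (n : Fin 2 → ℤ) (j : Fin 2) : torusPhase n (unitVec j) = n j := by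
  rw [torusPhase_apply, Finset.sum_eq_single j] <;> simp +contextual [unitVec]

lemma torusPhase_add (n : Fin 2 → ℤ) (x : Plane) (j : Fin 2) :
    torusPhase n (x + (2 * Real.pi) • unitVec j) = torusPhase n x + n j * (2 * Real.pi) := by
  rw [map_add, map_smul, torusPhase_unitVec, smul_eq_mul, mul_comm]

lemma isTest_cos (n : Fin 2 → ℤ) : IsTest .torus fun x => Real.cos (torusPhase n x) :=
  ⟨Real.contDiff_cos.comp (torusPhase n).contDiff, fun x j => by
    simp only [torusPhase_add, Real.cos_add_int_mul_two_pi]⟩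

lemma isTest_sin (n : Fin 2 → ℤ) : IsTest .torus fun x => Real.sin (torusPhase n x) :=
  ⟨Real.contDiff_sin.comp (torusPhase n).contDiff, fun x j => by
    simp only [torusPhase_add, Real.sin_add_int_mul_two_pi]⟩

lemma pderiv_cos (n : Fin 2 → ℤ) (j : Fin 2) :
    pderiv j (fun x => Real.cos (torusPhase n x)) = fun x =>
      -(n j : ℝ) * Real.sin (torusPhase n x) := by
  funext x
  rw [pderiv, ((torusPhase n).hasFDerivAt.cos).fderiv]
  simp [torusPhase_unitVec, mul_comm]

lemma pderiv_sin (n : Fin 2 → ℤ) (j : Fin 2) :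
    pderiv j (fun x => Real.sin (torusPhase n x)) = fun x =>
      (n j : ℝ) * Real.cos (torusPhase n x) := by
  funext x
  rw [pderiv, ((torusPhase n).hasFDerivAt.sin).fderiv]
  simp [torusPhase_unitVec, mul_comm]

lemma pderiv_const_mul (c : ℝ) {φ : Plane → ℝ} (hφ : ContDiff ℝ ∞ φ) (j : Fin 2) :
    pderiv j (fun x => c * φ x) = fun x => c * pderiv j φ x :=
  pderiv_smul c hφ j

end TorusCalculus

section TorusFourier

/-- Haar probability measure on the circle. -/
local instance : MeasureSpace UnitAddCircle := ⟨AddCircle.haarAddCircle⟩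

/-- The representative in `(0, 2π]²` of a point of the unit torus. -/
def torusLift (t : UnitAddTorus (Fin 2)) : Plane :=
  (2 * Real.pi) • WithLp.toLp 2 (UnitAddTorus.measurableEquivPiIoc (0 : Fin 2 → ℝ) t).1

lemma measurable_torusLift : Measurable torusLift :=
  (measurable_const_smul (2 * Real.pi)).comp ((WithLp.measurable_toLp 2 _).comp
    (measurable_subtype_coe.comp (UnitAddTorus.measurableEquivPiIoc (0 : Fin 2 → ℝ)).measurable))

/-- Haar measure on the unit torus becomes Lebesgue measure on the unit cell, which is then dilated
by 2π. Only the finiteness and the non-vanishing of the constant matter, for carrying L² membership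
one way and almost-everywhere equalities the other. -/
lemma map_torusLift : ∃ c : ENNReal, c ≠ 0 ∧ c ≠ ⊤ ∧
    (volume : Measure (UnitAddTorus (Fin 2))).map torusLift
      = c • HorizontalDomain.torus.measure := by
  have h2 : (2 * Real.pi) ≠ 0 := by positivity
  have hpi := Real.pi_pos
  set B : Set (Fin 2 → ℝ) := {x | ∀ i, x i ∈ Ioc ((0 : Fin 2 → ℝ) i) ((0 : Fin 2 → ℝ) i + 1)}
    with hB
  have hBm : MeasurableSet B := MeasurableSet.univ_pi' fun i => measurableSet_Ioc
  have hBpi : B = pi univ fun i => Ioc ((0 : Fin 2 → ℝ) i) ((0 : Fin 2 → ℝ) i + 1) := by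
    ext; simp [hB]
  have m1 : (volume : Measure (UnitAddTorus (Fin 2))).map
      (fun t => (UnitAddTorus.measurableEquivPiIoc (0 : Fin 2 → ℝ) t).1) = volume.restrict B := by
    have h3 := (UnitAddTorus.measurePreserving_equivPiIoc (0 : Fin 2 → ℝ)).map_eq
    have h4 := map_comap_subtype_coe hBm (volume : Measure (Fin 2 → ℝ))
    refine Eq.trans ?_ h4
    refine Eq.trans ?_ (congrArg (Measure.map Subtype.val) h3)
    exact (Measure.map_map measurable_subtype_coe (MeasurableEquiv.measurable _)).symm
  set B' : Set (Fin 2 → ℝ) := pi univ fun i => Ioo ((0 : Fin 2 → ℝ) i)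
    ((0 : Fin 2 → ℝ) i + 1) with hB'
  have m2 : (volume : Measure (Fin 2 → ℝ)).restrict B = volume.restrict B' := by
    refine Measure.restrict_congr_set ?_
    rw [hBpi]
    exact Measure.univ_pi_Ioc_ae_eq_Icc.trans Measure.univ_pi_Ioo_ae_eq_Icc.symm
  set A : Set Plane := {x : Plane | ∀ j, x j ∈ Ioo (0 : ℝ) (2 * Real.pi)} with hA
  have hAm : MeasurableSet A := measurableSet_carrier .torus
  set L : (Fin 2 → ℝ) → Plane := fun y => (2 * Real.pi) • WithLp.toLp 2 y with hL
  have hLm : Measurable L :=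
    (measurable_const_smul (2 * Real.pi)).comp (WithLp.measurable_toLp 2 _)
  have hpre : L ⁻¹' A = B' := by
    ext y
    simp only [hL, hA, hB', mem_preimage, mem_ofPred_eq, Set.mem_pi, mem_univ, true_imp_iff]
    refine forall_congr' fun i => ?_
    have e : ((2 * Real.pi) • (WithLp.toLp 2 y : Plane)) i = 2 * Real.pi * y i := rfl
    rw [e]
    simp only [mem_Ioo, Pi.zero_apply, zero_add]
    constructor
    · rintro ⟨h3, h4⟩
      exact ⟨by by_contra h; nlinarith, by by_contra h; nlinarith⟩
    · rintro ⟨h3, h4⟩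
      exact ⟨by positivity, by nlinarith⟩
  have m3 : (volume : Measure (Fin 2 → ℝ)).map L
      = ENNReal.ofReal (abs ((2 * Real.pi) ^ Module.finrank ℝ Plane)⁻¹) • volume := by
    rw [← Measure.map_addHaar_smul (volume : Measure Plane) h2,
      ← (PiLp.volume_preserving_toLp (Fin 2)).map_eq, Measure.map_map (measurable_const_smul _)
      (WithLp.measurable_toLp 2 _)]
    rfl
  refine ⟨ENNReal.ofReal (abs ((2 * Real.pi) ^ Module.finrank ℝ Plane)⁻¹), ?_,
    ENNReal.ofReal_ne_top, ?_⟩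
  · rw [Ne, ENNReal.ofReal_eq_zero, not_le]
    positivity
  · have e : torusLift = L ∘ fun t => (UnitAddTorus.measurableEquivPiIoc (0 : Fin 2 → ℝ) t).1 := rfl
    have hm : Measurable fun t => (UnitAddTorus.measurableEquivPiIoc (0 : Fin 2 → ℝ) t).1 :=
      measurable_subtype_coe.comp (MeasurableEquiv.measurable _)
    rw [e, ← Measure.map_map hLm hm, m1, m2,
      ← hpre, ← Measure.restrict_map hLm hAm, m3, Measure.restrict_smul, torus_measure]

lemma mFourier_eq_exp (n : Fin 2 → ℤ) (t : UnitAddTorus (Fin 2)) :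
    UnitAddTorus.mFourier n t = Complex.exp (torusPhase n (torusLift t) * Complex.I) := by
  have h : ∀ i, t i = ((UnitAddTorus.measurableEquivPiIoc (0 : Fin 2 → ℝ) t).1 i : UnitAddCircle) :=
    fun i => (AddCircle.coe_equivIoc (p := (1 : ℝ)) (a := 0)).symm
  have hl : ∀ i, (torusLift t) i = 2 * Real.pi * (UnitAddTorus.measurableEquivPiIoc
    (0 : Fin 2 → ℝ) t).1 i :=
    fun i => rfl
  simp only [UnitAddTorus.mFourier, ContinuousMap.coe_mk]
  rw [Fin.prod_univ_two, h 0, h 1, fourier_coe_apply, fourier_coe_apply, ← Complex.exp_add,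
    torusPhase_apply, Fin.sum_univ_two, hl 0, hl 1]
  congr 1
  push_cast
  ring

/-- A function on the torus with finitely many nonzero Fourier coefficients is a trigonometric
polynomial. -/
lemma torus_eq_trig_polynomial (u : L2 .torus) (S : Finset (Fin 2 → ℤ))
    (hS : ∀ n, n ∉ S →
      ∫ x, u x * Real.cos (torusPhase n x) ∂HorizontalDomain.torus.measure = 0 ∧
      ∫ x, u x * Real.sin (torusPhase n x) ∂HorizontalDomain.torus.measure = 0) :
    ∃ α β : (Fin 2 → ℤ) → ℝ, u =ᵐ[HorizontalDomain.torus.measure]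
      fun x => ∑ n ∈ S, (α n * Real.cos (torusPhase n x) + β n * Real.sin (torusPhase n x)) := by
  obtain ⟨c, hc0, hc1, hmap⟩ := map_torusLift
  have hum : Measurable u := (Lp.stronglyMeasurable u).measurable
  have hUm : MemLp (fun t => ((u (torusLift t) : ℝ) : ℂ)) 2
    (volume : Measure (UnitAddTorus (Fin 2))) := by
    have h1 : MemLp u 2 ((volume : Measure (UnitAddTorus (Fin 2))).map torusLift) := by
      rw [hmap]
      exact (Lp.memLp u).smul_measure hc1
    exact (h1.comp_of_map measurable_torusLift.aemeasurable).ofReal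
  set U := hUm.toLp _ with hU
  have hcoef : ∀ n, n ∉ S → UnitAddTorus.mFourierCoeff U n = 0 := by
    intro n hn
    have e1 : UnitAddTorus.mFourierCoeff U n = ∫ t, (fun x : Plane =>
        ((u x * Real.cos (torusPhase n x) : ℝ) : ℂ) - ((u x * Real.sin (torusPhase n x) : ℝ) : ℂ)
          * Complex.I) (torusLift t) := by
      rw [UnitAddTorus.mFourierCoeff]
      refine integral_congr_ae ?_
      filter_upwards [hUm.coeFn_toLp] with t ht
      rw [hU, ht, mFourier_eq_exp, smul_eq_mul]
      have : torusPhase (-n) (torusLift t) = -torusPhase n (torusLift t) := by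
        simp [torusPhase_apply]
      rw [this, Complex.exp_mul_I]
      push_cast
      rw [Complex.cos_neg, Complex.sin_neg]
      ring
    have ic : ∀ {w : Plane → ℝ}, IsTest .torus w →
        Integrable (fun x => ((u x * w x : ℝ) : ℂ)) HorizontalDomain.torus.measure := fun hw =>
      ((Lp.memLp u).integrable_mul hw.memLp).ofReal
    rw [e1, ← integral_map (μ := volume) (φ := torusLift) (f := fun x : Plane =>
        ((u x * Real.cos (torusPhase n x) : ℝ) : ℂ) - ((u x * Real.sin (torusPhase n x) : ℝ) : ℂ)
          * Complex.I) measurable_torusLift.aemeasurable, hmap, integral_smul_measure,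
      integral_sub (ic (isTest_cos n)) ((ic (isTest_sin n)).mul_const _), integral_mul_const,
      integral_complex_ofReal, integral_complex_ofReal, (hS n hn).1, (hS n hn).2]
    · simp
    · refine Measurable.aestronglyMeasurable ?_
      have hp : Measurable (torusPhase n) := (torusPhase n).continuous.measurable
      fun_prop
  -- All coefficients outside `S` vanish, so the Fourier series is a finite sum.
  have hsum := UnitAddTorus.hasSum_mFourier_series_L2 U
  have hfin : U = ∑ n ∈ S, UnitAddTorus.mFourierCoeff U n • UnitAddTorus.mFourierLp 2 n :=
    hsum.unique (hasSum_sum_of_ne_finset_zero fun n hn => by rw [hcoef n hn, zero_smul])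
  -- As u is real, it equals the real part of its finite Fourier sum, and Re (C e^(iθ)) = Re C cos θ
  -- - Im C sin θ.
  refine ⟨fun n => (UnitAddTorus.mFourierCoeff U n).re,
    fun n => -(UnitAddTorus.mFourierCoeff U n).im, ?_⟩
  set P : Plane → ℝ := fun x => ∑ n ∈ S, ((UnitAddTorus.mFourierCoeff U n).re *
    Real.cos (torusPhase n x)
    + -(UnitAddTorus.mFourierCoeff U n).im * Real.sin (torusPhase n x)) with hP
  have hPm : Measurable P := by
    refine Finset.measurable_sum _ fun n _ => ?_
    have hp : Measurable (torusPhase n) := (torusPhase n).continuous.measurable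
    fun_prop
  have hae : ∀ᵐ t : UnitAddTorus (Fin 2), u (torusLift t) = P (torusLift t) := by
    have h1 : U =ᵐ[volume] fun t => ∑ n ∈ S, UnitAddTorus.mFourierCoeff U n *
      UnitAddTorus.mFourier n t := by
      have h3 : ∀ᵐ t : UnitAddTorus (Fin 2), ∀ n : Fin 2 → ℤ,
          (UnitAddTorus.mFourierCoeff U n • UnitAddTorus.mFourierLp 2 n) t
            = UnitAddTorus.mFourierCoeff U n * UnitAddTorus.mFourier n t := by
        rw [ae_all_iff]
        intro n
        filter_upwards [Lp.coeFn_smul (UnitAddTorus.mFourierCoeff U n)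
          (UnitAddTorus.mFourierLp 2 n),
          UnitAddTorus.coeFn_mFourierLp 2 n] with t h4 h5
        rw [h4, Pi.smul_apply, h5, smul_eq_mul]
      have h6 : U =ᵐ[volume] ∑ n ∈ S,
          ⇑(UnitAddTorus.mFourierCoeff U n • UnitAddTorus.mFourierLp 2 n) := by
        conv_lhs => rw [hfin]
        exact Lp.coeFn_finsetSum _ _
      filter_upwards [h6, h3] with t h7 h8
      rw [h7, Finset.sum_apply]
      exact Finset.sum_congr rfl fun n _ => h8 n
    filter_upwards [h1, hUm.coeFn_toLp] with t h2 h3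
    have h4 : (u (torusLift t) : ℂ)
        = ∑ n ∈ S, UnitAddTorus.mFourierCoeff U n * UnitAddTorus.mFourier n t := by
      rw [← h2, hU, h3]
    have h5 := congrArg Complex.re h4
    rw [Complex.ofReal_re, Complex.re_sum] at h5
    rw [h5, hP]
    refine Finset.sum_congr rfl fun n _ => ?_
    rw [mFourier_eq_exp, Complex.mul_re, Complex.exp_ofReal_mul_I_re, Complex.exp_ofReal_mul_I_im]
    ring
  have h6 : ∀ᵐ x ∂((volume : Measure (UnitAddTorus (Fin 2))).map torusLift), u x = P x :=
    (ae_map_iff measurable_torusLift.aemeasurable (measurableSet_eq_fun hum hPm)).2 hae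
  rw [hmap] at h6
  rw [ae_iff, Measure.smul_apply, smul_eq_mul, mul_eq_zero] at h6
  exact h6.resolve_left hc0

end TorusFourier

end Torus

/-! ### Eigenfunctions of the torus and the spectral gap. -/

section SpectralGap

lemma weak_eigen_laplacian {D : HorizontalDomain} {e : L2 D} {k : ℝ} {g : Fin 2 → L2 D}
    (hg : IsWeakGradient D e g)
    (he : ∀ χ, IsTest D χ →
      ∑ j, ∫ x, g j x * pderiv j χ x ∂D.measure = k * ∫ x, e x * χ x ∂D.measure)
    {χ : Plane → ℝ} (hχ : IsTest D χ) :
    k * ∫ x, e x * χ x ∂D.measure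
      = -∑ j, ∫ x, e x * pderiv j (pderiv j χ) x ∂D.measure := by
  rw [← he χ hχ, ← Finset.sum_neg_distrib]
  exact Finset.sum_congr rfl fun j _ => by rw [hg _ (hχ.pderiv j) j, neg_neg]

/-- The frequencies of the eigenspace of the torus with eigenvalue `k`, without the constants. -/
lemma finite_frequencies (k : ℝ) :
    {n : Fin 2 → ℤ | n ≠ 0 ∧ ((n 0 : ℝ) ^ 2 + (n 1 : ℝ) ^ 2 = k)}.Finite := by
  set N : ℤ := ⌈k⌉ with hN
  refine (Set.finite_Icc (fun _ => -N : Fin 2 → ℤ) fun _ => N).subset ?_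
  rintro n ⟨-, hn⟩
  have hk : k ≤ N := Int.le_ceil k
  have h : ∀ m m' : ℤ, (m : ℝ) ^ 2 + (m' : ℝ) ^ 2 = k → |m| ≤ N := fun m m' h => by
    have h1 : (m : ℝ) ^ 2 ≤ N := by nlinarith [sq_nonneg (m' : ℝ)]
    have h2 : m ^ 2 ≤ N := by exact_mod_cast h1
    have h3 : |m| ≤ m ^ 2 := by
      rw [← sq_abs]
      rcases eq_or_ne m 0 with rfl | h0
      · simp
      · nlinarith [Int.one_le_abs h0]
    exact h3.trans h2
  have h0 := abs_le.1 (h _ _ hn)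
  have h1 := abs_le.1 (h (n 1) (n 0) (by linarith))
  constructor <;> intro i <;> fin_cases i
  · exact h0.1
  · exact h1.1
  · exact h0.2
  · exact h1.2

/-- Testing the equation with cos (n · x) and sin (n · x) gives (k - |n|²) times the Fourier
coefficient equal to 0, so only frequencies with |n|² = k survive. They are finitely many, and n = 0
is excluded by the zero integral. Since e ≠ 0, some frequency is present, so k = |n|² ≥ 1 for a
nonzero integer vector n. -/
lemma torus_eigenfunction {e : L2 .torus} {k : ℝ} {g : Fin 2 → L2 .torus}
    (hl : LateralCondition .torus e) (hg : IsWeakGradient .torus e g)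
    (he : ∀ χ, IsTest .torus χ →
      ∑ j, ∫ x, g j x * pderiv j χ x ∂HorizontalDomain.torus.measure
        = k * ∫ x, e x * χ x ∂HorizontalDomain.torus.measure) (hne : ‖e‖ = 1) :
    1 ≤ k ∧ ∃ P, IsTest .torus P ∧ e =ᵐ[HorizontalDomain.torus.measure] P ∧
      ∀ x, ∑ j, pderiv j (pderiv j P) x = -(k * P x) := by
  have hfin := finite_frequencies k
  set S := hfin.toFinset with hS
  have hS' : ∀ n, n ∈ S ↔ n ≠ 0 ∧ ((n 0 : ℝ) ^ 2 + (n 1 : ℝ) ^ 2 = k) := fun n => by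
    rw [hS, Set.Finite.mem_toFinset]; exact Iff.rfl
  have hcc : ∀ n j, pderiv j (pderiv j fun x => Real.cos (torusPhase n x))
      = fun x => -(n j : ℝ) ^ 2 * Real.cos (torusPhase n x) := fun n j => by
    rw [pderiv_cos, pderiv_const_mul _ (isTest_sin n).1, pderiv_sin]
    funext x; ring
  have hss : ∀ n j, pderiv j (pderiv j fun x => Real.sin (torusPhase n x))
      = fun x => -(n j : ℝ) ^ 2 * Real.sin (torusPhase n x) := fun n j => by
    rw [pderiv_sin, pderiv_const_mul _ (isTest_cos n).1, pderiv_cos]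
    funext x; ring
  have hzero : ∀ (n : Fin 2 → ℤ) (w : Plane → ℝ), IsTest .torus w →
      (∀ j, pderiv j (pderiv j w) = fun x => -(n j : ℝ) ^ 2 * w x) →
      ((n 0 : ℝ) ^ 2 + (n 1 : ℝ) ^ 2 ≠ k) →
      ∫ x, e x * w x ∂HorizontalDomain.torus.measure = 0 := fun n w hw hlap hnk => by
    have h := weak_eigen_laplacian hg he hw
    have e1 : ∀ j, ∫ x, e x * pderiv j (pderiv j w) x ∂HorizontalDomain.torus.measure
        = -(n j : ℝ) ^ 2 * ∫ x, e x * w x ∂HorizontalDomain.torus.measure := fun j => by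
      rw [hlap j, ← integral_const_mul]
      congr 1; ext x; ring
    rw [Fin.sum_univ_two, e1, e1] at h
    have h2 : (k - ((n 0 : ℝ) ^ 2 + (n 1 : ℝ) ^ 2))
        * ∫ x, e x * w x ∂HorizontalDomain.torus.measure = 0 := by linarith
    exact (mul_eq_zero.1 h2).resolve_left fun h3 => hnk (by linarith)
  have hcoef : ∀ n, n ∉ S →
      ∫ x, e x * Real.cos (torusPhase n x) ∂HorizontalDomain.torus.measure = 0 ∧
      ∫ x, e x * Real.sin (torusPhase n x) ∂HorizontalDomain.torus.measure = 0 := fun n hn => by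
    by_cases hn0 : n = 0
    · have hp : ∀ x, torusPhase n x = 0 := fun x => by simp [torusPhase_apply, hn0]
      simp only [hp, Real.cos_zero, Real.sin_zero, mul_one, mul_zero, integral_zero, and_true]
      exact hl
    · have hnk : (n 0 : ℝ) ^ 2 + (n 1 : ℝ) ^ 2 ≠ k := fun h => hn ((hS' n).2 ⟨hn0, h⟩)
      exact ⟨hzero n _ (isTest_cos n) (hcc n) hnk, hzero n _ (isTest_sin n) (hss n) hnk⟩
  obtain ⟨α, β, hP⟩ := torus_eq_trig_polynomial e S hcoef
  constructor
  · have hSne : S.Nonempty := by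
      rw [Finset.nonempty_iff_ne_empty]
      intro h0
      simp only [h0, Finset.sum_empty] at hP
      have : e = 0 := (Lp.eq_zero_iff_ae_eq_zero).2 hP
      rw [this, norm_zero] at hne
      exact zero_ne_one hne
    obtain ⟨n, hn⟩ := hSne
    obtain ⟨hn0, hnk⟩ := (hS' n).1 hn
    have h1 : 1 ≤ n 0 ^ 2 + n 1 ^ 2 := by
      by_contra h
      have h2 : n 0 = 0 := by nlinarith [sq_nonneg (n 0), sq_nonneg (n 1)]
      have h3 : n 1 = 0 := by nlinarith [sq_nonneg (n 0), sq_nonneg (n 1)]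
      exact hn0 (funext fun i => by fin_cases i <;> simp [h2, h3])
    rw [← hnk]
    exact_mod_cast h1
  set Q : (Fin 2 → ℤ) → Plane → ℝ := fun n x =>
    α n * Real.cos (torusPhase n x) + β n * Real.sin (torusPhase n x) with hQ
  have hQs : ∀ n, ContDiff ℝ ∞ (Q n) := fun n =>
    (contDiff_const.mul (isTest_cos n).1).add (contDiff_const.mul (isTest_sin n).1)
  have hadd : ∀ {φ ψ : Plane → ℝ} (j : Fin 2), ContDiff ℝ ∞ φ → ContDiff ℝ ∞ ψ →
      pderiv j (fun x => φ x + ψ x) = fun x => pderiv j φ x + pderiv j ψ x := fun j hφ hψ =>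
    pderiv_add hφ hψ j
  have hQl : ∀ n j, pderiv j (pderiv j (Q n)) = fun x => -(n j : ℝ) ^ 2 * Q n x := fun n j => by
    simp only [hQ]
    have c1 := (isTest_cos n).1
    have s1 := (isTest_sin n).1
    rw [hadd j (contDiff_const.mul c1) (contDiff_const.mul s1), pderiv_const_mul _ c1,
      pderiv_const_mul _ s1, hadd j (contDiff_const.mul (contDiff_pderiv c1 j))
        (contDiff_const.mul (contDiff_pderiv s1 j)), pderiv_const_mul _ (contDiff_pderiv c1 j),
      pderiv_const_mul _ (contDiff_pderiv s1 j), hcc, hss]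
    funext x; ring
  have hsum : ∀ (T : Finset (Fin 2 → ℤ)) (F : (Fin 2 → ℤ) → Plane → ℝ) (j : Fin 2),
      (∀ n, ContDiff ℝ ∞ (F n)) →
      pderiv j (fun x => ∑ n ∈ T, F n x) = fun x => ∑ n ∈ T, pderiv j (F n) x := fun T F j hF => by
    funext x
    simp only [pderiv]
    rw [fderiv_fun_sum fun n _ => (hF n).differentiable (by simp) x]
    simp
  refine ⟨fun x => ∑ n ∈ S, Q n x, ⟨ContDiff.sum fun n _ => hQs n, fun x j => ?_⟩, hP, fun x => ?_⟩
  · refine Finset.sum_congr rfl fun n _ => ?_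
    have h1 := (isTest_cos n).2 x j
    have h2 := (isTest_sin n).2 x j
    simp only at h1 h2
    simp only [hQ, h1, h2]
  · rw [Fin.sum_univ_two]
    have h2 : ∀ j, pderiv j (pderiv j fun x => ∑ n ∈ S, Q n x) x
        = ∑ n ∈ S, -(n j : ℝ) ^ 2 * Q n x := fun j => by
      rw [hsum S Q j hQs, hsum S _ j fun n => contDiff_pderiv (hQs n) j]
      exact Finset.sum_congr rfl fun n _ => by rw [hQl n j]
    rw [h2, h2, ← Finset.sum_add_distrib, Finset.mul_sum, ← Finset.sum_neg_distrib]
    refine Finset.sum_congr rfl fun n hn => ?_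
    rw [← ((hS' n).1 hn).2]
    ring

/-- The eigenfunction has a smooth representative that is itself a test function, so the
approximating sequence can be constant and every identity is a classical integration by parts. -/
lemma torus_eigenData {e : L2 .torus} {k : ℝ} {P : Plane → ℝ} (hP : IsTest .torus P)
    (heP : e =ᵐ[HorizontalDomain.torus.measure] P)
    (hlap : ∀ x, ∑ j, pderiv j (pderiv j P) x = -(k * P x)) :
    EigenData .torus e k (fun j => (hP.pderiv j).memLp.toLp _) (fun _ => P) := by
  have hgP : ∀ j, ((hP.pderiv j).memLp.toLp (pderiv j P) : L2 .torus)
      =ᵐ[HorizontalDomain.torus.measure] pderiv j P := fun j => MemLp.coeFn_toLp _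
  have hec : ∀ w : Plane → ℝ, ∫ x, e x * w x ∂HorizontalDomain.torus.measure
      = ∫ x, P x * w x ∂HorizontalDomain.torus.measure := fun w =>
    integral_congr_ae (heP.mono fun x hx => by simp only [hx])
  have hgc : ∀ j (w : Plane → ℝ), ∫ x, ((hP.pderiv j).memLp.toLp (pderiv j P) : L2 .torus) x * w x
      ∂HorizontalDomain.torus.measure = ∫ x, pderiv j P x * w x ∂HorizontalDomain.torus.measure :=
    fun j w => integral_congr_ae ((hgP j).mono fun x hx => by simp only [hx])
  have hlapw : ∀ w : Plane → ℝ, MemLp w 2 HorizontalDomain.torus.measure →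
      -∑ j, ∫ x, w x * pderiv j (pderiv j P) x ∂HorizontalDomain.torus.measure
        = k * ∫ x, w x * P x ∂HorizontalDomain.torus.measure := fun w hw => by
    have i1 : ∀ j, Integrable (fun x => w x * pderiv j (pderiv j P) x)
        HorizontalDomain.torus.measure := fun j => hw.integrable_mul ((hP.pderiv j).pderiv j).memLp
    rw [← integral_finsetSum _ fun j _ => i1 j, ← integral_const_mul, ← integral_neg]
    congr 1; ext x
    rw [← Finset.mul_sum, hlap x]
    ring
  refine ⟨fun χ hχ j => ?_, fun χ hχ => ?_, fun _ => hP, ?_, fun j => ?_, ?_⟩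
  · rw [hec, hgc, integral_mul_pderiv_torus hP hχ]
  · simp only [hgc, hec]
    rw [Finset.sum_congr rfl fun j _ => integral_mul_pderiv_torus (hP.pderiv j) hχ j,
      Finset.sum_neg_distrib]
    simp only [mul_comm _ (χ _)]
    exact hlapw χ hχ.memLp
  · have : eLpNorm (P - ⇑e) 2 HorizontalDomain.torus.measure = 0 := by
      rw [eLpNorm_eq_zero_iff (hP.memLp.1.sub (Lp.aestronglyMeasurable e)) (by norm_num)]
      exact heP.mono fun x hx => by simp [hx]
    simp only [this]
    exact tendsto_const_nhds
  · have : eLpNorm (pderiv j P - ⇑((hP.pderiv j).memLp.toLp (pderiv j P) : L2 .torus)) 2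
        HorizontalDomain.torus.measure = 0 := by
      rw [eLpNorm_eq_zero_iff ((hP.pderiv j).memLp.1.sub (Lp.aestronglyMeasurable _)) (by norm_num)]
      exact (hgP j).mono fun x hx => by simp [hx]
    simp only [this]
    exact tendsto_const_nhds
  · intro u hu _ γ hγ hγu
    have h1 : ∀ j, ∫ x, γ j x * ((hP.pderiv j).memLp.toLp (pderiv j P) : L2 .torus) x
        ∂HorizontalDomain.torus.measure
        = -∫ x, u x * pderiv j (pderiv j P) x ∂HorizontalDomain.torus.measure := fun j => by
      rw [hγu 0 j, neg_neg]
      exact integral_congr_ae ((hgP j).mono fun x hx => by simp only [hx])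
    rw [Finset.sum_congr rfl fun j _ => h1 j, Finset.sum_neg_distrib, hlapw u hu]
    congr 1
    exact integral_congr_ae (heP.mono fun x hx => by simp only [hx])

/-- Eigenfunctions come with approximating test functions, and the eigenvalues are bounded below by
a positive constant. -/
theorem IsEigenbasis.exists_eigenData {D : HorizontalDomain} {e : ℕ → L2 D} {k : ℕ → ℝ}
    (he : IsEigenbasis D e k) :
    ∃ (g : ℕ → Fin 2 → L2 D) (φ : ℕ → ℕ → Plane → ℝ) (c : ℝ), 0 < c ∧ (∀ i, c ≤ k i) ∧
      ∀ i, EigenData D (e i) (k i) (g i) (φ i) := by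
  have h1 : ∀ i, ‖e i‖ = 1 := he.orthonormal.1
  obtain hD | ⟨Ω, ho, hne, hb, hc, hD⟩ : D = .torus ∨ ∃ Ω ho hne hb hc,
    D = .convex Ω ho hne hb hc := by
    cases D with
    | torus => exact Or.inl rfl
    | convex Ω ho hne hb hc => exact Or.inr ⟨Ω, ho, hne, hb, hc, rfl⟩
  · subst hD
    choose g hg hge using he.eigen
    have h := fun i => torus_eigenfunction (he.lateral i) (hg i) (hge i) (h1 i)
    choose hk P hP heP hlap using h
    exact ⟨_, _, 1, one_pos, hk, fun i => torus_eigenData (hP i) (heP i) (hlap i)⟩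
  · choose g hg hge using he.eigen
    have h := fun i => convex_eigenData hD (he.lateral i) (hg i) (hge i)
    choose φ hφ using h
    obtain ⟨c, hc0, hc⟩ := convex_eigenvalue_lower_bound hD
    exact ⟨g, φ, c, hc0, fun i => hc _ _ _ _ (hφ i) (h1 i), hφ⟩

end SpectralGap

/-! ### Uniqueness of weighted gradients and of extensions. -/

section Uniqueness

variable {D : HorizontalDomain}

lemma tensor_sub_right (f : Lp ℝ 2 heightMeasure) (v w : L2 D) :
    tensor f (v - w) = tensor f v - tensor f w := by
  have h : ∀ᵐ p ∂D.cylMeasure, (v - w) p.2 = v p.2 - w p.2 :=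
    Measure.quasiMeasurePreserving_snd.ae (Lp.coeFn_sub v w)
  refine Lp.ext ?_
  filter_upwards [coeFn_tensor f (v - w), coeFn_tensor f v, coeFn_tensor f w,
    Lp.coeFn_sub (tensor f v) (tensor f w), h] with p h1 h2 h3 h4 h5
  rw [h1, h4, Pi.sub_apply, h2, h3, h5]
  ring

lemma norm_tensor (f : Lp ℝ 2 heightMeasure) (v : L2 D) : ‖tensor f v‖ = ‖f‖ * ‖v‖ := by
  have h := inner_tensor f f v v
  rw [real_inner_self_eq_norm_sq, real_inner_self_eq_norm_sq, real_inner_self_eq_norm_sq,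
    ← mul_pow] at h
  exact (sq_eq_sq₀ (norm_nonneg _) (by positivity)).1 h

lemma integral_mul_sliceCoef_eq_inner (F : L2Cyl D) {f : ℝ → ℝ} {v : Plane → ℝ}
    (hf : MemLp f 2 heightMeasure) (hv : MemLp v 2 D.measure) :
    ∫ z, f z * sliceCoef D v F z ∂heightMeasure
      = inner ℝ (tensor (hf.toLp f) (hv.toLp v)) F := by
  have h1 : ∀ᵐ p ∂D.cylMeasure, (hf.toLp f) p.1 = f p.1 :=
    Measure.quasiMeasurePreserving_fst.ae hf.coeFn_toLp
  have h2 : ∀ᵐ p ∂D.cylMeasure, (hv.toLp v) p.2 = v p.2 :=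
    Measure.quasiMeasurePreserving_snd.ae hv.coeFn_toLp
  rw [integral_mul_sliceCoef F hf hv, real_inner_comm, ← integral_mul_coe]
  refine integral_congr_ae ?_
  filter_upwards [coeFn_tensor (hf.toLp f) (hv.toLp v), h1, h2] with p h3 h4 h5
  rw [h3, h4, h5]

/-- The pairing is an inner product with f ⊗ v, hence continuous in v. Through it, identities known
for test functions pass to eigenfunctions. -/
lemma tendsto_integral_mul_sliceCoef (F : L2Cyl D) {f : ℝ → ℝ} (hf : MemLp f 2 heightMeasure)
    {φ : ℕ → Plane → ℝ} {u : Plane → ℝ} (hφ : ∀ n, MemLp (φ n) 2 D.measure)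
    (hu : MemLp u 2 D.measure)
    (h : Tendsto (fun n => eLpNorm (φ n - u) 2 D.measure) atTop (𝓝 0)) :
    Tendsto (fun n => ∫ z, f z * sliceCoef D (φ n) F z ∂heightMeasure) atTop
      (𝓝 (∫ z, f z * sliceCoef D u F z ∂heightMeasure)) := by
  simp only [integral_mul_sliceCoef_eq_inner F hf hu,
    fun n => integral_mul_sliceCoef_eq_inner F hf (hφ n)]
  refine Tendsto.inner ?_ tendsto_const_nhds
  have h1 := tendsto_toLp hφ hu h
  rw [tendsto_iff_norm_sub_tendsto_zero] at h1 ⊢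
  simp only [← tensor_sub_right, norm_tensor]
  simpa using h1.const_mul ‖hf.toLp f‖

lemma memLp_height_of_slab {f : ℝ → ℝ} (hf : ContinuousOn f (Ioi 0)) {ε R : ℝ} (hε : 0 < ε)
    (h0 : ∀ z, z ∉ Icc ε R → f z = 0) : MemLp f 2 heightMeasure := by
  have hsub : Icc ε R ⊆ Ioi (0 : ℝ) := fun z hz => hε.trans_le hz.1
  obtain ⟨C, hC⟩ := (isCompact_Icc (a := ε) (b := R)).exists_bound_of_continuousOn (hf.mono hsub)
  have hfin : heightMeasure (Icc ε R) ≠ ⊤ :=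
    ne_top_of_le_ne_top measure_Icc_lt_top.ne (Measure.restrict_apply_le _ _)
  refine MemLp.mono (memLp_indicator_const 2 measurableSet_Icc |C| (Or.inr hfin))
    (hf.aestronglyMeasurable measurableSet_Ioi) (Eventually.of_forall fun z => ?_)
  by_cases hz : z ∈ Icc ε R
  · rw [indicator_of_mem hz]
    simpa using (hC z hz).trans (le_abs_self C)
  · simp [h0 z hz]

lemma IsHeightTest.weight_mul {η : ℝ → ℝ} (hη : IsHeightTest η) {w : ℝ → ℝ}
    (hw : ContinuousOn w (Ioi 0)) : MemLp (fun z => w z * η z) 2 heightMeasure := by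
  obtain ⟨ε, R, hε, hεR, h0⟩ := hη.exists_Ioo
  refine memLp_height_of_slab (hw.mul hη.1.continuous.continuousOn) hε (R := R) fun z hz => ?_
  rw [h0 z fun h => hz (Ioo_subset_Icc_self h), mul_zero]

lemma IsHeightTest.weight_mul_deriv {η : ℝ → ℝ} (hη : IsHeightTest η) {w : ℝ → ℝ}
    (hw : ContinuousOn w (Ioi 0)) : MemLp (fun z => w z * deriv η z) 2 heightMeasure := by
  obtain ⟨ε, R, hε, hεR, h0⟩ := hη.exists_Ioo
  refine memLp_height_of_slab (hw.mul (hη.1.continuous_deriv (by simp)).continuousOn) hε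
    (R := R) fun z hz => ?_
  rw [deriv_eq_zero_of_notMem_Ioo h0 hz, mul_zero]

lemma IsHeightTest.memLp {η : ℝ → ℝ} (hη : IsHeightTest η) : MemLp η 2 heightMeasure := by
  simpa using hη.weight_mul (w := fun _ => 1) continuousOn_const

lemma IsHeightTest.memLp_deriv {η : ℝ → ℝ} (hη : IsHeightTest η) :
    MemLp (deriv η) 2 heightMeasure := by
  simpa using hη.weight_mul_deriv (w := fun _ => 1) continuousOn_const

lemma continuousOn_height_rpow (b : ℝ) : ContinuousOn (fun z : ℝ => z ^ b) (Ioi 0) := fun _ hz =>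
  (Real.continuousAt_rpow_const _ _ (Or.inl (ne_of_gt hz))).continuousWithinAt

lemma continuousOn_height_rpow_inv (b : ℝ) : ContinuousOn (fun z : ℝ => (z ^ b)⁻¹) (Ioi 0) :=
  (continuousOn_height_rpow b).inv₀ fun _ hz => (Real.rpow_pos_of_pos hz b).ne'

lemma ae_eq_zero_of_heightTest {f : ℝ → ℝ} (hf : MemLp f 2 heightMeasure)
    (h : ∀ η, IsHeightTest η → ∫ z in Ioi 0, f z * η z = 0) : f =ᵐ[heightMeasure] 0 := by
  have hloc : LocallyIntegrableOn f (Ioi 0) := locallyIntegrableOn_Ioi fun R =>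
    (hf.mono_measure (Measure.restrict_mono Ioc_subset_Ioi_self le_rfl)).integrable (by norm_num)
  have := isOpen_Ioi.ae_eq_zero_of_integral_contDiff_smul_eq_zero hloc fun η h1 h2 h3 => ?_
  · exact (ae_restrict_iff' measurableSet_Ioi).2 this
  · rw [← setIntegral_eq_integral_of_forall_compl_eq_zero (s := Ioi 0) fun z hz => ?_]
    · refine Eq.trans ?_ (h η ⟨h1, h2, h3⟩)
      simp only [smul_eq_mul, mul_comm]
    · have : η z = 0 := by
        by_contra hn
        exact hz (h3 (subset_tsupport _ hn))
      simp [this]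

/-- Products of test functions are test functions on the cylinder. -/
lemma IsHeightTest.isCylTest {η : ℝ → ℝ} {χ : Plane → ℝ} (hη : IsHeightTest η) (hχ : IsTest D χ) :
    IsCylTest D fun p => η p.1 * χ p.2 := by
  have hs : ContDiff ℝ ∞ fun p : ℝ × Plane => η p.1 * χ p.2 :=
    (hη.1.comp contDiff_fst).mul (hχ.contDiff.comp contDiff_snd)
  obtain ⟨ε, R, hε, hεR, h0⟩ := hη.exists_Ioo
  cases D with
  | torus =>
    refine ⟨hs, fun z x j => by simp only [hχ.2], ε, R, hε, fun z x hz => ?_⟩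
    simp only
    rw [h0 z fun h => hz (Ioo_subset_Icc_self h), zero_mul]
  | convex Ω ho hne hb hc =>
    have hsub : tsupport (fun p : ℝ × Plane => η p.1 * χ p.2) ⊆ tsupport η ×ˢ tsupport χ := by
      refine closure_minimal (fun p hp => ?_) ((isClosed_tsupport η).prod (isClosed_tsupport χ))
      exact ⟨subset_tsupport _ (left_ne_zero_of_mul hp),
        subset_tsupport _ (right_ne_zero_of_mul hp)⟩
    exact ⟨hs, (hη.2.1.prod hχ.2.1).of_isClosed_subset (isClosed_tsupport _) hsub,
      hsub.trans (prod_mono hη.2.2 hχ.2.2)⟩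

lemma cylVec_succ (j : Fin 2) : cylVec j.succ = (0, unitVec j) := by
  fin_cases j <;> rfl

lemma cylDeriv_zero_mul {η : ℝ → ℝ} {χ : Plane → ℝ} (hη : ContDiff ℝ ∞ η) (hχ : ContDiff ℝ ∞ χ) :
    cylDeriv 0 (fun p => η p.1 * χ p.2) = fun p => deriv η p.1 * χ p.2 := by
  funext p
  have h1 : HasFDerivAt (fun p : ℝ × Plane => η p.1) _ p :=
    ((hη.differentiable (by simp) p.1).hasFDerivAt).comp p hasFDerivAt_fst
  have h2 : HasFDerivAt (fun p : ℝ × Plane => χ p.2) _ p :=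
    ((hχ.differentiable (by simp) p.2).hasFDerivAt).comp p hasFDerivAt_snd
  rw [cylDeriv, (h1.fun_mul h2).fderiv]
  simp [cylVec, mul_comm]

lemma cylDeriv_succ_mul {η : ℝ → ℝ} {χ : Plane → ℝ} (hη : ContDiff ℝ ∞ η) (hχ : ContDiff ℝ ∞ χ)
    (j : Fin 2) : cylDeriv j.succ (fun p => η p.1 * χ p.2) = fun p => η p.1 * pderiv j χ p.2 := by
  funext p
  have h1 : HasFDerivAt (fun p : ℝ × Plane => η p.1) _ p :=
    ((hη.differentiable (by simp) p.1).hasFDerivAt).comp p hasFDerivAt_fst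
  have h2 : HasFDerivAt (fun p : ℝ × Plane => χ p.2) _ p :=
    ((hχ.differentiable (by simp) p.2).hasFDerivAt).comp p hasFDerivAt_snd
  rw [cylDeriv, cylVec_succ, (h1.fun_mul h2).fderiv]
  simp [pderiv]

lemma sqrtWeight_zero (a z : ℝ) : sqrtWeight a 0 z = z ^ (a / 2) := by simp [sqrtWeight]

lemma sqrtWeight_succ (a z : ℝ) (j : Fin 2) : sqrtWeight a j.succ z = 1 := by simp [sqrtWeight]

/-- The definition tested with the product η(z) χ(x), read as an equation for slice coefficients. -/
lemma IsWeightedGradient.vertical {a : ℝ} {Ψ : L2Cyl D} {G : Fin 3 → L2Cyl D}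
    (h : IsWeightedGradient D a Ψ G) {η : ℝ → ℝ} {χ : Plane → ℝ} (hη : IsHeightTest η)
    (hχ : IsTest D χ) :
    ∫ z, deriv η z * sliceCoef D χ Ψ z ∂heightMeasure
      = -∫ z, ((z ^ (a / 2))⁻¹ * η z) * sliceCoef D χ (G 0) z ∂heightMeasure := by
  have h1 := h _ (hη.isCylTest hχ) 0
  rw [integral_mul_sliceCoef Ψ hη.memLp_deriv hχ.memLp, integral_mul_sliceCoef (G 0)
    (hη.weight_mul (continuousOn_height_rpow_inv (a / 2))) hχ.memLp]
  rw [cylDeriv_zero_mul hη.1 hχ.contDiff] at h1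
  simpa only [sqrtWeight_zero, mul_assoc] using h1

lemma IsWeightedGradient.horizontal {a : ℝ} {Ψ : L2Cyl D} {G : Fin 3 → L2Cyl D}
    (h : IsWeightedGradient D a Ψ G) {η : ℝ → ℝ} {χ : Plane → ℝ} (hη : IsHeightTest η)
    (hχ : IsTest D χ) (j : Fin 2) :
    ∫ z, η z * sliceCoef D (pderiv j χ) Ψ z ∂heightMeasure
      = -∫ z, η z * sliceCoef D χ (G j.succ) z ∂heightMeasure := by
  have h1 := h _ (hη.isCylTest hχ) j.succ
  rw [integral_mul_sliceCoef Ψ hη.memLp (hχ.pderiv j).memLp, integral_mul_sliceCoef _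
    hη.memLp hχ.memLp]
  rw [cylDeriv_succ_mul hη.1 hχ.contDiff] at h1
  simpa only [sqrtWeight_succ, inv_one, one_mul] using h1

lemma sliceCoef_sub (F G : L2Cyl D) {v : Plane → ℝ} (hv : MemLp v 2 D.measure) :
    sliceCoef D v (F - G : L2Cyl D) =ᵐ[heightMeasure] sliceCoef D v F - sliceCoef D v G := by
  filter_upwards [sliceCoef_congr (Lp.coeFn_sub F G) v, memLp_slice F,
    memLp_slice G] with z h1 h2 h3
  rw [h1, Pi.sub_apply]
  have i1 : Integrable (fun x => F (z, x) * v x) D.measure := h2.integrable_mul hv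
  have i2 : Integrable (fun x => G (z, x) * v x) D.measure := h3.integrable_mul hv
  simp only [sliceCoef, Pi.sub_apply, sub_mul]
  exact integral_sub i1 i2

lemma isTest_one_torus : IsTest .torus fun _ => (1 : ℝ) := ⟨contDiff_const, fun _ _ => rfl⟩

section Basis

variable {e : ℕ → L2 D} {k : ℕ → ℝ} {g : ℕ → Fin 2 → L2 D} {φ : ℕ → ℕ → Plane → ℝ} {a : ℝ}

/-- Functions in `L²(ℝ₊ × Ω)` are determined by their pairings with test functions. -/
lemma eq_zero_of_sliceCoef_test (he : IsEigenbasis D e k)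
    (hE : ∀ i, EigenData D (e i) (k i) (g i) (φ i)) (F : L2Cyl D)
    (h : ∀ χ, IsTest D χ → sliceCoef D χ F =ᵐ[heightMeasure] 0) : F = 0 := by
  refine eq_zero_of_sliceCoef he F (fun i => ?_) fun hD => ?_
  · refine ae_eq_of_forall_integral_mul (memLp_sliceCoef F (Lp.memLp _)) MemLp.zero fun f hf => ?_
    have h1 := tendsto_integral_mul_sliceCoef F hf (fun n => ((hE i).test n).memLp) (Lp.memLp _)
      (hE i).tendsto
    have h2 : ∀ n, ∫ z, f z * sliceCoef D (φ i n) F z ∂heightMeasure = 0 := fun n => by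
      refine integral_eq_zero_of_ae ?_
      filter_upwards [h _ ((hE i).test n)] with z hz
      simp [hz]
    simp only [h2] at h1
    rw [tendsto_nhds_unique h1 tendsto_const_nhds]
    simp
  · subst hD
    exact h _ isTest_one_torus

/-- `weightedGradient` is obtained by choice; uniqueness is what identifies it with a gradient
computed explicitly. Product test functions suffice because their slice pairings determine the
function. The density behind this comes from completeness of the eigenbasis together with its
approximants, and from the constant function on the torus. The vertical weight never vanishes on (0,
∞), so it can be divided out. -/
lemma IsWeightedGradient.unique (he : IsEigenbasis D e k)
    (hE : ∀ i, EigenData D (e i) (k i) (g i) (φ i)) {Ψ : L2Cyl D} {G H : Fin 3 → L2Cyl D}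
    (hG : IsWeightedGradient D a Ψ G) (hH : IsWeightedGradient D a Ψ H) : G = H := by
  have key : ∀ (i : Fin 3) (w : ℝ → ℝ), ContinuousOn w (Ioi 0) → (∀ z, 0 < z → w z ≠ 0) →
      (∀ η χ, IsHeightTest η → IsTest D χ → ∫ z, (w z * η z) * sliceCoef D χ (G i) z ∂heightMeasure
        = ∫ z, (w z * η z) * sliceCoef D χ (H i) z ∂heightMeasure) → G i = H i := by
    intro i w hw hw0 h
    rw [← sub_eq_zero]
    refine eq_zero_of_sliceCoef_test he hE _ fun χ hχ => ?_
    set f := sliceCoef D χ (G i - H i : L2Cyl D) with hf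
    have hfm : MemLp f 2 heightMeasure := memLp_sliceCoef _ hχ.memLp
    have hloc : LocallyIntegrableOn (fun z => w z * f z) (Ioi 0) := by
      refine (locallyIntegrableOn_Ioi fun R => ?_).continuousOn_mul hw isOpen_Ioi.isLocallyClosed
      exact (hfm.mono_measure (Measure.restrict_mono Ioc_subset_Ioi_self le_rfl)).integrable
        (by norm_num)
    have := isOpen_Ioi.ae_eq_zero_of_integral_contDiff_smul_eq_zero hloc fun η h1 h2 h3 => ?_
    · have h4 : ∀ᵐ z ∂heightMeasure, w z * f z = 0 := (ae_restrict_iff' measurableSet_Ioi).2 this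
      filter_upwards [h4, ae_restrict_mem measurableSet_Ioi] with z hz hz0
      exact (mul_eq_zero.1 hz).resolve_left (hw0 z hz0)
    · have hη : IsHeightTest η := ⟨h1, h2, h3⟩
      rw [← setIntegral_eq_integral_of_forall_compl_eq_zero (s := Ioi 0) fun z hz => ?_]
      · have i1 : Integrable (fun z => (w z * η z) * sliceCoef D χ (G i) z) heightMeasure :=
          (hη.weight_mul hw).integrable_mul (memLp_sliceCoef _ hχ.memLp)
        have i2 : Integrable (fun z => (w z * η z) * sliceCoef D χ (H i) z) heightMeasure :=
          (hη.weight_mul hw).integrable_mul (memLp_sliceCoef _ hχ.memLp)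
        refine Eq.trans (integral_congr_ae ?_)
          ((integral_sub i1 i2).trans (sub_eq_zero.2 (h η χ hη hχ)))
        filter_upwards [sliceCoef_sub (G i) (H i) hχ.memLp] with z hz
        rw [hf, hz, smul_eq_mul, Pi.sub_apply]
        ring
      · have : η z = 0 := by
          by_contra hn
          exact hz (h3 (subset_tsupport _ hn))
        simp [this]
  funext i
  refine Fin.cases ?_ (fun j => ?_) i
  · refine key 0 (fun z => (z ^ (a / 2))⁻¹) (continuousOn_height_rpow_inv _)
      (fun z hz => inv_ne_zero (Real.rpow_pos_of_pos hz _).ne') fun η χ hη hχ => ?_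
    have h1 := hG.vertical hη hχ
    have h2 := hH.vertical hη hχ
    linarith
  · refine key _ (fun _ => 1) continuousOn_const (fun _ _ => one_ne_zero) fun η χ hη hχ => ?_
    have h1 := hG.horizontal hη hχ j
    have h2 := hH.horizontal hη hχ j
    simp only [one_mul]
    linarith

/-- Weak formulation of the eigenvalue problem, tested with almost every slice of `Ψ`. -/
lemma EigenData.slice_identity {e : L2 D} {k : ℝ} {g : Fin 2 → L2 D} {φ : ℕ → Plane → ℝ}
    (hE : EigenData D e k g φ) {Ψ : L2Cyl D} {G : Fin 3 → L2Cyl D}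
    (hG : IsWeightedGradient D a Ψ G) (hl : CylLateralCondition D Ψ) :
    ∀ᵐ z ∂heightMeasure, ∑ j, sliceCoef D (g j) (G j.succ) z = k * sliceCoef D e Ψ z := by
  have h1 : ∀ n j, ∀ᵐ z ∂heightMeasure,
      sliceCoef D (pderiv j (pderiv j (φ n))) Ψ z = -sliceCoef D (pderiv j (φ n)) (G j.succ) z := by
    intro n j
    have hχ := (hE.test n).pderiv j
    have m1 := memLp_sliceCoef Ψ (hχ.pderiv j).memLp
    have m2 := memLp_sliceCoef (G j.succ) hχ.memLp
    have := ae_eq_zero_of_heightTest (m1.add m2) fun η hη => ?_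
    · filter_upwards [this] with z hz
      exact eq_neg_of_add_eq_zero_left hz
    · have h2 := hG.horizontal hη hχ j
      have i1 : Integrable (fun z => η z * sliceCoef D (pderiv j (pderiv j (φ n))) Ψ z)
        heightMeasure :=
        hη.memLp.integrable_mul m1
      have i2 : Integrable (fun z => η z * sliceCoef D (pderiv j (φ n)) (G j.succ) z)
        heightMeasure :=
        hη.memLp.integrable_mul m2
      refine Eq.trans (integral_congr_ae (Eventually.of_forall fun z => ?_))
        ((integral_add i1 i2).trans (by rw [h2, neg_add_cancel]))
      simp only [Pi.add_apply]
      ring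
  -- Only the countably many test functions attached to the approximants of `e` occur, so one null
  -- set of heights serves them all.
  have h1' : ∀ᵐ z ∂heightMeasure, ∀ n j,
      sliceCoef D (pderiv j (pderiv j (φ n))) Ψ z = -sliceCoef D (pderiv j (φ n)) (G j.succ) z :=
    ae_all_iff.2 fun n => ae_all_iff.2 fun j => h1 n j
  have hGs : ∀ᵐ z ∂heightMeasure, ∀ j : Fin 2, MemLp (fun x => G j.succ (z, x)) 2 D.measure :=
    ae_all_iff.2 fun j => memLp_slice _
  filter_upwards [h1', hGs, memLp_slice Ψ, hl] with z z1 z2 z3 z4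
  exact hE.slice _ z3 z4 (fun j x => G j.succ (z, x)) z2 z1

lemma weightedGradient_spec (Ψ : SobolevH D a) :
    IsWeightedGradient D a (Ψ : L2Cyl D) (weightedGradient Ψ) := Ψ.2.1.choose_spec

lemma IsHarmonic.separated {Ψ : SobolevH D a} (hh : IsHarmonic Ψ) {η : ℝ → ℝ} {χ : Plane → ℝ}
    (hη : IsHeightTest η) (hχ : IsTest D χ) :
    ∫ z, (z ^ (a / 2) * deriv η z) * sliceCoef D χ (weightedGradient Ψ 0) z ∂heightMeasure
      + ∑ j, ∫ z, η z * sliceCoef D (pderiv j χ) (weightedGradient Ψ j.succ) z ∂heightMeasure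
        = 0 := by
  have h := hh _ (hη.isCylTest hχ)
  have m0 := memLp_tensor (hη.weight_mul_deriv (continuousOn_height_rpow (a / 2))) hχ.memLp
  have mj := fun j => memLp_tensor hη.memLp (hχ.pderiv j).memLp
  rw [integral_mul_sliceCoef _ (hη.weight_mul_deriv (continuousOn_height_rpow (a / 2))) hχ.memLp]
  simp only [fun j => integral_mul_sliceCoef (weightedGradient Ψ (Fin.succ j)) hη.memLp
    (hχ.pderiv j).memLp]
  have ij : ∀ j : Fin 2, Integrable (fun p => weightedGradient Ψ j.succ p *
    (η p.1 * pderiv j χ p.2))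
      D.cylMeasure := fun j => (Lp.memLp _).integrable_mul (mj j)
  have i0 : Integrable (fun p => weightedGradient Ψ 0 p * (p.1 ^ (a / 2) * deriv η p.1 * χ p.2))
      D.cylMeasure := (Lp.memLp _).integrable_mul m0
  rw [← integral_finsetSum _ fun j _ => ij j, ← integral_add i0
    (integrable_finsetSum _ fun j _ => ij j),
    ← h]
  congr 1; ext p
  rw [Fin.sum_univ_succ (n := 2), cylDeriv_zero_mul hη.1 hχ.contDiff]
  congr 1
  · rw [sqrtWeight_zero]; ring
  · refine Finset.sum_congr rfl fun j _ => ?_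
    rw [cylDeriv_succ_mul hη.1 hχ.contDiff, sqrtWeight_succ]; ring

/-- The coefficients of a weighted-harmonic function solve the vertical equation. -/
lemma EigenData.weak_ode {e : L2 D} {k : ℝ} {g : Fin 2 → L2 D} {φ : ℕ → Plane → ℝ}
    (hE : EigenData D e k g φ) {Ψ : SobolevH D a} (hh : IsHarmonic Ψ) {η : ℝ → ℝ}
    (hη : IsHeightTest η) :
    ∫ z, sliceCoef D e Ψ.1 z * deriv η z ∂heightMeasure
      = -∫ z, sliceCoef D e (weightedGradient Ψ 0) z * ((z ^ (a / 2))⁻¹ * η z) ∂heightMeasure ∧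
    ∫ z, z ^ (a / 2) * sliceCoef D e (weightedGradient Ψ 0) z * deriv η z ∂heightMeasure
      = -∫ z, k * sliceCoef D e Ψ.1 z * η z ∂heightMeasure := by
  have hG := weightedGradient_spec Ψ
  have hm := fun n => (hE.test n).memLp
  constructor
  · have l1 := tendsto_integral_mul_sliceCoef Ψ.1 hη.memLp_deriv hm (Lp.memLp _) hE.tendsto
    have l2 := (tendsto_integral_mul_sliceCoef (weightedGradient Ψ 0)
      (hη.weight_mul (continuousOn_height_rpow_inv (a / 2))) hm (Lp.memLp _) hE.tendsto).neg
    have := tendsto_nhds_unique l1 (l2.congr fun n => (hG.vertical hη (hE.test n)).symm)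
    simpa only [mul_comm] using this
  · have l1 := tendsto_integral_mul_sliceCoef (weightedGradient Ψ 0)
      (hη.weight_mul_deriv (continuousOn_height_rpow (a / 2))) hm (Lp.memLp _) hE.tendsto
    have l2 := tendsto_finsetSum (Finset.univ : Finset (Fin 2)) fun j _ =>
      tendsto_integral_mul_sliceCoef (weightedGradient Ψ j.succ) hη.memLp
      (fun n => ((hE.test n).pderiv j).memLp) (Lp.memLp _) (hE.tendsto_grad j)
    have h0 := tendsto_nhds_unique ((l1.add l2).congr fun n => hh.separated hη (hE.test n))
      tendsto_const_nhds
    -- The horizontal part of the equation is the eigenvalue identity on almost every slice, which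
    -- turns it into k times the coefficient of Ψ.
    have h1 : ∑ j, ∫ z, η z * sliceCoef D (g j) (weightedGradient Ψ j.succ) z ∂heightMeasure
        = ∫ z, k * sliceCoef D e Ψ.1 z * η z ∂heightMeasure := by
      have ij : ∀ j : Fin 2, Integrable (fun z => η z * sliceCoef D (g j)
        (weightedGradient Ψ j.succ) z)
          heightMeasure := fun j => hη.memLp.integrable_mul (memLp_sliceCoef _ (Lp.memLp _))
      rw [← integral_finsetSum _ fun j _ => ij j]
      refine integral_congr_ae ?_
      filter_upwards [hE.slice_identity hG Ψ.2.2] with z hz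
      rw [← Finset.mul_sum, hz]; ring
    rw [h1] at h0
    rw [← eq_neg_of_add_eq_zero_left h0]
    congr 1; ext z; ring

lemma HasDirichletTrace.tendsto_sliceCoef {Ψ : SobolevH D a} {h : ℕ → ℝ}
    (ht : HasDirichletTrace e Ψ h) (v : L2 D) :
    Tendsto (sliceCoef D v Ψ.1) heightToZero (𝓝 (inner ℝ v (∑' i, h i • e i : L2 D))) := by
  set H : L2 D := ∑' i, h i • e i with hH
  have h1 : Tendsto (fun z => (eLpNorm (fun x => Ψ.1 (z, x) - H x) 2 D.measure).toReal * ‖v‖)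
      heightToZero (𝓝 0) := by
    have := ((ENNReal.tendsto_toReal ENNReal.zero_ne_top).comp ht).mul_const ‖v‖
    simpa using this
  rw [tendsto_iff_norm_sub_tendsto_zero]
  refine tendsto_of_tendsto_of_tendsto_of_le_of_le' tendsto_const_nhds h1
    (Eventually.of_forall fun z => norm_nonneg _) ?_
  filter_upwards [eventually_heightToZero (memLp_slice Ψ.1)] with z hz
  have hd : MemLp (fun x => Ψ.1 (z, x) - H x) 2 D.measure := hz.sub (Lp.memLp H)
  have e1 : sliceCoef D v Ψ.1 z - inner ℝ v H = inner ℝ v (hd.toLp _) := by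
    have i1 : Integrable (fun x => Ψ.1 (z, x) * v x) D.measure := hz.integrable_mul (Lp.memLp v)
    have i2 : Integrable (fun x => H x * v x) D.measure := (Lp.memLp H).integrable_mul (Lp.memLp v)
    rw [sliceCoef, real_inner_comm, ← integral_mul_coe, ← integral_sub i1 i2, real_inner_comm,
      ← integral_mul_coe]
    refine integral_congr_ae ?_
    filter_upwards [hd.coeFn_toLp] with x hx
    rw [hx]; ring
  rw [e1, ← Lp.norm_toLp _ hd, mul_comm]
  exact norm_inner_le_norm _ _

lemma integral_conormal (Ψ : SobolevH D a) (v : Plane → ℝ) (z : ℝ) :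
    ∫ x, conormal Ψ z x * v x ∂D.measure
      = -(z ^ (a / 2) * sliceCoef D v (weightedGradient Ψ 0) z) := by
  rw [sliceCoef, ← integral_const_mul, ← integral_neg]
  congr 1; ext x
  simp only [conormal]; ring

/-- A single term is bounded by the whole series, and its weight k_i^s is positive; hence
convergence in Ḣ^s implies convergence of each coefficient. -/
lemma HasNeumannTrace.tendsto_sliceCoef {s : ℝ} {Ψ : SobolevH D a} {θ : ℕ → ℝ}
    (hk : ∀ i, 0 < k i) (ht : HasNeumannTrace e k s Ψ θ) (i : ℕ) :
    Tendsto (fun z => z ^ (a / 2) * sliceCoef D (e i) (weightedGradient Ψ 0) z) heightToZero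
      (𝓝 (-θ i)) := by
  set c : ℝ → ℝ := fun z => ∫ x, conormal Ψ z x * e i x ∂D.measure with hc
  have hks : 0 < k i ^ s := Real.rpow_pos_of_pos (hk i) s
  have h1 : Tendsto (fun z => ENNReal.ofReal (k i ^ s * (c z - θ i) ^ 2)) heightToZero (𝓝 0) :=
    tendsto_of_tendsto_of_tendsto_of_le_of_le tendsto_const_nhds ht (fun z => bot_le)
      fun z => ENNReal.le_tsum i
  have h2 := (ENNReal.tendsto_toReal ENNReal.zero_ne_top).comp h1
  have h3 : Tendsto (fun z => k i ^ s * (c z - θ i) ^ 2) heightToZero (𝓝 0) := by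
    refine h2.congr fun z => ?_
    rw [Function.comp_apply, ENNReal.toReal_ofReal (by positivity)]
  have h4 : Tendsto (fun z => |c z - θ i|) heightToZero (𝓝 0) := by
    have := ((h3.const_mul (k i ^ s)⁻¹).sqrt)
    rw [mul_zero, Real.sqrt_zero] at this
    refine this.congr fun z => ?_
    rw [← mul_assoc, inv_mul_cancel₀ hks.ne', one_mul, Real.sqrt_sq_eq_abs]
  have h5 : Tendsto c heightToZero (𝓝 (θ i)) := by
    rw [tendsto_iff_norm_sub_tendsto_zero]
    exact h4
  refine h5.neg.congr fun z => ?_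
  simp only [hc]
  rw [integral_conormal, neg_neg]

/-- Weighted-harmonic functions in the energy class with the same Dirichlet or Neumann datum
coincide. -/
lemma eq_of_trace_eq (ha : a < 1) (he : IsEigenbasis D e k)
    (hE : ∀ i, EigenData D (e i) (k i) (g i) (φ i)) (hk : ∀ i, 0 < k i) {Ψ Φ : SobolevH D a}
    (hΨ : IsHarmonic Ψ) (hΦ : IsHarmonic Φ)
    (h : ∀ i, Tendsto (fun z => sliceCoef D (e i) Ψ.1 z - sliceCoef D (e i) Φ.1 z) heightToZero
      (𝓝 0) ∨
      Tendsto (fun z => z ^ (a / 2) * (sliceCoef D (e i) (weightedGradient Ψ 0) z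
        - sliceCoef D (e i) (weightedGradient Φ 0) z)) heightToZero (𝓝 0)) : Ψ = Φ := by
  refine Subtype.ext (sub_eq_zero.1 (eq_zero_of_sliceCoef he _ (fun i => ?_) fun hD => ?_))
  · have mv := Lp.memLp (e i)
    have m1 := memLp_sliceCoef Ψ.1 mv
    have m2 := memLp_sliceCoef Φ.1 mv
    have m3 := memLp_sliceCoef (weightedGradient Ψ 0) mv
    have m4 := memLp_sliceCoef (weightedGradient Φ 0) mv
    refine (sliceCoef_sub Ψ.1 Φ.1 mv).trans
      (ae_eq_zero_of_weak_ode ha (hk i) (m1.sub m2) (m3.sub m4) (fun η hη => ?_) (fun η hη => ?_)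
        (h i))
    · have i1 : Integrable (fun z => sliceCoef D (e i) Ψ.1 z * deriv η z) heightMeasure :=
        m1.integrable_mul hη.memLp_deriv
      have i2 : Integrable (fun z => sliceCoef D (e i) Φ.1 z * deriv η z) heightMeasure :=
        m2.integrable_mul hη.memLp_deriv
      have hw := hη.weight_mul (continuousOn_height_rpow_inv (a / 2))
      have i3 : Integrable (fun z => sliceCoef D (e i) (weightedGradient Ψ 0) z
        * ((z ^ (a / 2))⁻¹ * η z)) heightMeasure := m3.integrable_mul hw
      have i4 : Integrable (fun z => sliceCoef D (e i) (weightedGradient Φ 0) z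
        * ((z ^ (a / 2))⁻¹ * η z)) heightMeasure := m4.integrable_mul hw
      simp only [Pi.sub_apply, sub_mul]
      rw [integral_sub i1 i2, integral_sub i3 i4, ((hE i).weak_ode hΨ hη).1,
        ((hE i).weak_ode hΦ hη).1]
      ring
    · have hw := hη.weight_mul_deriv (continuousOn_height_rpow (a / 2))
      have e1 : ∀ q : ℝ → ℝ, (fun z => z ^ (a / 2) * q z * deriv η z)
          = fun z => q z * (z ^ (a / 2) * deriv η z) := fun q => by ext z; ring
      have i1 : Integrable (fun z => z ^ (a / 2) * sliceCoef D (e i) (weightedGradient Ψ 0) z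
          * deriv η z) heightMeasure := by rw [e1]; exact m3.integrable_mul hw
      have i2 : Integrable (fun z => z ^ (a / 2) * sliceCoef D (e i) (weightedGradient Φ 0) z
          * deriv η z) heightMeasure := by rw [e1]; exact m4.integrable_mul hw
      have i3 : Integrable (fun z => k i * sliceCoef D (e i) Ψ.1 z * η z) heightMeasure :=
        (m1.const_mul (k i)).integrable_mul hη.memLp
      have i4 : Integrable (fun z => k i * sliceCoef D (e i) Φ.1 z * η z) heightMeasure :=
        (m2.const_mul (k i)).integrable_mul hη.memLp
      simp only [Pi.sub_apply, mul_sub, sub_mul]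
      rw [integral_sub i1 i2, integral_sub i3 i4, ((hE i).weak_ode hΨ hη).2,
        ((hE i).weak_ode hΦ hη).2]
      ring
  -- The constant mode of the torus is not seen by the eigenbasis; it vanishes by the lateral
  -- condition.
  · subst hD
    have m1 : MemLp (fun _ : Plane => (1 : ℝ)) 2 HorizontalDomain.torus.measure := memLp_const 1
    filter_upwards [sliceCoef_sub Ψ.1 Φ.1 m1, Ψ.2.2, Φ.2.2] with z h1 h2 h3
    have h2' : ∫ x, Ψ.1 (z, x) ∂HorizontalDomain.torus.measure = 0 := h2
    have h3' : ∫ x, Φ.1 (z, x) ∂HorizontalDomain.torus.measure = 0 := h3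
    rw [h1]
    simp [sliceCoef, h2', h3']

end Basis

end Uniqueness

/-! ### Separated solutions f(z) e(x): gradient, equation and orthogonality. -/

section SeparatedModes

variable {D : HorizontalDomain}

section CylTest

variable {φ : ℝ × Plane → ℝ}

lemma IsCylTest.contDiff (h : IsCylTest D φ) : ContDiff ℝ ∞ φ := by
  cases D <;> exact h.1

lemma IsCylTest.isHeightTest (h : IsCylTest D φ) (x : Plane) : IsHeightTest fun z => φ (z, x) := by
  obtain ⟨ε, R, hε, h0⟩ := slab_of_isCylTest h
  have hs : tsupport (fun z => φ (z, x)) ⊆ Icc ε R := by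
    refine closure_minimal (fun z hz => ?_) isClosed_Icc
    by_contra hn
    exact hz (h0 z x hn)
  exact ⟨h.contDiff.comp (contDiff_id.prodMk contDiff_const),
    isCompact_Icc.of_isClosed_subset (isClosed_tsupport _) hs, fun z hz => hε.trans_le (hs hz).1⟩

lemma IsCylTest.isTest (h : IsCylTest D φ) (z : ℝ) : IsTest D fun x => φ (z, x) := by
  have hc : ContDiff ℝ ∞ fun x => φ (z, x) := h.contDiff.comp (contDiff_const.prodMk contDiff_id)
  cases D with
  | torus => exact ⟨hc, fun x j => h.2.1 z x j⟩
  | convex Ω ho hne hb hv =>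
    have hs : tsupport (fun x => φ (z, x)) ⊆ Prod.mk z ⁻¹' tsupport φ :=
      closure_minimal (fun x hx => subset_tsupport φ hx)
        ((isClosed_tsupport φ).preimage (by fun_prop))
    have hK : IsCompact (Prod.snd '' tsupport φ) := h.2.1.isCompact.image continuous_snd
    exact ⟨hc, hK.of_isClosed_subset (isClosed_tsupport _) fun x hx => ⟨(z, x), hs hx, rfl⟩,
      fun x hx => (h.2.2 (hs hx)).2⟩

lemma IsCylTest.deriv_slice (h : IsCylTest D φ) (z : ℝ) (x : Plane) :
    deriv (fun z => φ (z, x)) z = cylDeriv 0 φ (z, x) := by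
  have h1 := (h.contDiff.differentiable (by simp) (z, x)).hasFDerivAt.comp_hasDerivAt z
    ((hasDerivAt_id z).prodMk (hasDerivAt_const z x))
  exact h1.deriv

lemma IsCylTest.pderiv_slice (h : IsCylTest D φ) (j : Fin 2) (z : ℝ) (x : Plane) :
    SingularQG.pderiv j (fun x => φ (z, x)) x = cylDeriv j.succ φ (z, x) := by
  have h1 := (h.contDiff.differentiable (by simp) (z, x)).hasFDerivAt.comp x
    (hasFDerivAt_prodMk_right z x)
  have h2 : fderiv ℝ (fun x => φ (z, x)) x = _ := h1.fderiv
  rw [SingularQG.pderiv, h2, cylDeriv, cylVec_succ]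
  simp

lemma IsCylTest.memLp_weight_mul_cylDeriv (h : IsCylTest D φ) (a : ℝ) (i : Fin 3) :
    MemLp (fun p => sqrtWeight a i p.1 * cylDeriv i φ p) 2 D.cylMeasure := by
  refine Fin.cases ?_ (fun j => ?_) i
  · obtain ⟨ε, R, hε, hz⟩ := slab_of_isCylTest h
    have hc : Continuous (cylDeriv 0 φ) :=
      (h.contDiff.continuous_fderiv (by simp)).clm_apply continuous_const
    simp only [sqrtWeight_zero]
    refine memLp_of_slab D (ε := ε) (R := R) ?_ ?_ fun z x hzx => ?_
    · exact (by fun_prop : Measurable fun p : ℝ × Plane => p.1 ^ (a / 2)).mul hc.measurable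
    · exact (ContinuousOn.rpow_const continuous_fst.continuousOn
        fun p hp => Or.inl (hε.trans_le hp.1.1).ne').mul hc.continuousOn
    · have h1 : (fun z => φ (z, x)) =ᶠ[𝓝 z] fun _ => 0 := by
        filter_upwards [isClosed_Icc.isOpen_compl.mem_nhds hzx] with w hw using hz w x hw
      rw [← h.deriv_slice, h1.deriv_eq]
      simp
  · simpa only [sqrtWeight_succ, one_mul] using memLp_cylDeriv h j.succ

end CylTest

/-- Both orders of integration are needed: horizontal derivatives are moved on each slice z = const,
vertical ones on each line x = const. -/
lemma integral_separated_height {f : ℝ → ℝ} {v : Plane → ℝ} {w : ℝ × Plane → ℝ}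
    (hi : Integrable (fun p => f p.1 * v p.2 * w p) D.cylMeasure) :
    ∫ p, f p.1 * v p.2 * w p ∂D.cylMeasure
      = ∫ z, f z * ∫ x, v x * w (z, x) ∂D.measure ∂heightMeasure := by
  refine (integral_prod _ hi).trans ?_
  simp only [mul_assoc, integral_const_mul]

lemma integral_separated_plane {f : ℝ → ℝ} {v : Plane → ℝ} {w : ℝ × Plane → ℝ}
    (hi : Integrable (fun p => f p.1 * v p.2 * w p) D.cylMeasure) :
    ∫ p, f p.1 * v p.2 * w p ∂D.cylMeasure
      = ∫ x, v x * ∫ z, f z * w (z, x) ∂heightMeasure ∂D.measure := by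
  refine (integral_prod_symm _ hi).trans ?_
  simp only [mul_comm (f _), mul_assoc, integral_const_mul]

lemma integral_mul_deriv_heightTest {u u' η : ℝ → ℝ} (hu : ∀ z, 0 < z → HasDerivAt u (u' z) z)
    (hu' : ContinuousOn u' (Ioi 0)) (hη : IsHeightTest η) :
    ∫ z, u z * deriv η z ∂heightMeasure = -∫ z, u' z * η z ∂heightMeasure := by
  have hc : ContinuousOn u (Ioi 0) := fun z hz => (hu z hz).continuousAt.continuousWithinAt
  obtain ⟨ε, R, hε, hεR, h0⟩ := hη.exists_Ioo
  have hd : ∀ z ∈ Ioi (0 : ℝ), HasDerivAt η (deriv η z) z := fun z _ =>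
    (hη.1.differentiable (by simp) z).hasDerivAt
  have i1 : IntegrableOn (u * deriv η) (Ioi 0) :=
    integrable_mul_of_slab (hc.locallyIntegrableOn measurableSet_Ioi)
      (hη.1.continuous_deriv (by simp)) hε fun z hz => deriv_eq_zero_of_notMem_Ioo h0 hz
  have i2 : IntegrableOn (u' * η) (Ioi 0) :=
    integrable_mul_of_slab (hu'.locallyIntegrableOn measurableSet_Ioi) hη.1.continuous hε
      fun z hz => h0 z fun h => hz (Ioo_subset_Icc_self h)
  have l1 : Tendsto (u * η) (𝓝[>] 0) (𝓝 0) := by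
    refine tendsto_const_nhds.congr' ?_
    filter_upwards [nhdsWithin_le_nhds (Iio_mem_nhds hε)] with z hz
    rw [Pi.mul_apply, h0 z fun h => not_lt_of_gt hz h.1, mul_zero]
  have l2 : Tendsto (u * η) atTop (𝓝 0) := by
    refine tendsto_const_nhds.congr' ?_
    filter_upwards [eventually_ge_atTop R] with z hz
    rw [Pi.mul_apply, h0 z fun h => not_lt_of_ge hz h.2, mul_zero]
  have := integral_Ioi_mul_deriv_eq_deriv_mul (fun z hz => hu z hz) hd i1 i2 l1 l2
  simpa using this

namespace IsProfile

variable {a k m : ℝ} {f q : ℝ → ℝ}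

lemma memLp (h : IsProfile a k m f q) (hk : 0 < k) : MemLp f 2 heightMeasure := by
  have hm : AEStronglyMeasurable f heightMeasure := h.continuousOn.aestronglyMeasurable
    measurableSet_Ioi
  rw [memLp_two_iff_integrable_sq hm]
  refine Integrable.mono' ((h.energy hk).1.const_mul k⁻¹) (hm.pow 2) ?_
  filter_upwards [ae_restrict_mem measurableSet_Ioi] with z hz
  have h1 : 0 ≤ z ^ (-a) * q z ^ 2 :=
    mul_nonneg (Real.rpow_nonneg (le_of_lt hz) _) (sq_nonneg _)
  rw [Real.norm_of_nonneg (sq_nonneg _), mul_add, inv_mul_cancel_left₀ hk.ne']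
  exact le_add_of_nonneg_left (mul_nonneg (inv_nonneg.2 hk.le) h1)

lemma sq_weight_flux (q : ℝ → ℝ) {z : ℝ} (hz : 0 < z) :
    (-(z ^ (-(a / 2)) * q z)) ^ 2 = z ^ (-a) * q z ^ 2 := by
  rw [neg_sq, mul_pow, ← Real.rpow_natCast, ← Real.rpow_mul hz.le]
  congr 2
  push_cast
  ring

lemma memLp_flux (h : IsProfile a k m f q) (hk : 0 < k) :
    MemLp (fun z => -(z ^ (-(a / 2)) * q z)) 2 heightMeasure := by
  have hm : AEStronglyMeasurable (fun z => -(z ^ (-(a / 2)) * q z)) heightMeasure :=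
    ((continuousOn_height_rpow _).mul h.continuousOn_flux).neg.aestronglyMeasurable
      measurableSet_Ioi
  rw [memLp_two_iff_integrable_sq hm]
  refine Integrable.mono' (h.energy hk).1 (hm.pow 2) ?_
  filter_upwards [ae_restrict_mem measurableSet_Ioi] with z hz
  rw [Real.norm_of_nonneg (sq_nonneg _), sq_weight_flux q hz]
  exact le_add_of_nonneg_right (mul_nonneg hk.le (sq_nonneg _))

lemma norm_sq_add (h : IsProfile a k m f q) (hk : 0 < k) :
    ‖(h.memLp_flux hk).toLp‖ ^ 2 + k * ‖(h.memLp hk).toLp‖ ^ 2 = m := by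
  have i1 : Integrable (fun z => k * f z ^ 2) heightMeasure :=
    (h.memLp hk).integrable_sq.const_mul k
  rw [norm_toLp_sq, norm_toLp_sq, ← integral_const_mul,
    ← integral_add (h.memLp_flux hk).integrable_sq i1]
  refine Eq.trans (setIntegral_congr_fun measurableSet_Ioi fun z hz => ?_) (h.energy hk).2
  simp only [sq_weight_flux q hz]

/-- Decay of the profile, from its monotonicity and the energy identity. -/
lemma mul_sq_le (h : IsProfile a k m f q) (hk : 0 < k) {z : ℝ} (hz : 0 < z) :
    k * f z ^ 2 ≤ m / z := by
  have h1 : ‖(h.memLp hk).toLp‖ ^ 2 ≤ m / k := by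
    rw [le_div_iff₀' hk]
    exact (le_add_of_nonneg_left (sq_nonneg _)).trans_eq (h.norm_sq_add hk)
  have h2 : z * f z ^ 2 ≤ ‖(h.memLp hk).toLp‖ ^ 2 := by
    rw [norm_toLp_sq]
    have h3 : ∫ w in Ioc 0 z, f w ^ 2 ≤ ∫ w, f w ^ 2 ∂heightMeasure :=
      setIntegral_mono_set (h.memLp hk).integrable_sq (Eventually.of_forall fun _ => sq_nonneg _)
        Ioc_subset_Ioi_self.eventuallyLE
    have h4 : ∫ w in Ioc 0 z, f z ^ 2 ≤ ∫ w in Ioc 0 z, f w ^ 2 := by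
      refine setIntegral_mono_on (integrable_const _)
        ((h.memLp hk).integrable_sq.mono_measure (Measure.restrict_mono Ioc_subset_Ioi_self le_rfl))
        measurableSet_Ioc fun w hw => ?_
      exact pow_le_pow_left₀ (h.nonneg z hz) (h.antitoneOn hw.1 hz hw.2) 2
    refine le_trans (le_of_eq ?_) (h4.trans h3)
    simp [hz.le]
  rw [le_div_iff₀ hz]
  calc k * f z ^ 2 * z = k * (z * f z ^ 2) := by ring
    _ ≤ k * (m / k) := by gcongr; exact h2.trans h1
    _ = m := mul_div_cancel₀ _ hk.ne'

end IsProfile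

/-- The weighted gradient of a separated function `f(z) v(x)`, from the weighted vertical derivative
of `f` and the gradient of `v`. -/
def separatedGradient (f f' : Lp ℝ 2 heightMeasure) (v : L2 D) (g : Fin 2 → L2 D) :
    PiLp 2 fun _ : Fin 3 => L2Cyl D :=
  WithLp.toLp 2 (Fin.cons (tensor f' v) fun j => tensor f (g j))

lemma separatedGradient_zero (f f' : Lp ℝ 2 heightMeasure) (v : L2 D) (g : Fin 2 → L2 D) :
    separatedGradient f f' v g 0 = tensor f' v := rfl

lemma separatedGradient_succ (f f' : Lp ℝ 2 heightMeasure) (v : L2 D) (g : Fin 2 → L2 D)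
    (j : Fin 2) :
    separatedGradient f f' v g j.succ = tensor f (g j) := rfl

/-- The horizontal gradients contribute k times ⟨e, e'⟩ by `EigenData.inner_grad`, so the whole
product is a multiple of ⟨e, e'⟩. Gradients of different modes are thus orthogonal whatever their
profiles, and on the diagonal one finds the energy integral of the profile. -/
lemma EigenData.inner_separatedGradient {e e' : L2 D} {k k' : ℝ} {g g' : Fin 2 → L2 D}
    {φ φ' : ℕ → Plane → ℝ} (h : EigenData D e k g φ) (h' : EigenData D e' k' g' φ')
    (f f₁ h₀ h₁ : Lp ℝ 2 heightMeasure) :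
    inner ℝ (separatedGradient f f₁ e g) (separatedGradient h₀ h₁ e' g')
      = (inner ℝ f₁ h₁ + k * inner ℝ f h₀) * inner ℝ e e' := by
  rw [PiLp.inner_apply, Fin.sum_univ_succ (n := 2)]
  simp only [separatedGradient_zero, separatedGradient_succ, inner_tensor]
  rw [← Finset.mul_sum, h.inner_grad h']
  ring

lemma integral_tensor_mul {f : ℝ → ℝ} (hf : MemLp f 2 heightMeasure) (v : L2 D)
    (w : ℝ × Plane → ℝ) :
    ∫ p, tensor (hf.toLp f) v p * w p ∂D.cylMeasure = ∫ p, f p.1 * v p.2 * w p ∂D.cylMeasure := by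
  have h1 : ∀ᵐ p ∂D.cylMeasure, (hf.toLp f) p.1 = f p.1 :=
    Measure.quasiMeasurePreserving_fst.ae hf.coeFn_toLp
  refine integral_congr_ae ?_
  filter_upwards [coeFn_tensor (hf.toLp f) v, h1] with p h2 h3
  rw [h2, h3]

section Mode

variable {a k m : ℝ} {f q : ℝ → ℝ} {e : L2 D} {g : Fin 2 → L2 D} {φ : ℕ → Plane → ℝ}

/-- By Fubini, the vertical component is the classical integration by parts with f' = -z^(-a) q on
each vertical line, and the horizontal ones are the weak gradient of e on each slice. The weight
splits as z^(-a) = z^(-a/2) · z^(-a/2). -/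
lemma EigenData.isWeightedGradient (hE : EigenData D e k g φ) (hp : IsProfile a k m f q)
    (hk : 0 < k) : IsWeightedGradient D a (tensor ((hp.memLp hk).toLp f) e)
      (separatedGradient ((hp.memLp hk).toLp f) ((hp.memLp_flux hk).toLp _) e g) := by
  intro χ hχ i
  have hf := memLp_tensor (hp.memLp hk) (Lp.memLp e)
  refine Fin.cases ?_ (fun j => ?_) i
  · have hq := memLp_tensor (hp.memLp_flux hk) (Lp.memLp e)
    rw [separatedGradient_zero, integral_tensor_mul, integral_tensor_mul,
      integral_separated_plane (hf.integrable_mul (memLp_cylDeriv hχ 0)),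
      integral_separated_plane (f := fun z => -(z ^ (-(a / 2)) * q z))
        (hq.integrable_mul (memLp_weight_mul hχ a 0)), ← integral_neg]
    congr 1; ext x
    rw [← mul_neg]
    congr 1
    simp only [← hχ.deriv_slice]
    rw [integral_mul_deriv_heightTest hp.deriv
      ((continuousOn_height_rpow _).mul hp.continuousOn_flux).neg (hχ.isHeightTest x)]
    congr 1
    refine setIntegral_congr_fun measurableSet_Ioi fun z hz => ?_
    have hz' : (0 : ℝ) < z := hz
    have e1 : z ^ (-a) = z ^ (-(a / 2)) * (z ^ (a / 2))⁻¹ := by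
      rw [← Real.rpow_neg hz'.le, ← Real.rpow_add hz']; congr 1; ring
    simp only [sqrtWeight_zero, e1]
    ring
  · have hg := memLp_tensor (hp.memLp hk) (Lp.memLp (g j))
    rw [separatedGradient_succ, integral_tensor_mul, integral_tensor_mul,
      integral_separated_height (hf.integrable_mul (memLp_cylDeriv hχ j.succ)),
      integral_separated_height (hg.integrable_mul (memLp_weight_mul hχ a j.succ)), ← integral_neg]
    congr 1; ext z
    simp only [sqrtWeight_succ, inv_one, one_mul, ← hχ.pderiv_slice]
    rw [hE.grad _ (hχ.isTest z) j, mul_neg]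

/-- Two contributions cancel: q' = -k f turns the vertical term into -k ∫∫ f e χ, and the eigenvalue
equation on each slice turns the horizontal terms into +k ∫∫ f e χ. -/
lemma EigenData.weak_harmonic (hE : EigenData D e k g φ) (hp : IsProfile a k m f q)
    (hk : 0 < k) {χ : ℝ × Plane → ℝ} (hχ : IsCylTest D χ) :
    ∑ i, ∫ p, separatedGradient ((hp.memLp hk).toLp f) ((hp.memLp_flux hk).toLp _) e g i p
      * (sqrtWeight a i p.1 * cylDeriv i χ p) ∂D.cylMeasure = 0 := by
  have hw := hχ.memLp_weight_mul_cylDeriv a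
  have hq := memLp_tensor (hp.memLp_flux hk) (Lp.memLp e)
  have hg := fun j => memLp_tensor (hp.memLp hk) (Lp.memLp (g j))
  have hf := memLp_tensor (hp.memLp hk) (Lp.memLp e)
  have hχ2 : MemLp χ 2 D.cylMeasure := by
    simpa [sqrtWeight] using memLp_weight_mul hχ a 1
  rw [Fin.sum_univ_succ (n := 2)]
  simp only [separatedGradient_zero, separatedGradient_succ, integral_tensor_mul]
  have h0 : ∫ p, -(p.1 ^ (-(a / 2)) * q p.1) * e p.2 * (sqrtWeight a 0 p.1 * cylDeriv 0 χ p)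
      ∂D.cylMeasure = -(k * ∫ p, f p.1 * e p.2 * χ p ∂D.cylMeasure) := by
    rw [integral_separated_plane (f := fun z => -(z ^ (-(a / 2)) * q z))
        (hq.integrable_mul (hw 0)),
      integral_separated_plane (hf.integrable_mul hχ2), ← integral_const_mul, ← integral_neg]
    congr 1; ext x
    have h1 := integral_mul_deriv_heightTest hp.deriv_flux
      (hp.continuousOn.const_smul k).neg (hχ.isHeightTest x)
    have h2 : ∫ z, -(z ^ (-(a / 2)) * q z) * (sqrtWeight a 0 z * cylDeriv 0 χ (z, x)) ∂heightMeasure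
        = -∫ z, q z * deriv (fun z => χ (z, x)) z ∂heightMeasure := by
      rw [← integral_neg]
      refine setIntegral_congr_fun measurableSet_Ioi fun z hz => ?_
      have hz' : (0 : ℝ) < z := hz
      have e1 : z ^ (-(a / 2)) * z ^ (a / 2) = 1 := by
        rw [← Real.rpow_add hz', neg_add_cancel, Real.rpow_zero]
      simp only [sqrtWeight_zero, hχ.deriv_slice]
      linear_combination (-(q z) * cylDeriv 0 χ (z, x)) * e1
    rw [h2, h1, neg_neg]
    have h3 : ∫ z, -(k * f z) * χ (z, x) ∂heightMeasure
        = -(k * ∫ z, f z * χ (z, x) ∂heightMeasure) := by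
      rw [← integral_const_mul, ← integral_neg]
      congr 1; ext z; ring
    rw [h3]
    ring
  have hj : ∑ j : Fin 2, ∫ p, f p.1 * g j p.2 * (sqrtWeight a j.succ p.1 * cylDeriv j.succ χ p)
      ∂D.cylMeasure = k * ∫ p, f p.1 * e p.2 * χ p ∂D.cylMeasure := by
    have hi := fun j => (hg j).integrable_mul (hw j.succ)
    have h1 := fun j => integral_separated_height (hi j)
    have h2 : ∀ j, Integrable (fun z => f z * ∫ x, g j x * (sqrtWeight a j.succ z *
        cylDeriv j.succ χ (z, x)) ∂D.measure) heightMeasure := fun j => by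
      refine (Integrable.integral_prod_left (hi j)).congr (Eventually.of_forall fun z => ?_)
      simp only [Pi.mul_apply, mul_assoc, integral_const_mul]
    simp only [h1]
    rw [← integral_finsetSum _ fun j _ => h2 j, integral_separated_height (hf.integrable_mul hχ2),
      ← integral_const_mul]
    congr 1; ext z
    simp only [sqrtWeight_succ, one_mul, ← hχ.pderiv_slice]
    rw [← Finset.mul_sum, hE.eigen _ (hχ.isTest z)]
    ring
  rw [h0, hj, neg_add_cancel]

end Mode

end SeparatedModes

/-! ### Passage to the limit in series; the lateral condition for expansions. -/

section Lateral

variable {D : HorizontalDomain}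

section Closure

/-- Both sides of the defining identity are inner products with fixed L² functions, so the relation
is closed under L² convergence of the function and of its gradient. -/
lemma IsWeightedGradient.of_hasSum {a : ℝ} {U : ℕ → L2Cyl D}
    {V : ℕ → PiLp 2 fun _ : Fin 3 => L2Cyl D} {Ψ : L2Cyl D} {G : PiLp 2 fun _ : Fin 3 => L2Cyl D}
    (h : ∀ i, IsWeightedGradient D a (U i) (V i))
    (hU : HasSum U Ψ) (hV : HasSum V G) : IsWeightedGradient D a Ψ G := by
  intro χ hχ l
  have h1 := hU.mapL (innerSL ℝ ((memLp_cylDeriv hχ l).toLp _))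
  have h2 := ((hV.mapL (PiLp.proj 2 (fun _ : Fin 3 => L2Cyl D) l : _ →L[ℝ] L2Cyl D)).mapL
    (innerSL ℝ ((memLp_weight_mul hχ a l).toLp _))).neg
  simp only [innerSL_apply_apply, PiLp.proj_apply, ← integral_mul_eq_inner] at h1 h2
  simp only [fun i => h i χ hχ l] at h1
  exact h1.unique h2

lemma weak_harmonic_of_hasSum {a : ℝ} {V : ℕ → PiLp 2 fun _ : Fin 3 => L2Cyl D}
    {G : PiLp 2 fun _ : Fin 3 => L2Cyl D} {χ : ℝ × Plane → ℝ} (hχ : IsCylTest D χ)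
    (h : ∀ i, ∑ l, ∫ p, V i l p * (sqrtWeight a l p.1 * cylDeriv l χ p) ∂D.cylMeasure = 0)
    (hV : HasSum V G) :
    ∑ l, ∫ p, G l p * (sqrtWeight a l p.1 * cylDeriv l χ p) ∂D.cylMeasure = 0 := by
  have h1 : HasSum (fun i => ∑ l, ∫ p, V i l p * (sqrtWeight a l p.1 * cylDeriv l χ p)
      ∂D.cylMeasure)
      (∑ l, ∫ p, G l p * (sqrtWeight a l p.1 * cylDeriv l χ p) ∂D.cylMeasure) := by
    refine hasSum_sum fun l _ => ?_
    have h2 := (hV.mapL (PiLp.proj 2 (fun _ : Fin 3 => L2Cyl D) l : _ →L[ℝ] L2Cyl D)).mapL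
      (innerSL ℝ ((hχ.memLp_weight_mul_cylDeriv a l).toLp _))
    simpa only [innerSL_apply_apply, PiLp.proj_apply, ← integral_mul_eq_inner] using h2
  simp only [h] at h1
  exact h1.unique hasSum_zero

end Closure

lemma IsTest.zero : IsTest D 0 := by
  cases D with
  | torus => exact ⟨contDiff_const, fun _ _ => rfl⟩
  | convex Ω ho hne hb hc => exact ⟨contDiff_const, HasCompactSupport.zero, by simp⟩

lemma IsTest.add {φ ψ : Plane → ℝ} (hφ : IsTest D φ) (hψ : IsTest D ψ) : IsTest D (φ + ψ) := by
  cases D with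
  | torus => exact ⟨hφ.1.add hψ.1, fun x j => by simp only [Pi.add_apply, hφ.2, hψ.2]⟩
  | convex Ω ho hne hb hc =>
    exact ⟨hφ.1.add hψ.1, hφ.2.1.add hψ.2.1, (tsupport_add φ ψ).trans (union_subset hφ.2.2 hψ.2.2)⟩

lemma IsTest.smul {φ : Plane → ℝ} (c : ℝ) (hφ : IsTest D φ) : IsTest D (c • φ) := by
  cases D with
  | torus => exact ⟨hφ.1.const_smul c, fun x j => by simp only [Pi.smul_apply, hφ.2]⟩
  | convex Ω ho hne hb hc =>
    exact ⟨hφ.1.const_smul c, hφ.2.1.smul_left,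
      (closure_mono (Function.support_const_smul_subset c φ)).trans hφ.2.2⟩

variable (D) in
/-- The graph of the gradient over the test functions, in `L²(Ω)³`. -/
def testGraph : Submodule ℝ (PiLp 2 fun _ : Fin 3 => L2 D) where
  carrier := {w | ∃ (χ : Plane → ℝ) (_ : IsTest D χ), ⇑(w 0) =ᵐ[D.measure] χ ∧
    ∀ j : Fin 2, ⇑(w j.succ) =ᵐ[D.measure] pderiv j χ}
  zero_mem' := by
    have h0 : ⇑(0 : L2 D) =ᵐ[D.measure] 0 := Lp.coeFn_zero ℝ 2 D.measure
    refine ⟨0, IsTest.zero, h0, fun j => h0.trans (Eventually.of_forall fun x => ?_)⟩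
    simp [pderiv]
  add_mem' := by
    rintro w w' ⟨χ, hχ, h0, h1⟩ ⟨χ', hχ', h0', h1'⟩
    refine ⟨χ + χ', hχ.add hχ', (Lp.coeFn_add _ _).trans (h0.add h0'), fun j => ?_⟩
    rw [pderiv_add hχ.contDiff hχ'.contDiff]
    exact (Lp.coeFn_add _ _).trans ((h1 j).add (h1' j))
  smul_mem' := by
    rintro c w ⟨χ, hχ, h0, h1⟩
    refine ⟨c • χ, hχ.smul c, (Lp.coeFn_smul _ _).trans (h0.const_smul c), fun j => ?_⟩
    rw [pderiv_smul c hχ.contDiff]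
    exact (Lp.coeFn_smul _ _).trans ((h1 j).const_smul c)

/-- A function and its gradient, as an element of `L²(Ω)³`. -/
def graphVec (u : L2 D) (g : Fin 2 → L2 D) : PiLp 2 fun _ : Fin 3 => L2 D :=
  WithLp.toLp 2 (Fin.cons u g)

lemma graphVec_zero (u : L2 D) (g : Fin 2 → L2 D) : graphVec u g 0 = u := rfl

lemma graphVec_succ (u : L2 D) (g : Fin 2 → L2 D) (j : Fin 2) : graphVec u g j.succ = g j := rfl

lemma EigenData.graphVec_mem {e : L2 D} {k : ℝ} {g : Fin 2 → L2 D} {φ : ℕ → Plane → ℝ}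
    (hE : EigenData D e k g φ) : graphVec e g ∈ (testGraph D).topologicalClosure := by
  have hm := fun n => (hE.test n).memLp
  have hm' := fun (j : Fin 2) n => ((hE.test n).pderiv j).memLp
  refine mem_closure_of_tendsto (b := atTop)
    (f := fun n => graphVec ((hm n).toLp _) fun j => (hm' j n).toLp _) ?_
    (Eventually.of_forall fun n => ⟨φ n, hE.test n, (hm n).coeFn_toLp,
      fun j => (hm' j n).coeFn_toLp⟩)
  refine ((PiLp.continuous_toLp 2 _).tendsto _).comp (tendsto_pi_nhds.2 fun l => ?_)
  refine Fin.cases ?_ (fun j => ?_) l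
  · simpa using tendsto_toLp hm (Lp.memLp e) hE.tendsto
  · simpa using tendsto_toLp (hm' j) (Lp.memLp (g j)) (hE.tendsto_grad j)

/-- The closure of `testGraph` is a closed subspace, hence stable under convergent series; here it
is translated back into approximation by a sequence of test functions. -/
lemma memH10_of_mem_closure {Ω : Set Plane} {ho hne hb hc} {w : PiLp 2 fun _ : Fin 3 =>
      L2 (.convex Ω ho hne hb hc)}
    (hw : w ∈ (testGraph (.convex Ω ho hne hb hc)).topologicalClosure) : MemH10 Ω (w 0) := by
  obtain ⟨W, hW, hlim⟩ := mem_closure_iff_seq_limit.1 hw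
  choose χ hχ h0 h1 using hW
  have hl : ∀ l, Tendsto (fun n => W n l) atTop (𝓝 (w l)) := fun l =>
    ((PiLp.continuous_apply 2 _ l).tendsto w).comp hlim
  have hl' := fun l => (Lp.tendsto_Lp_iff_tendsto_eLpNorm' _ _).1 (hl l)
  refine ⟨Lp.memLp (w 0), χ, fun j => w j.succ, hχ, fun j => Lp.memLp _, ?_, fun j => ?_⟩
  · exact (hl' 0).congr fun n => eLpNorm_congr_ae ((h0 n).sub (EventuallyEq.refl _ _))
  · exact (hl' j.succ).congr fun n => eLpNorm_congr_ae ((h1 n j).sub (EventuallyEq.refl _ _))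

section Basis

variable {e : ℕ → L2 D} {k : ℕ → ℝ} {g : ℕ → Fin 2 → L2 D} {φ : ℕ → ℕ → Plane → ℝ}

lemma IsEigenbasis.pairwise_smul (he : IsEigenbasis D e k) (c : ℕ → ℝ) :
    Pairwise fun i j => inner ℝ (c i • e i) (c j • e j) = 0 := fun i j hij => by
  simp [inner_smul_left, inner_smul_right, he.orthonormal.2 hij]

lemma IsEigenbasis.norm_sq_smul (he : IsEigenbasis D e k) (c : ℝ) (i : ℕ) :
    ‖c • e i‖ ^ 2 = c ^ 2 := by
  rw [norm_smul, he.orthonormal.1, mul_one, Real.norm_eq_abs, sq_abs]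

lemma IsEigenbasis.summable_smul (he : IsEigenbasis D e k) {c : ℕ → ℝ}
    (hc : Summable fun i => c i ^ 2) : Summable fun i => c i • e i :=
  summable_of_pairwise_orthogonal (he.pairwise_smul c) (by simpa only [he.norm_sq_smul] using hc)

lemma IsEigenbasis.inner_tsum (he : IsEigenbasis D e k) {c : ℕ → ℝ}
    (hc : Summable fun i => c i ^ 2) (i : ℕ) : inner ℝ (e i) (∑' j, c j • e j) = c i := by
  have h1 := ((he.summable_smul hc).hasSum.mapL (innerSL ℝ (e i))).tsum_eq
  simp only [innerSL_apply_apply, inner_smul_right] at h1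
  rw [← h1, tsum_eq_single i]
  · rw [real_inner_self_eq_norm_sq, he.orthonormal.1]; ring
  · intro j hj
    rw [he.orthonormal.2 hj.symm, mul_zero]

lemma IsEigenbasis.norm_sq_tsum (he : IsEigenbasis D e k) {c : ℕ → ℝ}
    (hc : Summable fun i => c i ^ 2) : ‖∑' j, c j • e j‖ ^ 2 = ∑' j, c j ^ 2 := by
  rw [norm_tsum_sq_of_pairwise_orthogonal (he.pairwise_smul c) (he.summable_smul hc)]
  simp only [he.norm_sq_smul]

lemma IsEigenbasis.integral_eq_zero (he : IsEigenbasis D e k) (hD : D = .torus) (i : ℕ) :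
    ∫ x, e i x ∂D.measure = 0 := by
  have := he.lateral i
  subst hD
  exact this

lemma IsEigenbasis.integral_tsum (he : IsEigenbasis D e k) (hD : D = .torus) {c : ℕ → ℝ}
    (hc : Summable fun i => c i ^ 2) : ∫ x, (∑' j, c j • e j : L2 D) x ∂D.measure = 0 := by
  have m1 : MemLp (fun _ : Plane => (1 : ℝ)) 2 D.measure := memLp_const 1
  have h1 := ((he.summable_smul hc).hasSum.mapL (innerSL ℝ (m1.toLp _))).tsum_eq
  simp only [innerSL_apply_apply, inner_smul_right, ← integral_mul_eq_inner, mul_one,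
    he.integral_eq_zero hD, mul_zero, tsum_zero] at h1
  exact h1.symm

/-- Finite-energy expansions in the eigenbasis satisfy the lateral condition. -/
lemma IsEigenbasis.lateralCondition_tsum (he : IsEigenbasis D e k)
    (hE : ∀ i, EigenData D (e i) (k i) (g i) (φ i)) {c : ℕ → ℝ} (hc : Summable fun i => c i ^ 2)
    (hkc : Summable fun i => k i * c i ^ 2) : LateralCondition D (∑' j, c j • e j : L2 D) := by
  -- In the graph norm the eigenfunctions remain orthogonal, with squared norm 1 + k_i. Summability
  -- of c_i² and k_i c_i² is therefore what convergence in H¹ requires.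
  have hin : ∀ i j, inner ℝ (graphVec (e i) (g i)) (graphVec (e j) (g j))
      = (1 + k i) * inner ℝ (e i) (e j) := fun i j => by
    rw [PiLp.inner_apply, Fin.sum_univ_succ (n := 2)]
    simp only [graphVec_zero, graphVec_succ]
    rw [(hE i).inner_grad (hE j)]
    ring
  have hs : Summable fun i => c i • graphVec (e i) (g i) := by
    refine summable_of_pairwise_orthogonal (fun i j hij => ?_) ?_
    · simp [inner_smul_left, inner_smul_right, hin, he.orthonormal.2 hij]
    · refine (hc.add hkc).congr fun i => ?_
      rw [norm_smul, mul_pow, ← real_inner_self_eq_norm_sq (graphVec (e i) (g i)), hin,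
        real_inner_self_eq_norm_sq, he.orthonormal.1, Real.norm_eq_abs, sq_abs]
      ring
  have hmem : ∑' i, c i • graphVec (e i) (g i) ∈ (testGraph D).topologicalClosure :=
    (testGraph D).isClosed_topologicalClosure.mem_of_tendsto hs.hasSum
      (Eventually.of_forall fun s => Submodule.sum_mem _ fun i _ =>
        Submodule.smul_mem _ _ (hE i).graphVec_mem)
  have h0 : (∑' i, c i • graphVec (e i) (g i)) 0 = ∑' i, c i • e i := by
    have := (hs.hasSum.mapL (PiLp.proj 2 (fun _ : Fin 3 => L2 D) 0 : _ →L[ℝ] L2 D)).tsum_eq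
    simpa only [PiLp.proj_apply, PiLp.smul_apply, graphVec_zero] using this.symm
  cases D with
  | torus => exact he.integral_tsum rfl hc
  | convex Ω ho hne hb hv =>
    rw [← h0]
    exact memH10_of_mem_closure hmem

end Basis

end Lateral

/-! ### Series of separated solutions. -/

section Series

variable {D : HorizontalDomain}

lemma mem_hDot_iff {k : ℕ → ℝ} (hk : ∀ i, 0 < k i) {s : ℝ} {θ : ℕ → ℝ} :
    θ ∈ HDot k s ↔ Summable fun i => k i ^ s * θ i ^ 2 := by
  change Memℓp (fun i => k i ^ (s / 2) * θ i) 2 ↔ _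
  rw [memℓp_gen_iff (by norm_num)]
  refine summable_congr fun i => ?_
  rw [ENNReal.toReal_ofNat, Real.rpow_two, Real.norm_eq_abs, sq_abs, mul_pow, ← Real.rpow_natCast,
    ← Real.rpow_mul (hk i).le]
  norm_num

lemma normHDot_sq {k : ℕ → ℝ} (hk : ∀ i, 0 < k i) {s : ℝ} (θ : HDot k s) :
    normHDot θ ^ 2 = ∑' i, k i ^ s * (θ : ℕ → ℝ) i ^ 2 :=
  Real.sq_sqrt (tsum_nonneg fun i => mul_nonneg (Real.rpow_nonneg (hk i).le s) (sq_nonneg _))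

lemma sliceCoef_smul_tensor (b : ℝ) (w : Lp ℝ 2 heightMeasure) (u v : L2 D) :
    sliceCoef D v (b • tensor w u : L2Cyl D) =ᵐ[heightMeasure]
      fun z => b * (w z * inner ℝ u v) := by
  have h1 : ⇑(b • tensor w u) =ᵐ[D.cylMeasure] fun p => b * tensor w u p := by
    filter_upwards [Lp.coeFn_smul b (tensor w u)] with p hp
    rw [hp]; rfl
  filter_upwards [sliceCoef_congr h1 v, sliceCoef_tensor w u v] with z h2 h3
  rw [h2, ← h3, sliceCoef, sliceCoef, ← integral_const_mul]
  simp only [mul_assoc]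

/-- The data from which the extension operators are built: an eigenbasis with its spectral gap, and
the vertical profile of each of its modes. -/
structure ModalData (D : HorizontalDomain) (e : ℕ → L2 D) (k : ℕ → ℝ) (g : ℕ → Fin 2 → L2 D)
    (φ : ℕ → ℕ → Plane → ℝ) (a κ c : ℝ) (f q : ℕ → ℝ → ℝ) : Prop where
  weight_lt : a < 1
  basis : IsEigenbasis D e k
  data : ∀ i, EigenData D (e i) (k i) (g i) (φ i)
  gap_pos : 0 < c
  gap : ∀ i, c ≤ k i
  factor_pos : 0 < κ
  profile : ∀ i, IsProfile a (k i) (κ * k i ^ ((1 - a) / (2 - a))) (f i) (q i)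

namespace ModalData

variable {e : ℕ → L2 D} {k : ℕ → ℝ} {g : ℕ → Fin 2 → L2 D} {φ : ℕ → ℕ → Plane → ℝ} {a κ c : ℝ}
  {f q : ℕ → ℝ → ℝ} (M : ModalData D e k g φ a κ c f q) {h : ℕ → ℝ}
include M

lemma pos (i : ℕ) : 0 < k i := M.gap_pos.trans_le (M.gap i)

lemma rpow_pos (s : ℝ) (i : ℕ) : 0 < k i ^ s := Real.rpow_pos_of_pos (M.pos i) s

/-- The `i`-th vertical profile, as an element of `L²(ℝ₊)`. -/
def height (i : ℕ) : Lp ℝ 2 heightMeasure := ((M.profile i).memLp (M.pos i)).toLp (f i)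

/-- The weighted derivative of the `i`-th vertical profile, as an element of `L²(ℝ₊)`. -/
def flux (i : ℕ) : Lp ℝ 2 heightMeasure := ((M.profile i).memLp_flux (M.pos i)).toLp _

/-- The separated solution with trace `e i`. -/
def mode (i : ℕ) : L2Cyl D := tensor (M.height i) (e i)

/-- The weighted gradient of the `i`-th separated solution. -/
def modeGrad (i : ℕ) : PiLp 2 fun _ : Fin 3 => L2Cyl D :=
  separatedGradient (M.height i) (M.flux i) (e i) (g i)

lemma inner_modeGrad (i j : ℕ) : inner ℝ (M.modeGrad i) (M.modeGrad j)
    = (inner ℝ (M.flux i) (M.flux j) + k i * inner ℝ (M.height i) (M.height j))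
      * inner ℝ (e i) (e j) :=
  (M.data i).inner_separatedGradient (M.data j) _ _ _ _

lemma norm_sq_modeGrad (i : ℕ) : ‖M.modeGrad i‖ ^ 2 = κ * k i ^ ((1 - a) / (2 - a)) := by
  rw [← real_inner_self_eq_norm_sq, M.inner_modeGrad, real_inner_self_eq_norm_sq,
    real_inner_self_eq_norm_sq, real_inner_self_eq_norm_sq, M.basis.orthonormal.1, one_pow, mul_one]
  exact (M.profile i).norm_sq_add (M.pos i)

/-- The energy identity bounds k_i ‖f_i‖² by κ k_i^ν, and the spectral gap gives c ≤ k_i. -/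
lemma norm_sq_mode_le (i : ℕ) : ‖M.mode i‖ ^ 2 ≤ κ / c * k i ^ ((1 - a) / (2 - a)) := by
  have h1 := (M.profile i).norm_sq_add (M.pos i)
  have h2 : k i * ‖M.height i‖ ^ 2 ≤ κ * k i ^ ((1 - a) / (2 - a)) :=
    (le_add_of_nonneg_left (sq_nonneg _)).trans_eq h1
  have h3 : c * ‖M.height i‖ ^ 2 ≤ k i * ‖M.height i‖ ^ 2 :=
    mul_le_mul_of_nonneg_right (M.gap i) (sq_nonneg _)
  rw [mode, norm_tensor, M.basis.orthonormal.1, mul_one, div_mul_eq_mul_div, le_div_iff₀' M.gap_pos]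
  exact h3.trans h2

lemma pairwise_mode : Pairwise fun i j => inner ℝ (h i • M.mode i) (h j • M.mode j) = 0 :=
  fun i j hij => by
    simp [mode, inner_tensor, inner_smul_left, inner_smul_right, M.basis.orthonormal.2 hij]

lemma pairwise_modeGrad :
    Pairwise fun i j => inner ℝ (h i • M.modeGrad i) (h j • M.modeGrad j) = 0 := fun i j hij => by
  simp [inner_modeGrad, inner_smul_left, inner_smul_right, M.basis.orthonormal.2 hij]

lemma norm_sq_smul_modeGrad (i : ℕ) :
    ‖h i • M.modeGrad i‖ ^ 2 = κ * (k i ^ ((1 - a) / (2 - a)) * h i ^ 2) := by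
  rw [norm_smul, mul_pow, M.norm_sq_modeGrad, Real.norm_eq_abs, sq_abs]
  ring

lemma norm_sq_smul_mode_le (i : ℕ) :
    ‖h i • M.mode i‖ ^ 2 ≤ κ / c * (k i ^ ((1 - a) / (2 - a)) * h i ^ 2) := by
  rw [norm_smul, mul_pow, Real.norm_eq_abs, sq_abs]
  refine (mul_le_mul_of_nonneg_left (M.norm_sq_mode_le i) (sq_nonneg _)).trans_eq ?_
  ring

lemma profile_sq_le_one (i : ℕ) {z : ℝ} (hz : 0 < z) : f i z ^ 2 ≤ 1 :=
  pow_le_one₀ ((M.profile i).nonneg z hz) ((M.profile i).le_one z hz)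

section Series

variable (hh : Summable fun i => k i ^ ((1 - a) / (2 - a)) * h i ^ 2)
include hh

lemma summable_modeGrad : Summable fun i => h i • M.modeGrad i :=
  summable_of_pairwise_orthogonal M.pairwise_modeGrad (by
    simpa only [M.norm_sq_smul_modeGrad] using hh.mul_left κ)

lemma summable_norm_sq_mode : Summable fun i => ‖h i • M.mode i‖ ^ 2 :=
  (hh.mul_left (κ / c)).of_nonneg_of_le (fun _ => sq_nonneg _) M.norm_sq_smul_mode_le

lemma summable_mode : Summable fun i => h i • M.mode i :=
  summable_of_pairwise_orthogonal M.pairwise_mode (M.summable_norm_sq_mode hh)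

lemma norm_sq_tsum_modeGrad :
    ‖∑' i, h i • M.modeGrad i‖ ^ 2 = κ * ∑' i, k i ^ ((1 - a) / (2 - a)) * h i ^ 2 := by
  rw [norm_tsum_sq_of_pairwise_orthogonal M.pairwise_modeGrad (M.summable_modeGrad hh),
    ← tsum_mul_left]
  simp only [M.norm_sq_smul_modeGrad]

lemma norm_sq_tsum_mode_le :
    ‖∑' i, h i • M.mode i‖ ^ 2 ≤ κ / c * ∑' i, k i ^ ((1 - a) / (2 - a)) * h i ^ 2 := by
  rw [norm_tsum_sq_of_pairwise_orthogonal M.pairwise_mode (M.summable_mode hh), ← tsum_mul_left]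
  exact (M.summable_norm_sq_mode hh).tsum_le_tsum M.norm_sq_smul_mode_le (hh.mul_left _)

lemma isWeightedGradient_tsum :
    IsWeightedGradient D a (∑' i, h i • M.mode i)
      (∑' i, h i • M.modeGrad i : PiLp 2 fun _ : Fin 3 => L2Cyl D) :=
  IsWeightedGradient.of_hasSum (V := fun i => h i • M.modeGrad i)
    (fun i => isWeightedGradient_smul (h i) ((M.data i).isWeightedGradient (M.profile i) (M.pos i)))
    (M.summable_mode hh).hasSum (M.summable_modeGrad hh).hasSum

lemma weak_harmonic_tsum {χ : ℝ × Plane → ℝ} (hχ : IsCylTest D χ) :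
    ∑ l, ∫ p, (∑' i, h i • M.modeGrad i) l p * (sqrtWeight a l p.1 * cylDeriv l χ p)
      ∂D.cylMeasure = 0 := by
  refine weak_harmonic_of_hasSum hχ (fun i => ?_) (M.summable_modeGrad hh).hasSum
  have h1 : ∀ l, ∫ p, (h i • M.modeGrad i) l p * (sqrtWeight a l p.1 * cylDeriv l χ p) ∂D.cylMeasure
      = h i * ∫ p, M.modeGrad i l p * (sqrtWeight a l p.1 * cylDeriv l χ p) ∂D.cylMeasure := by
    intro l
    rw [← integral_const_mul]
    refine integral_congr_ae ?_
    filter_upwards [Lp.coeFn_smul (h i) (M.modeGrad i l)] with p hp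
    rw [PiLp.smul_apply, hp, Pi.smul_apply, smul_eq_mul, mul_assoc]
  simp only [h1, ← Finset.mul_sum]
  rw [modeGrad, height, flux, (M.data i).weak_harmonic (M.profile i) (M.pos i) hχ, mul_zero]

/-- The spectral gap and ν ≥ 0 give k_i^ν ≥ c^ν, so Ḣ^ν embeds in L². -/
lemma summable_sq : Summable fun i => h i ^ 2 := by
  have hc := Real.rpow_pos_of_pos M.gap_pos ((1 - a) / (2 - a))
  have ha := M.weight_lt
  refine (hh.mul_left (c ^ ((1 - a) / (2 - a)))⁻¹).of_nonneg_of_le (fun _ => sq_nonneg _)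
    fun i => ?_
  rw [← div_eq_inv_mul, le_div_iff₀' hc]
  refine mul_le_mul_of_nonneg_right (Real.rpow_le_rpow M.gap_pos.le (M.gap i) ?_) (sq_nonneg _)
  exact div_nonneg (by linarith) (by linarith)

lemma summable_slice_sq {z : ℝ} (hz : 0 < z) : Summable fun i => (h i * f i z) ^ 2 := by
  refine (M.summable_sq hh).of_nonneg_of_le (fun _ => sq_nonneg _) fun i => ?_
  rw [mul_pow]
  exact mul_le_of_le_one_right (sq_nonneg _) (M.profile_sq_le_one i hz)

/-- The datum is only in Ḣ^ν, but the slices at positive height lie in H¹: the decay k_i f_i(z)² ≤ κ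
k_i^ν / z compensates the missing powers of k_i. The lateral condition on slices rests on this. -/
lemma summable_slice_energy {z : ℝ} (hz : 0 < z) : Summable fun i => k i * (h i * f i z) ^ 2 := by
  refine (hh.mul_left (κ / z)).of_nonneg_of_le
    (fun i => mul_nonneg (M.pos i).le (sq_nonneg _)) fun i => ?_
  calc k i * (h i * f i z) ^ 2 = h i ^ 2 * (k i * f i z ^ 2) := by ring
    _ ≤ h i ^ 2 * (κ * k i ^ ((1 - a) / (2 - a)) / z) :=
      mul_le_mul_of_nonneg_left ((M.profile i).mul_sq_le (M.pos i) hz) (sq_nonneg _)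
    _ = κ / z * (k i ^ ((1 - a) / (2 - a)) * h i ^ 2) := by ring

lemma sliceCoef_tsum_mode (i : ℕ) :
    sliceCoef D (e i) (∑' j, h j • M.mode j : L2Cyl D) =ᵐ[heightMeasure] fun z => h i * f i z := by
  refine sliceCoef_hasSum (M.summable_mode hh).hasSum (e i) (i := i) ?_ fun j hj => ?_
  · filter_upwards [sliceCoef_smul_tensor (h i) (M.height i) (e i) (e i),
      ((M.profile i).memLp (M.pos i)).coeFn_toLp] with z h1 h2
    rw [mode, h1, real_inner_self_eq_norm_sq, M.basis.orthonormal.1, height, h2]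
    ring
  · filter_upwards [sliceCoef_smul_tensor (h j) (M.height j) (e j) (e i)] with z h1
    rw [mode, h1, M.basis.orthonormal.2 hj]
    simp

lemma sliceCoef_tsum_modeGrad (i : ℕ) :
    sliceCoef D (e i) ((∑' j, h j • M.modeGrad j) 0 : L2Cyl D) =ᵐ[heightMeasure]
      fun z => h i * -(z ^ (-(a / 2)) * q i z) := by
  have hs := (M.summable_modeGrad hh).hasSum.mapL
    (PiLp.proj 2 (fun _ : Fin 3 => L2Cyl D) 0 : _ →L[ℝ] L2Cyl D)
  simp only [PiLp.proj_apply, PiLp.smul_apply, modeGrad, separatedGradient_zero] at hs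
  refine sliceCoef_hasSum hs (e i) (i := i) ?_ fun j hj => ?_
  · filter_upwards [sliceCoef_smul_tensor (h i) (M.flux i) (e i) (e i),
      ((M.profile i).memLp_flux (M.pos i)).coeFn_toLp] with z h1 h2
    rw [h1, real_inner_self_eq_norm_sq, M.basis.orthonormal.1, flux, h2]
    ring
  · filter_upwards [sliceCoef_smul_tensor (h j) (M.flux j) (e j) (e i)] with z h1
    rw [h1, M.basis.orthonormal.2 hj]
    simp

/-- The eigenfunctions have integral zero, and pairing with the constant 1 passes through the
series. This is the information on the constant mode needed to identify the slices. -/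
lemma integral_slice_eq_zero (hD : D = .torus) :
    ∀ᵐ z ∂heightMeasure, ∫ x, (∑' j, h j • M.mode j : L2Cyl D) (z, x) ∂D.measure = 0 := by
  have m1 : MemLp (fun _ : Plane => (1 : ℝ)) 2 D.measure := memLp_const 1
  have h0 : ∀ j, sliceCoef D (m1.toLp _) (h j • M.mode j : L2Cyl D) =ᵐ[heightMeasure] 0 :=
    fun j => by
    filter_upwards [sliceCoef_smul_tensor (h j) (M.height j) (e j) (m1.toLp _)] with z h1
    rw [mode, h1, real_inner_comm, ← integral_mul_eq_inner]
    simp [M.basis.integral_eq_zero hD]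
  filter_upwards [sliceCoef_hasSum (M.summable_mode hh).hasSum (m1.toLp _) (h0 0) fun j _ => h0 j]
    with z hz
  rw [sliceCoef_congr_right m1.coeFn_toLp] at hz
  simpa [sliceCoef] using hz

/-- The horizontal slices of the extension. -/
lemma slice_tsum_mode : ∀ᵐ z ∂heightMeasure, (fun x => (∑' j, h j • M.mode j : L2Cyl D) (z, x))
    =ᵐ[D.measure] (∑' j, (h j * f j z) • e j : L2 D) := by
  have h1 : ∀ᵐ z ∂heightMeasure, D = .torus →
      ∫ x, (∑' j, h j • M.mode j : L2Cyl D) (z, x) ∂D.measure = 0 := by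
    by_cases hD : D = .torus
    · filter_upwards [M.integral_slice_eq_zero hh hD] with z hz _ using hz
    · exact Eventually.of_forall fun z h => absurd h hD
  filter_upwards [ae_all_iff.2 (M.sliceCoef_tsum_mode hh), memLp_slice (∑' j, h j • M.mode j), h1,
    ae_restrict_mem measurableSet_Ioi] with z h2 h3 h4 hz
  have hs := M.summable_slice_sq hh hz
  rw [← toLp_eq_of_coef M.basis h3 _ (fun i => (h2 i).trans (M.basis.inner_tsum hs i).symm)
    fun hD => (h4 hD).trans (M.basis.integral_tsum hD hs).symm]
  exact h3.coeFn_toLp.symm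

lemma tsum_mode_mem : ∑' i, h i • M.mode i ∈ SobolevH D a := by
  refine ⟨⟨_, M.isWeightedGradient_tsum hh⟩, ?_⟩
  filter_upwards [M.slice_tsum_mode hh, ae_restrict_mem measurableSet_Ioi] with z h1 hz
  exact LateralCondition.congr h1.symm (M.basis.lateralCondition_tsum M.data
    (M.summable_slice_sq hh hz) (M.summable_slice_energy hh hz))

end Series

end ModalData

end Series

/-! ### The extension operators, their energies and their traces. -/

section Extension

variable {D : HorizontalDomain}

namespace ModalData

variable {e : ℕ → L2 D} {k : ℕ → ℝ} {g : ℕ → Fin 2 → L2 D} {φ : ℕ → ℕ → Plane → ℝ} {a κ c : ℝ}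
  {f q : ℕ → ℝ → ℝ} (M : ModalData D e k g φ a κ c f q)
include M

lemma summable_of_hDot (h : HDot k ((1 - a) / (2 - a))) :
    Summable fun i => k i ^ ((1 - a) / (2 - a)) * (h : ℕ → ℝ) i ^ 2 :=
  (mem_hDot_iff M.pos).1 h.2

/-- The Dirichlet extension operator. -/
def dirichletExtension : HDot k ((1 - a) / (2 - a)) →ₗ[ℝ] SobolevH D a where
  toFun h := ⟨∑' i, (h : ℕ → ℝ) i • M.mode i, M.tsum_mode_mem (M.summable_of_hDot h)⟩
  map_add' h h' := by
    refine Subtype.ext ?_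
    simp only [Submodule.coe_add, Pi.add_apply, add_smul]
    exact (M.summable_mode (M.summable_of_hDot h)).tsum_add
      (M.summable_mode (M.summable_of_hDot h'))
  map_smul' b h := by
    refine Subtype.ext ?_
    simp only [Submodule.coe_smul, Pi.smul_apply, smul_assoc, RingHom.id_apply]
    exact (M.summable_mode (M.summable_of_hDot h)).tsum_const_smul b

lemma coe_dirichletExtension (h : HDot k ((1 - a) / (2 - a))) :
    (M.dirichletExtension h : L2Cyl D) = ∑' i, (h : ℕ → ℝ) i • M.mode i := rfl

/-- The gradient chosen in the definition of the energy is the series of explicit gradients, by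
uniqueness; energy, harmonicity and flux can then be read off mode by mode. -/
lemma weightedGradient_dirichletExtension (h : HDot k ((1 - a) / (2 - a))) :
    weightedGradient (M.dirichletExtension h)
      = (∑' i, (h : ℕ → ℝ) i • M.modeGrad i : PiLp 2 fun _ : Fin 3 => L2Cyl D) :=
  IsWeightedGradient.unique M.basis M.data (weightedGradient_spec _)
    (M.isWeightedGradient_tsum (M.summable_of_hDot h))

lemma energy_dirichletExtension (h : HDot k ((1 - a) / (2 - a))) :
    energy (M.dirichletExtension h) = κ * normHDot h ^ 2 := by
  rw [energy, M.weightedGradient_dirichletExtension, normHDot_sq M.pos,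
    ← M.norm_sq_tsum_modeGrad (M.summable_of_hDot h), PiLp.norm_sq_eq_of_L2]
  rw [integral_finsetSum _ fun l _ => (Lp.memLp _).integrable_sq]
  refine Finset.sum_congr rfl fun l _ => ?_
  rw [← real_inner_self_eq_norm_sq, ← integral_mul_coe]
  simp only [sq]

lemma normH_dirichletExtension_le (h : HDot k ((1 - a) / (2 - a))) :
    normH (M.dirichletExtension h) ≤ (√(κ / c) + √κ) * normHDot h := by
  have h0 : 0 ≤ normHDot h := Real.sqrt_nonneg _
  have h1 : ‖(M.dirichletExtension h : L2Cyl D)‖ ≤ √(κ / c) * normHDot h := by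
    have := M.norm_sq_tsum_mode_le (M.summable_of_hDot h)
    rw [← normHDot_sq M.pos, ← M.coe_dirichletExtension] at this
    refine (Real.le_sqrt_of_sq_le this).trans_eq ?_
    rw [Real.sqrt_mul (div_pos M.factor_pos M.gap_pos).le, Real.sqrt_sq h0]
  have h2 : √(energy (M.dirichletExtension h)) = √κ * normHDot h := by
    rw [M.energy_dirichletExtension, Real.sqrt_mul M.factor_pos.le, Real.sqrt_sq h0]
  rw [normH, h2, add_mul]
  exact add_le_add_left h1 _

lemma isHarmonic_dirichletExtension (h : HDot k ((1 - a) / (2 - a))) :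
    IsHarmonic (M.dirichletExtension h) := by
  intro χ hχ
  rw [M.weightedGradient_dirichletExtension, ← M.weak_harmonic_tsum (M.summable_of_hDot h) hχ]
  simp only [mul_comm (sqrtWeight _ _ _), mul_assoc]
  simp only [mul_comm (cylDeriv _ _ _)]
  exact integral_finsetSum _ fun l _ =>
    (Lp.memLp _).integrable_mul (hχ.memLp_weight_mul_cylDeriv a l)

/-- By Parseval the squared distance to the datum at height z is ∑ h_i² (f_i(z) - 1)². Each term
tends to 0 and is at most h_i² because 0 ≤ f_i ≤ 1, so dominated convergence applies. -/
lemma hasDirichletTrace (h : HDot k ((1 - a) / (2 - a))) :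
    HasDirichletTrace e (M.dirichletExtension h) h := by
  have hh := M.summable_of_hDot h
  have hs := M.summable_sq hh
  have hlim : Tendsto (fun z => ∑' i, ((h : ℕ → ℝ) i * f i z - (h : ℕ → ℝ) i) ^ 2) (𝓝[>] 0)
    (𝓝 0) := by
    have h1 : Tendsto (fun z => ∑' i, ((h : ℕ → ℝ) i * f i z - (h : ℕ → ℝ) i) ^ 2) (𝓝[>] 0)
        (𝓝 (∑' i, ((h : ℕ → ℝ) i * 1 - (h : ℕ → ℝ) i) ^ 2)) := by
      refine tendsto_tsum_of_dominated_convergence hs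
        (fun i => (((M.profile i).tendsto_zero.const_mul _).sub_const _).pow 2) ?_
      filter_upwards [self_mem_nhdsWithin] with z hz i
      have f0 := (M.profile i).nonneg z hz
      have f1 := (M.profile i).le_one z hz
      rw [Real.norm_of_nonneg (sq_nonneg _),
        show (h : ℕ → ℝ) i * f i z - (h : ℕ → ℝ) i = (h : ℕ → ℝ) i * (f i z - 1) by ring, mul_pow]
      exact mul_le_of_le_one_right (sq_nonneg _) (by nlinarith)
    simpa using h1
  have hlim' : Tendsto (fun z =>
      ENNReal.ofReal √(∑' i, ((h : ℕ → ℝ) i * f i z - (h : ℕ → ℝ) i) ^ 2))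
      heightToZero (𝓝 0) := by
    simpa using ENNReal.tendsto_ofReal ((hlim.mono_left heightToZero_le).sqrt)
  refine hlim'.congr' ?_
  filter_upwards [eventually_heightToZero (M.slice_tsum_mode hh),
    eventually_heightToZero (ae_restrict_mem measurableSet_Ioi)] with z h1 hz
  have hz1 := M.summable_slice_sq hh hz
  have hd : Summable fun i => ((h : ℕ → ℝ) i * f i z - (h : ℕ → ℝ) i) ^ 2 := by
    refine ((hz1.add hs).mul_left 2).of_nonneg_of_le (fun _ => sq_nonneg _) fun i => ?_
    nlinarith [sq_nonneg ((h : ℕ → ℝ) i * f i z + (h : ℕ → ℝ) i)]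
  have e1 : (∑' i, ((h : ℕ → ℝ) i * f i z) • e i : L2 D) - ∑' i, (h : ℕ → ℝ) i • e i
      = ∑' i, ((h : ℕ → ℝ) i * f i z - (h : ℕ → ℝ) i) • e i := by
    simp only [sub_smul]
    exact ((M.basis.summable_smul hz1).tsum_sub (M.basis.summable_smul hs)).symm
  rw [← M.basis.norm_sq_tsum hd, Real.sqrt_sq (norm_nonneg _), ← e1, ofReal_norm,
    Lp.enorm_def]
  refine eLpNorm_congr_ae ?_
  filter_upwards [Lp.coeFn_sub (∑' i, ((h : ℕ → ℝ) i * f i z) • e i : L2 D)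
    (∑' i, (h : ℕ → ℝ) i • e i), h1] with x h2 h3
  rw [h2, Pi.sub_apply, ← h3]
  rfl

/-- The domination for the Neumann trace: since 0 ≤ q_i ≤ κ k_i^ν, the defect of the flux is at most
its boundary value, and k_i^(-ν) (k_i^ν)² = k_i^ν. -/
lemma flux_defect_le (h : ℕ → ℝ) (i : ℕ) {z : ℝ} (hz : 0 < z) :
    k i ^ (-((1 - a) / (2 - a))) * (h i * q i z - κ * k i ^ ((1 - a) / (2 - a)) * h i) ^ 2
      ≤ κ ^ 2 * (k i ^ ((1 - a) / (2 - a)) * h i ^ 2) := by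
  have q0 := (M.profile i).flux_nonneg z hz
  have q1 := (M.profile i).flux_le z hz
  have hkk : k i ^ (-((1 - a) / (2 - a))) * (k i ^ ((1 - a) / (2 - a)) * k i ^ ((1 - a) / (2 - a)))
    = k i ^ ((1 - a) / (2 - a)) := by
    rw [← mul_assoc, ← Real.rpow_add (M.pos i), neg_add_cancel, Real.rpow_zero, one_mul]
  have h1 : (q i z - κ * k i ^ ((1 - a) / (2 - a))) ^ 2 ≤
    (κ * k i ^ ((1 - a) / (2 - a))) ^ 2 := by nlinarith
  calc k i ^ (-((1 - a) / (2 - a))) * (h i * q i z - κ * k i ^ ((1 - a) / (2 - a)) * h i) ^ 2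
      = k i ^ (-((1 - a) / (2 - a))) * h i ^ 2 *
        (q i z - κ * k i ^ ((1 - a) / (2 - a))) ^ 2 := by ring
    _ ≤ k i ^ (-((1 - a) / (2 - a))) * h i ^ 2 * (κ * k i ^ ((1 - a) / (2 - a))) ^ 2 :=
      mul_le_mul_of_nonneg_left h1 (mul_nonneg (M.rpow_pos _ i).le (sq_nonneg _))
    _ = κ ^ 2 * ((k i ^ (-((1 - a) / (2 - a))) *
        (k i ^ ((1 - a) / (2 - a)) * k i ^ ((1 - a) / (2 - a)))) * h i ^ 2) := by ring
    _ = κ ^ 2 * (k i ^ ((1 - a) / (2 - a)) * h i ^ 2) := by rw [hkk]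

lemma flux_defect_nonneg (h : ℕ → ℝ) (z : ℝ) (i : ℕ) :
    0 ≤ k i ^ (-((1 - a) / (2 - a))) * (h i * q i z - κ * k i ^ ((1 - a) / (2 - a)) * h i) ^ 2 :=
  mul_nonneg (M.rpow_pos _ i).le (sq_nonneg _)

lemma tendsto_flux_defect {h : ℕ → ℝ} (hh : Summable fun i => k i ^ ((1 - a) / (2 - a)) * h i ^ 2) :
    Tendsto (fun z => ∑' i, k i ^ (-((1 - a) / (2 - a))) *
      (h i * q i z - κ * k i ^ ((1 - a) / (2 - a)) * h i) ^ 2)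
      (𝓝[>] 0) (𝓝 0) := by
  have h0 : ∑' i, k i ^ (-((1 - a) / (2 - a))) *
      (h i * (κ * k i ^ ((1 - a) / (2 - a))) - κ * k i ^ ((1 - a) / (2 - a)) * h i) ^ 2 = 0 := by
    simp [mul_comm (h _)]
  refine Tendsto.mono_right ?_ (congrArg 𝓝 h0).le
  refine tendsto_tsum_of_dominated_convergence (hh.mul_left (κ ^ 2)) (fun i =>
    ((((M.profile i).flux_tendsto_zero.const_mul _).sub_const _).pow 2).const_mul _) ?_
  filter_upwards [self_mem_nhdsWithin] with z hz i
  rw [Real.norm_of_nonneg (M.flux_defect_nonneg h z i)]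
  exact M.flux_defect_le h i hz

/-- The coefficients of -λ ∂_z Ψ at height z are h_i q_i(z), with limits κ k_i^ν h_i. The
Dirichlet-to-Neumann map is therefore κ times the fractional power ν of -Δ, an isomorphism from Ḣ^ν
onto Ḣ^(-ν). -/
lemma hasNeumannTrace (h : HDot k ((1 - a) / (2 - a))) :
    HasNeumannTrace e k (-((1 - a) / (2 - a))) (M.dirichletExtension h)
      fun i => κ * k i ^ ((1 - a) / (2 - a)) * (h : ℕ → ℝ) i := by
  have hh := M.summable_of_hDot h
  have hlim := ENNReal.tendsto_ofReal ((M.tendsto_flux_defect hh).mono_left heightToZero_le)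
  rw [ENNReal.ofReal_zero] at hlim
  refine hlim.congr' ?_
  filter_upwards [eventually_heightToZero (ae_all_iff.2 (M.sliceCoef_tsum_modeGrad hh)),
    eventually_heightToZero (ae_restrict_mem measurableSet_Ioi)] with z h1 hz
  have hz' : (0 : ℝ) < z := hz
  have e1 : z ^ (a / 2) * z ^ (-(a / 2)) = 1 := by
    rw [← Real.rpow_add hz', add_neg_cancel, Real.rpow_zero]
  rw [sqENormHDot, ENNReal.ofReal_tsum_of_nonneg (M.flux_defect_nonneg _ z)
    ((hh.mul_left (κ ^ 2)).of_nonneg_of_le (M.flux_defect_nonneg _ z)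
      fun i => M.flux_defect_le _ i hz)]
  refine tsum_congr fun i => ?_
  rw [integral_conormal, M.weightedGradient_dirichletExtension, h1 i,
    show -(z ^ (a / 2) * ((h : ℕ → ℝ) i * -(z ^ (-(a / 2)) * q i z)))
      = (h : ℕ → ℝ) i * q i z * (z ^ (a / 2) * z ^ (-(a / 2))) by ring, e1, mul_one]

/-- The Dirichlet datum of the solution with a given Neumann datum. -/
def neumannToDirichlet : HDot k (-((1 - a) / (2 - a))) →ₗ[ℝ] HDot k ((1 - a) / (2 - a)) where
  toFun θ := ⟨fun i => κ⁻¹ * k i ^ (-((1 - a) / (2 - a))) * (θ : ℕ → ℝ) i, by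
    rw [mem_hDot_iff M.pos]
    refine (((mem_hDot_iff M.pos).1 θ.2).mul_left (κ⁻¹ ^ 2)).congr fun i => ?_
    rw [Real.rpow_neg (M.pos i).le]
    field_simp [(M.rpow_pos ((1 - a) / (2 - a)) i).ne']⟩
  map_add' θ θ' := by
    refine Subtype.ext (funext fun i => ?_)
    simp only [Submodule.coe_add, Pi.add_apply, mul_add]
  map_smul' b θ := by
    refine Subtype.ext (funext fun i => ?_)
    simp only [Submodule.coe_smul, Pi.smul_apply, smul_eq_mul, RingHom.id_apply]
    ring

lemma coe_neumannToDirichlet (θ : HDot k (-((1 - a) / (2 - a)))) (i : ℕ) :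
    (M.neumannToDirichlet θ : ℕ → ℝ) i = κ⁻¹ * k i ^ (-((1 - a) / (2 - a))) * (θ : ℕ → ℝ) i := rfl

/-- The multiplier squares to κ⁻² k_i^(-2ν), and k_i^ν k_i^(-2ν) = k_i^(-ν). -/
lemma normHDot_neumannToDirichlet (θ : HDot k (-((1 - a) / (2 - a)))) :
    normHDot (M.neumannToDirichlet θ) = κ⁻¹ * normHDot θ := by
  have h0 : 0 ≤ normHDot θ := Real.sqrt_nonneg _
  have h1 : normHDot (M.neumannToDirichlet θ) ^ 2 = (κ⁻¹ * normHDot θ) ^ 2 := by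
    rw [mul_pow, normHDot_sq M.pos, normHDot_sq M.pos, ← tsum_mul_left]
    refine tsum_congr fun i => ?_
    rw [coe_neumannToDirichlet, Real.rpow_neg (M.pos i).le]
    field_simp [(M.rpow_pos ((1 - a) / (2 - a)) i).ne']
  exact (sq_eq_sq₀ (Real.sqrt_nonneg _) (mul_nonneg (inv_nonneg.2 M.factor_pos.le) h0)).1 h1

lemma hasNeumannTrace_neumannToDirichlet (θ : HDot k (-((1 - a) / (2 - a)))) :
    HasNeumannTrace e k (-((1 - a) / (2 - a))) (M.dirichletExtension (M.neumannToDirichlet θ))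
      θ := by
  have h := M.hasNeumannTrace (M.neumannToDirichlet θ)
  have e1 : (fun i => κ * k i ^ ((1 - a) / (2 - a)) * (M.neumannToDirichlet θ : ℕ → ℝ) i) = θ := by
    funext i
    have := M.factor_pos.ne'
    rw [coe_neumannToDirichlet, Real.rpow_neg (M.pos i).le]
    field_simp [(M.rpow_pos ((1 - a) / (2 - a)) i).ne']
  rwa [e1] at h

lemma eq_of_dirichletTrace {Ψ Φ : SobolevH D a} {h : ℕ → ℝ} (hΨ : IsHarmonic Ψ) (hΦ : IsHarmonic Φ)
    (tΨ : HasDirichletTrace e Ψ h) (tΦ : HasDirichletTrace e Φ h) : Ψ = Φ := by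
  refine eq_of_trace_eq M.weight_lt M.basis M.data M.pos hΨ hΦ fun i => Or.inl ?_
  simpa using (tΨ.tendsto_sliceCoef (e i)).sub (tΦ.tendsto_sliceCoef (e i))

lemma eq_of_neumannTrace {Ψ Φ : SobolevH D a} {s : ℝ} {θ : ℕ → ℝ} (hΨ : IsHarmonic Ψ)
    (hΦ : IsHarmonic Φ) (tΨ : HasNeumannTrace e k s Ψ θ) (tΦ : HasNeumannTrace e k s Φ θ) :
    Ψ = Φ := by
  refine eq_of_trace_eq M.weight_lt M.basis M.data M.pos hΨ hΦ fun i => Or.inr ?_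
  simpa [mul_sub] using (tΨ.tendsto_sliceCoef M.pos i).sub (tΦ.tendsto_sliceCoef M.pos i)

end ModalData

lemma IsEigenbasis.exists_modalData {e : ℕ → L2 D} {k : ℕ → ℝ} (he : IsEigenbasis D e k) {a κ : ℝ}
    (ha : a < 1) (hκ : 0 < κ)
    (hp : ∀ k : ℝ, 0 < k → ∃ f q, IsProfile a k (κ * k ^ ((1 - a) / (2 - a))) f q) :
    ∃ g φ c f q, ModalData D e k g φ a κ c f q := by
  obtain ⟨g, φ, c, hc, hck, hE⟩ := he.exists_eigenData
  choose f q hfq using fun i => hp (k i) (hc.trans_le (hck i))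
  exact ⟨g, φ, c, f, q, ⟨ha, he, hE, hc, hck, hκ, hfq⟩⟩

end Extension

end SingularQG

end

theorem proposition4p5 (a : ℝ) (ha : a < 1) :
    ∃ κ : ℝ, 0 < κ ∧ (a = 0 → κ = 1) ∧
      ∀ (D : SingularQG.HorizontalDomain) (e : ℕ → SingularQG.L2 D) (k : ℕ → ℝ),
        SingularQG.IsEigenbasis D e k →
        ∃ (E₁ : SingularQG.HDot k (-((1 - a) / (2 - a))) →ₗ[ℝ] SingularQG.SobolevH D a)
          (E₂ : SingularQG.HDot k ((1 - a) / (2 - a)) →ₗ[ℝ] SingularQG.SobolevH D a),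
          (∃ C : ℝ, ∀ θ, SingularQG.normH (E₁ θ) ≤ C * SingularQG.normHDot θ) ∧
          (∃ C : ℝ, ∀ h, SingularQG.normH (E₂ h) ≤ C * SingularQG.normHDot h) ∧
          (∀ θ, SingularQG.IsNeumannExtension e θ (E₁ θ) ∧
            ∀ Ψ, SingularQG.IsNeumannExtension e θ Ψ → Ψ = E₁ θ) ∧
          (∀ h, SingularQG.IsDirichletExtension e h (E₂ h) ∧
            ∀ Ψ, SingularQG.IsDirichletExtension e h Ψ → Ψ = E₂ h) ∧
          (∀ θ, SingularQG.energy (E₁ θ) = κ⁻¹ * SingularQG.normHDot θ ^ 2) ∧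
          (∀ h, SingularQG.energy (E₂ h) = κ * SingularQG.normHDot h ^ 2) := by
  obtain ⟨κ, hκ, hκ1, hp⟩ := SingularQG.exists_isProfile a ha
  refine ⟨κ, hκ, hκ1, fun D e k he => ?_⟩
  obtain ⟨g, φ, c, f, q, M⟩ := he.exists_modalData ha hκ hp
  -- The Neumann problem reduces to the Dirichlet problem with datum κ⁻¹ k_i^(-ν) θ_i; its energy is
  -- κ (κ⁻¹ ‖θ‖)² = κ⁻¹ ‖θ‖².
  refine ⟨M.dirichletExtension ∘ₗ M.neumannToDirichlet, M.dirichletExtension,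
    ⟨(√(κ / c) + √κ) * κ⁻¹, fun θ => ?_⟩, ⟨_, M.normH_dirichletExtension_le⟩,
      fun θ => ⟨⟨?_, ?_⟩, ?_⟩,
    fun h => ⟨⟨M.isHarmonic_dirichletExtension h, M.hasDirichletTrace h⟩, ?_⟩, fun θ => ?_,
    M.energy_dirichletExtension⟩
  · rw [mul_assoc, ← M.normHDot_neumannToDirichlet]
    exact M.normH_dirichletExtension_le _
  · exact M.isHarmonic_dirichletExtension _
  · exact M.hasNeumannTrace_neumannToDirichlet θ
  · rintro Ψ ⟨h1, h2⟩
    exact M.eq_of_neumannTrace h1 (M.isHarmonic_dirichletExtension _) h2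
      (M.hasNeumannTrace_neumannToDirichlet θ)
  · rintro Ψ ⟨h1, h2⟩
    exact M.eq_of_dirichletTrace h1 (M.isHarmonic_dirichletExtension h) h2 (M.hasDirichletTrace h)
  · rw [LinearMap.comp_apply, M.energy_dirichletExtension, M.normHDot_neumannToDirichlet, mul_pow]
    field_simp
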